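/- Let $p$ be a prime, let $d^Nx$ be the Haar measure on $\mathbb{Q}_p^N$ with $\mathrm{vol}(\mathbb{Z}_p^N)=1$, let $\chi_p(y)=e^{2\pi i\{y\}_p}$, and write $\mathcal{F}\varphi(\xi)=\int\chi_p(-\xi\cdot x)\varphi(x)\,d^Nx$; for a finite signed measure $\nu$ on $\mathbb{Q}_p^N$, $\mathcal{F}\nu(\xi)=\int\chi_p(-\xi\cdot x)\,\nu(dx)$. Let $\mathcal{D}$ (resp. $\mathcal{D}_{\mathbb{R}}$) be the space of complex-valued (resp. real-valued) locally constant functions with compact support on $\mathbb{Q}_p^N$. **Noise.** Let $\Lambda$ and $\mu$ be regular (non-negative) Borel measures on $\mathbb{Q}_p^N$ such that $\Lambda$ is the Fourier transform of $\mu$, that is, $\int\varphi\,d\Lambda=\int\mathcal{F}\varphi\,d\mu$ for all $\varphi\in\mathcal{D}$ (for example $\Lambda(dx)=f(x)\,d^Nx$ with a non-negative kernel $f$ that is continuous off $0$, or $\Lambda=\delta_0$ for white noise). On a complete probability space $(\Omega,\mathcal{A},P)$ let $W(\varphi)$ be mean zero Gaussian random variables, indexed by the linear combinations $\varphi$ of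 functions $1_I(t)\phi(x)$ with $I\subset\mathbb{R}$ a bounded interval and $\phi\in\mathcal{D}_{\mathbb{R}}$, with covariance $$E\big(W(\varphi)W(\psi)\big)=\int_0^\infty\int_{\mathbb{Q}_p^N}\Big(\int_{\mathbb{Q}_p^N}\varphi(t,x)\psi(t,x-z)\,d^Nx\Big)\Lambda(dz)\,dt .$$ Let $U$ be the completion of $\mathcal{D}_{\mathbb{R}}$ for the semi-inner product $\langle\varphi,\psi\rangle_U=\int\mathcal{F}\varphi\,\overline{\mathcal{F}\psi}\,d\mu$; through $\varphi\mapsto\mathcal{F}\varphi$ it is identified with the closure of $\mathcal{F}(\mathcal{D}_{\mathbb{R}})$ in $L^2(\mu)$, and a finite signed measure $\nu$ is said to belong to $U$ if $\mathcal{F}\nu$ belongs to this closure. For $t\ge 0$, the map $\varphi\mapsto W_t(\varphi):=W(1_{[0,t]}\varphi)$, $\varphi\in\mathcal{D}_{\mathbb{R}}$, has a unique continuous linear extension $W_t:U\to L^2(\Omega)$. Let $\mathcal{F}_t$ be the $\sigma$-field generated by $W_s(h)$, $0\le s\le t$, $h\in U$, and the $P$-null sets. Fix $T>0$; the predictable $\sigma$-field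 on $[0,T]\times\Omega$ is generated by the sets $(s,t]\times A$ with $0\le s<t\le T$, $A\in\mathcal{F}_s$. Set $U_T=L^2([0,T];U)$. For a predictable $g\in L^2(\Omega\times[0,T];U)$, the stochastic integral is $g\cdot W=\sum_j\int_0^T\langle g_s,e_j\rangle_U\,dW_s(e_j)$, a series of Itô integrals that converges in $L^2(\Omega)$, where $(e_j)$ is any complete orthonormal basis of $U$. **Hypothesis A.** $(\Gamma(t,dx))_{t\ge0}$ is a (measurable) family of non-negative Borel measures on $\mathbb{Q}_p^N$ with $$\int_0^T\int_{\mathbb{Q}_p^N}|\mathcal{F}\Gamma(t)(\xi)|^2\,d\mu(\xi)\,dt<\infty,\qquad \sup_{0\le t\le T'}\Gamma(t,\mathbb{Q}_p^N)<\infty\ \text{ for all } T'>0 .$$ **Proposition.** Assume that $\Gamma$ satisfies Hypothesis A. Let $Y=\{Y(t,x),(t,x)\in[0,T]\times\mathbb{Q}_p^N\}$ be a real-valued predictable process (jointly measurable for the product of the predictable $\sigma$-field and the Borel $\sigma$-field of $\mathbb{Q}_p^N$) with $$C_Y:=\sup_{(t,x)\in[0,T]\times\mathbb{Q}_p^N}E\big(|Y(t,x)|^2\big)<\infty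 .$$ Then, for $dt\otimes P$-almost every $(t,\omega)$, $G(t)=Y(t,x)\,\Gamma(t,dx)$ is a finite signed measure that belongs to $U$, and $G$ (set equal to $0$ where this fails) is a predictable $U$-valued process in $L^2(\Omega\times[0,T];U)$. Moreover $$E\big(\|G\|_{U_T}^2\big)=E\Big[\int_0^T\int_{\mathbb{Q}_p^N}|\mathcal{F}(Y(t)\Gamma(t))(\xi)|^2\,d\mu(\xi)\,dt\Big]\le C_Y\int_0^T\int_{\mathbb{Q}_p^N}|\mathcal{F}\Gamma(t)(\xi)|^2\,d\mu(\xi)\,dt,$$ and the stochastic integral $G\cdot W$ exists, is unique in $L^2(\Omega)$, and satisfies $$E\big(|G\cdot W|^2\big)\le\int_0^T\Big(\sup_{x\in\mathbb{Q}_p^N}E\big(|Y(s,x)|^2\big)\Big)\int_{\mathbb{Q}_p^N}|\mathcal{F}\Gamma(s)(\xi)|^2\,d\mu(\xi)\,ds .$$ -/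

import Mathlib

open MeasureTheory ProbabilityTheory Filter Topology
open scoped ENNReal NNReal

noncomputable section

namespace PadicNoise

/-! ### `p`-adic analysis -/

instance instMeasurableSpacePadic (p : ℕ) [Fact p.Prime] : MeasurableSpace ℚ_[p] := borel _

instance instBorelSpacePadic (p : ℕ) [Fact p.Prime] : BorelSpace ℚ_[p] := ⟨rfl⟩

/-- The space `ℚ_p^N`, with the maximum norm and its Borel `σ`-algebra. -/
abbrev Space (p : ℕ) [Fact p.Prime] (N : ℕ) : Type := Fin N → ℚ_[p]

/-- The unit ball `B_0^N = ℤ_p^N` of `ℚ_p^N`. -/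
def unitBall (p : ℕ) [Fact p.Prime] (N : ℕ) :
    TopologicalSpace.PositiveCompacts (Space p N) where
  carrier := Metric.closedBall 0 1
  isCompact' := isCompact_closedBall 0 1
  interior_nonempty' :=
    ⟨0, Metric.ball_subset_interior_closedBall (Metric.mem_ball_self one_pos)⟩

/-- The Haar measure `d^N x` on `ℚ_p^N` with `vol(B_0^N) = 1`. -/
def haar (p : ℕ) [Fact p.Prime] (N : ℕ) : Measure (Space p N) :=
  Measure.addHaarMeasure (unitBall p N)

/-- `p ^ n * y` is a `p`-adic integer for `n = max (-ord y) 0`. -/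
theorem norm_pow_mul_le_one (p : ℕ) [Fact p.Prime] (y : ℚ_[p]) :
    ‖(p : ℚ_[p]) ^ (-y.valuation).toNat * y‖ ≤ 1 := by
  by_cases hy : y = 0
  · simp [hy]
  · have hp : (1 : ℝ) < p := by exact_mod_cast (Fact.out : p.Prime).one_lt
    have hp0 : (p : ℝ) ≠ 0 := by positivity
    rw [norm_mul, norm_pow, Padic.norm_p, Padic.norm_eq_zpow_neg_valuation hy, inv_pow,
      ← zpow_natCast, ← zpow_neg, ← zpow_add₀ hp0]
    apply zpow_le_one_of_nonpos₀ hp.le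
    have := Int.self_le_toNat (-y.valuation)
    omega

/-- The fractional part `{y}_p`: with `n = max (-ord y) 0`, it is `a / p ^ n`, where
`a = ∑_{j < n} a_j p^j` is the truncation of the expansion of the `p`-adic integer `p ^ n y`. -/
def fracPart (p : ℕ) [Fact p.Prime] (y : ℚ_[p]) : ℚ :=
  (PadicInt.appr (⟨(p : ℚ_[p]) ^ (-y.valuation).toNat * y, norm_pow_mul_le_one p y⟩ : ℤ_[p])
    (-y.valuation).toNat : ℚ) / (p : ℚ) ^ (-y.valuation).toNat

/-- The additive character `χ_p(y) = exp(2 π i {y}_p)`. -/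
def chi (p : ℕ) [Fact p.Prime] (y : ℚ_[p]) : ℂ :=
  Complex.exp (2 * Real.pi * Complex.I * (fracPart p y : ℂ))

/-- The Bruhat-Schwartz space of locally constant, compactly supported functions
`ℚ_p^N → 𝕜`, for `𝕜 = ℝ` or `ℂ`. -/
def TestFunction (p : ℕ) [Fact p.Prime] (N : ℕ) (𝕜 : Type) [RCLike 𝕜] :
    Submodule 𝕜 (Space p N → 𝕜) where
  carrier := {φ | IsLocallyConstant φ ∧ HasCompactSupport φ}
  add_mem' := fun ha hb => ⟨ha.1.add hb.1, ha.2.add hb.2⟩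
  zero_mem' := ⟨IsLocallyConstant.const 0, HasCompactSupport.zero⟩
  smul_mem' := fun c _ ha => ⟨ha.1.comp (fun z => c • z), ha.2.comp_left (smul_zero c)⟩

/-- The Fourier transform `(ℱ φ)(ξ) = ∫ χ_p(-ξ · x) φ(x) d^N x`. -/
def fourier {p : ℕ} [Fact p.Prime] {N : ℕ} (φ : Space p N → ℂ) (ξ : Space p N) : ℂ :=
  ∫ x, chi p (-(ξ ⬝ᵥ x)) * φ x ∂(haar p N)

/-- The Fourier transform of the signed measure `y(x) ν(dx)`:
`ξ ↦ ∫ χ_p(-ξ · x) y(x) ν(dx)`. -/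
def fourierMeasure {p : ℕ} [Fact p.Prime] {N : ℕ} (y : Space p N → ℝ)
    (ν : Measure (Space p N)) (ξ : Space p N) : ℂ :=
  ∫ x, chi p (-(ξ ⬝ᵥ x)) * (y x : ℂ) ∂ν

/-- The Fourier transform of the positive distribution given by the measure `ν`. -/
def fourierPos {p : ℕ} [Fact p.Prime] {N : ℕ} (ν : Measure (Space p N)) (ξ : Space p N) : ℂ :=
  fourierMeasure (fun _ => 1) ν ξ

/-! ### The Gaussian noise -/

/-- `ℐ(ℝ)`: linear combinations of indicators of bounded intervals. -/
def StepFunction : Submodule ℝ (ℝ → ℝ) :=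
  Submodule.span ℝ {c | ∃ I : Set ℝ, I.OrdConnected ∧ Bornology.IsBounded I ∧
    c = I.indicator (fun _ => (1 : ℝ))}

/-- `ℐ(ℝ) ⊗_alg 𝒟_ℝ(ℚ_p^N)`, as a space of functions of `(t, x)`. -/
def NoiseTest (p : ℕ) [Fact p.Prime] (N : ℕ) : Submodule ℝ (ℝ → Space p N → ℝ) :=
  Submodule.span ℝ {ψ | ∃ c ∈ StepFunction, ∃ φ ∈ TestFunction p N ℝ, ψ = fun t x => c t * φ x}

/-- The element `(s, x) ↦ 1_{[0,t]}(s) φ(x)`. -/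
def cylTest {p : ℕ} [Fact p.Prime] {N : ℕ} (t : ℝ) (φ : TestFunction p N ℝ) : NoiseTest p N :=
  ⟨fun s x => (Set.Icc (0 : ℝ) t).indicator (fun _ => (1 : ℝ)) s * φ.1 x,
    Submodule.subset_span ⟨_, Submodule.subset_span
      ⟨Set.Icc 0 t, Set.ordConnected_Icc, Metric.isBounded_Icc 0 t, rfl⟩, φ.1, φ.2, rfl⟩⟩

/-- `Λ`, regarded as a distribution, is the Fourier transform of `μ`:
`(Λ, φ) = ∫ ℱ φ dμ` for all test functions. Here `Λ` is the covariance kernel of the noise: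
`Λ(dx) = f(x) d^N x` for a non-negative kernel function `f`, and the Dirac measure at `0`
for white noise. -/
def IsSpectralMeasure {p : ℕ} [Fact p.Prime] {N : ℕ} (Λ μ : Measure (Space p N)) : Prop :=
  ∀ φ : TestFunction p N ℂ, ∫ x, φ.1 x ∂Λ = ∫ ξ, fourier φ.1 ξ ∂μ

/-- `W` is a family of mean zero Gaussian random variables with covariance
`E (W φ W ψ) = ∫_0^∞ ∫ (φ(t) ∗ ψ̃(t))(z) Λ(dz) dt`, where `ψ̃(t)(z) = ψ(t, -z)`. -/
structure IsGaussianNoise {p : ℕ} [Fact p.Prime] {N : ℕ} {Ω : Type*} [MeasurableSpace Ω]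
    (Λ : Measure (Space p N)) (P : Measure Ω) (W : NoiseTest p N → Ω → ℝ) : Prop where
  gaussian : ∀ φ, ∃ v : ℝ≥0, HasLaw (W φ) (gaussianReal 0 v) P
  covariance : ∀ φ ψ : NoiseTest p N, ∫ ω, W φ ω * W ψ ω ∂P =
    ∫ t in Set.Ioi (0 : ℝ), ∫ z, (∫ x, φ.1 t x * ψ.1 t (x - z) ∂(haar p N)) ∂Λ

/-! ### The Hilbert space `U` and the cylindrical Wiener process -/

/-- The completion `U` of `𝒟_ℝ(ℚ_p^N)` for the semi-inner product
`⟨φ, ψ⟩_U = ∫ ℱφ conj(ℱψ) dμ`, realized through `φ ↦ ℱφ` as the closure of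
`{ℱφ | φ ∈ 𝒟_ℝ(ℚ_p^N)}` in the real Hilbert space `L²(μ; ℂ)`. -/
def U {p : ℕ} [Fact p.Prime] {N : ℕ} (μ : Measure (Space p N)) : Submodule ℝ (Lp ℂ 2 μ) :=
  (Submodule.span ℝ {u : Lp ℂ 2 μ | ∃ φ : TestFunction p N ℝ,
    u =ᵐ[μ] fourier (fun x => (φ.1 x : ℂ))}).topologicalClosure

/-- The element of `U` whose Fourier transform is the function `h` (and `0` if there is none). -/
def ofFourier {p : ℕ} [Fact p.Prime] {N : ℕ} (μ : Measure (Space p N)) (h : Space p N → ℂ) :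
    U μ :=
  open Classical in
  if H : ∃ u : U μ, (u : Lp ℂ 2 μ) =ᵐ[μ] h then H.choose else 0

/-- `L` is the extension to `U`, by linearity and continuity, of
`φ ↦ W(1_{[0,t]} φ)`, `φ ∈ 𝒟_ℝ(ℚ_p^N)`. There is at most one, since `𝒟_ℝ(ℚ_p^N)` is dense
in `U`. -/
def IsWienerExtension {p : ℕ} [Fact p.Prime] {N : ℕ} {Ω : Type*} [MeasurableSpace Ω]
    (μ : Measure (Space p N)) (P : Measure Ω) (W : NoiseTest p N → Ω → ℝ) (t : ℝ)
    (L : U μ →L[ℝ] Lp ℝ 2 P) : Prop :=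
  ∀ (φ : TestFunction p N ℝ) (u : U μ),
    (u : Lp ℂ 2 μ) =ᵐ[μ] fourier (fun x => (φ.1 x : ℂ)) → L u =ᵐ[P] W (cylTest t φ)

/-- The cylindrical Wiener process `W_t(h)`, `t ≥ 0`, `h ∈ U`, associated with `W`. -/
def wiener {p : ℕ} [Fact p.Prime] {N : ℕ} {Ω : Type*} [MeasurableSpace Ω]
    (μ : Measure (Space p N)) (P : Measure Ω) (W : NoiseTest p N → Ω → ℝ) (t : ℝ) :
    U μ →L[ℝ] Lp ℝ 2 P :=
  open Classical in
  if H : ∃ L, IsWienerExtension μ P W t L then H.choose else 0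

/-- `ℱ_t`: the `σ`-field generated by `W_s(h)`, `h ∈ U`, `0 ≤ s ≤ t`, and the `P`-null sets. -/
@[reducible]
def sigmaField {p : ℕ} [Fact p.Prime] {N : ℕ} {Ω : Type*} [MeasurableSpace Ω]
    (μ : Measure (Space p N)) (P : Measure Ω) (W : NoiseTest p N → Ω → ℝ) (t : ℝ) :
    MeasurableSpace Ω :=
  (⨆ s ∈ Set.Icc (0 : ℝ) t, ⨆ h : U μ, MeasurableSpace.comap (wiener μ P W s h) (borel ℝ)) ⊔
    MeasurableSpace.generateFrom {A | P A = 0}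

/-- The time interval `[0, T]`. -/
abbrev Time (T : ℝ) : Type := Set.Icc (0 : ℝ) T

/-- The Lebesgue measure `dt` on `[0, T]`. -/
def lebesgue (T : ℝ) : Measure (Time T) := Measure.comap Subtype.val volume

/-- The predictable `σ`-field in `[0, T] × Ω`, generated by the sets `(s, t] × A`,
`A ∈ ℱ_s`, `0 ≤ s < t ≤ T`. -/
@[reducible]
def predictable {p : ℕ} [Fact p.Prime] {N : ℕ} {Ω : Type*} [MeasurableSpace Ω]
    (μ : Measure (Space p N)) (P : Measure Ω) (W : NoiseTest p N → Ω → ℝ) (T : ℝ) :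
    MeasurableSpace (Time T × Ω) :=
  MeasurableSpace.generateFrom {S | ∃ (s t : ℝ) (A : Set Ω), 0 ≤ s ∧ s < t ∧ t ≤ T ∧
    MeasurableSet[sigmaField μ P W s] A ∧ S = {q | s < q.1 ∧ (q.1 : ℝ) ≤ t ∧ q.2 ∈ A}}

/-! ### The stochastic integral -/

/-- A simple process `∑_k X_k 1_{(a_k, b_k]}`, with `0 ≤ a_k < b_k ≤ T` and bounded,
`ℱ_{a_k}`-measurable `X_k`. -/
structure SimpleProcess {p : ℕ} [Fact p.Prime] {N : ℕ} {Ω : Type*} [MeasurableSpace Ω]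
    (μ : Measure (Space p N)) (P : Measure Ω) (W : NoiseTest p N → Ω → ℝ) (T : ℝ) where
  n : ℕ
  a : Fin n → ℝ
  b : Fin n → ℝ
  X : Fin n → Ω → ℝ
  nonneg : ∀ k, 0 ≤ a k
  lt : ∀ k, a k < b k
  le : ∀ k, b k ≤ T
  meas : ∀ k, Measurable[sigmaField μ P W (a k)] (X k)
  bdd : ∀ k, ∃ C : ℝ, ∀ ω, |X k ω| ≤ C

/-- The process `∑_k X_k 1_{(a_k, b_k]}`. -/
def SimpleProcess.eval {p : ℕ} [Fact p.Prime] {N : ℕ} {Ω : Type*} [MeasurableSpace Ω]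
    {μ : Measure (Space p N)} {P : Measure Ω} {W : NoiseTest p N → Ω → ℝ} {T : ℝ}
    (S : SimpleProcess μ P W T) (q : Time T × Ω) : ℝ :=
  ∑ k, (Set.Ioc (S.a k) (S.b k)).indicator (fun _ => S.X k q.2) (q.1 : ℝ)

/-- The Itô integral `∑_k X_k (W_{b_k}(h) - W_{a_k}(h))` of a simple process. -/
def SimpleProcess.integral {p : ℕ} [Fact p.Prime] {N : ℕ} {Ω : Type*} [MeasurableSpace Ω]
    {μ : Measure (Space p N)} {P : Measure Ω} {W : NoiseTest p N → Ω → ℝ} {T : ℝ}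
    (S : SimpleProcess μ P W T) (h : U μ) (ω : Ω) : ℝ :=
  ∑ k, S.X k ω * (wiener μ P W (S.b k) h ω - wiener μ P W (S.a k) h ω)

/-- `I` is the Itô integral `∫_0^T ψ_s dW_s(h)`: the `L²(Ω)` limit of the integrals of simple
processes that converge to `ψ` in `L²([0, T] × Ω)`. -/
def IsItoIntegral {p : ℕ} [Fact p.Prime] {N : ℕ} {Ω : Type*} [MeasurableSpace Ω]
    (μ : Measure (Space p N)) (P : Measure Ω) (W : NoiseTest p N → Ω → ℝ) (T : ℝ)
    (h : U μ) (ψ : Time T × Ω → ℝ) (I : Lp ℝ 2 P) : Prop :=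
  ∃ S : ℕ → SimpleProcess μ P W T,
    Tendsto (fun n => eLpNorm ((S n).eval - ψ) 2 ((lebesgue T).prod P))
      atTop (𝓝 0) ∧
    Tendsto (fun n => eLpNorm ((S n).integral h - ⇑I) 2 P) atTop (𝓝 0)

/-- `I` is the stochastic integral `g · W = ∑_j ∫_0^T ⟨g_s, e_j⟩_U dW_s(e_j)`, the series
converging in `L²(Ω)` to `I` for every complete orthonormal basis `(e_j)` of `U`. -/
def IsStochasticIntegral {p : ℕ} [Fact p.Prime] {N : ℕ} {Ω : Type*} [MeasurableSpace Ω]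
    (μ : Measure (Space p N)) (P : Measure Ω) (W : NoiseTest p N → Ω → ℝ) (T : ℝ)
    (g : Time T × Ω → U μ) (I : Lp ℝ 2 P) : Prop :=
  ∀ (ι : Type) (e : HilbertBasis ι ℝ (U μ)), ∃ J : ι → Lp ℝ 2 P,
    (∀ j, IsItoIntegral μ P W T (e j) (fun q => inner ℝ (g q) (e j)) (J j)) ∧ HasSum J I

/-! ### The integrands -/

/-- Hypothesis A, with time horizon `T`. For `t ≥ 0`, the measure `Γ t` is `Γ(t, d^N x)`, which
stands for the positive distribution `φ ↦ ∫ φ(x) Γ(t, d^N x)`. -/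
structure HypothesisA {p : ℕ} [Fact p.Prime] {N : ℕ} (μ : Measure (Space p N)) (T : ℝ)
    (Γ : ℝ → Measure (Space p N)) : Prop where
  measurable : Measurable (fun t : Set.Ici (0 : ℝ) => Γ t)
  integral_lt_top : (∫⁻ t : Time T, ∫⁻ ξ, ‖fourierPos (Γ t) ξ‖ₑ ^ 2 ∂μ ∂(lebesgue T)) < ⊤
  sup_mass_lt_top : ∀ T' : ℝ, 0 < T' → (⨆ t ∈ Set.Icc (0 : ℝ) T', Γ t Set.univ) < ⊤

/-- A random field `Y(t, x)` is predictable if it is measurable for the product of the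
predictable `σ`-field in `[0, T] × Ω` and the Borel `σ`-field of `ℚ_p^N`. -/
def IsPredictableField {p : ℕ} [Fact p.Prime] {N : ℕ} {Ω : Type*} [MeasurableSpace Ω]
    (μ : Measure (Space p N)) (P : Measure Ω) (W : NoiseTest p N → Ω → ℝ) (T : ℝ)
    (Y : Time T → Space p N → Ω → ℝ) : Prop :=
  Measurable[(predictable μ P W T).prod (MeasurableSpace.pi : MeasurableSpace (Space p N))]
    (fun z : (Time T × Ω) × Space p N => Y z.1.1 z.2 z.1.2)

/-- The `U`-valued process `G(t) = Y(t, x) Γ(t, d^N x)`, identified with an element of `U`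
through its Fourier transform. -/
def integrand {p : ℕ} [Fact p.Prime] {N : ℕ} {Ω : Type*} (μ : Measure (Space p N)) {T : ℝ}
    (Γ : ℝ → Measure (Space p N)) (Y : Time T → Space p N → Ω → ℝ) (q : Time T × Ω) : U μ :=
  ofFourier μ (fourierMeasure (fun x => Y q.1 x q.2) (Γ q.1))

end PadicNoise

end

open MeasureTheory ProbabilityTheory Filter Topology
open scoped ENNReal NNReal

noncomputable section

namespace PadicNoise

/-! ### The additive character of `ℚ_p`. -/

section Character

variable {p : ℕ} [Fact p.Prime]

/-! The heart is one inequality at a fixed time: E∫|ℱ(Yν)|² dμ ≤ sup_x E|Y(x)|² · ∫|ℱν|² dμ for a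
finite measure ν (`lintegral_fourierMeasure_le`). Formally the left side is E∬ Y(x)Y(x') Λ(x-x')
ν(dx)ν(dx'). As Λ and ν are non-negative, E|Y(x)Y(x')| may be replaced by its upper bound, and what
remains is the same expression with Y = 1. Since Λ is only a measure, this is carried out after
cutting the frequencies off at the ball of radius p^n. The ultrametric makes the cutoff exact: the
indicator of that ball is the Fourier transform of the normalised indicator of the dual ball
(`fourier_bump`). Hence the Fourier transform of the restriction of μ to the ball is Λ averaged over
small balls, a non-negative function (`setIntegral_phase`, `smoothKernel`). The inequality holds for
every n, and monotone convergence removes the cutoff.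

Finite expectation makes ℱ(YΓ) square integrable for μ almost surely. Such a measure belongs to U
because restricting it to a ball and convolving with `bump` yields test functions, and both
truncations converge in L²(μ) (`toLp_fourierMeasure_mem`).

For the integral, the covariance identity alone forces W to be linear and isometric into L²(Ω). The
closure of its range consists of centred Gaussian variables, where orthogonality means independence,
so increments of W_t(h) after time a are independent of ℱ_a (`indep_increment`). This gives an Itô
isometry in polarised form, E[∫ψ dW(h) ∫ψ' dW(h')] = ⟨h,h'⟩⟨ψ,ψ'⟩ (`IsItoIntegral.inner_eq`). The
terms of the series over an orthonormal basis are then orthogonal, Bessel's inequality gives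
convergence and the bound by ‖G‖², and the sum does not depend on the basis
(`exists_hasSum_series`). -/

lemma fracPart_spec (y : ℚ_[p]) :
    ∃ (a : ℤ) (n : ℕ), fracPart p y = a / (p : ℚ) ^ n ∧ ‖y - (fracPart p y : ℚ_[p])‖ ≤ 1 := by
  refine ⟨_, _, by rw [fracPart, ← Int.cast_natCast], ?_⟩
  set n := (-y.valuation).toNat
  have hp0 : (p : ℚ_[p]) ≠ 0 := by exact_mod_cast (Fact.out : p.Prime).ne_zero
  set x : ℤ_[p] := ⟨(p : ℚ_[p]) ^ n * y, norm_pow_mul_le_one p y⟩ with hx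
  -- The truncation agrees with p^n y modulo p^n, so dividing by p^n leaves an error in `ℤ_p`.
  have h := PadicInt.appr_spec n x
  rw [← PadicInt.norm_le_pow_iff_mem_span_pow, PadicInt.norm_def] at h
  have e : y - (fracPart p y : ℚ_[p])
      = ((p : ℚ_[p]) ^ n)⁻¹ * ((x - (x.appr n : ℤ_[p]) : ℤ_[p]) : ℚ_[p]) := by
    have hf : fracPart p y = (x.appr n : ℚ) / (p : ℚ) ^ n := rfl
    have hxc : (x : ℚ_[p]) = (p : ℚ_[p]) ^ n * y := rfl
    rw [hf, PadicInt.coe_sub, hxc]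
    push_cast
    field_simp
  rw [e, norm_mul, norm_inv, norm_pow, Padic.norm_p, inv_pow, inv_inv]
  have hp : (0 : ℝ) < p := by exact_mod_cast (Fact.out : p.Prime).pos
  calc (p : ℝ) ^ n * _ ≤ (p : ℝ) ^ n * (p : ℝ) ^ (-n : ℤ) := by gcongr
    _ = 1 := by rw [zpow_neg, zpow_natCast]; field_simp

lemma norm_sub_le_max' {E : Type*} [SeminormedAddCommGroup E] [IsUltrametricDist E] (x y : E) :
    ‖x - y‖ ≤ max ‖x‖ ‖y‖ := by
  simpa [sub_eq_add_neg] using IsUltrametricDist.norm_add_le_max x (-y)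

/-- ℤ[1/p] ∩ ℤ_p = ℤ: the denominator is a power of p, so p-integrality forces p^n to divide a. -/
lemma exists_int_of_norm_le_one {a : ℤ} {n : ℕ} {q : ℚ} (hq : q = a / (p : ℚ) ^ n)
    (h : ‖(q : ℚ_[p])‖ ≤ 1) : ∃ k : ℤ, q = k := by
  have hp : (0 : ℝ) < p := by exact_mod_cast (Fact.out : p.Prime).pos
  have hp0 : (p : ℚ) ≠ 0 := by exact_mod_cast (Fact.out : p.Prime).ne_zero
  have hp0' : (p : ℚ_[p]) ≠ 0 := by exact_mod_cast (Fact.out : p.Prime).ne_zero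
  have e : (a : ℚ_[p]) = (p : ℚ_[p]) ^ n * (q : ℚ_[p]) := by
    rw [hq]; push_cast; field_simp
  have : ‖(a : ℚ_[p])‖ ≤ (p : ℝ) ^ (-n : ℤ) := by
    rw [e, norm_mul, norm_pow, Padic.norm_p, inv_pow, zpow_neg, zpow_natCast]
    exact mul_le_of_le_one_right (by positivity) h
  obtain ⟨k, hk⟩ := (Padic.norm_int_le_pow_iff_dvd a n).1 this
  refine ⟨k, ?_⟩
  rw [hq, hk]
  push_cast
  field_simp

/-- Two representatives in ℤ[1/p] of the same class modulo `ℤ_p` differ by an ordinary integer,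
which the exponential does not see. This freedom of choice gives additivity, triviality on `ℤ_p` and
the value at 1/p. -/
lemma chi_eq_of_norm_sub_le_one {y : ℚ_[p]} {a : ℤ} {n : ℕ} {q : ℚ}
    (hq : q = a / (p : ℚ) ^ n) (h : ‖y - (q : ℚ_[p])‖ ≤ 1) :
    chi p y = Complex.exp (2 * Real.pi * Complex.I * (q : ℂ)) := by
  obtain ⟨b, m, hb, hy⟩ := fracPart_spec y
  have hp0 : (p : ℚ) ≠ 0 := by exact_mod_cast (Fact.out : p.Prime).ne_zero
  have h1 : fracPart p y - q = ((b * p ^ n - a * p ^ m : ℤ) : ℚ) / (p : ℚ) ^ (m + n) := by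
    rw [hb, hq]; push_cast; field_simp; ring
  have h2 : ‖((fracPart p y - q : ℚ) : ℚ_[p])‖ ≤ 1 := by
    have : ((fracPart p y - q : ℚ) : ℚ_[p]) = (y - q) - (y - fracPart p y) := by
      push_cast; ring
    rw [this]
    exact (norm_sub_le_max' _ _).trans (max_le h hy)
  obtain ⟨k, hk⟩ := exists_int_of_norm_le_one h1 h2
  have h3 : ((fracPart p y : ℚ) : ℂ) = q + k := by
    have : fracPart p y = q + k := by linarith
    rw [this]; push_cast; ring
  rw [chi, h3, mul_add, Complex.exp_add]
  have : Complex.exp (2 * Real.pi * Complex.I * (k : ℂ)) = 1 := by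
    rw [mul_comm]; exact Complex.exp_int_mul_two_pi_mul_I k
  rw [this, mul_one]

lemma chi_add (x y : ℚ_[p]) : chi p (x + y) = chi p x * chi p y := by
  obtain ⟨a, m, ha, hx⟩ := fracPart_spec x
  obtain ⟨b, n, hb, hy⟩ := fracPart_spec y
  have hp0 : (p : ℚ) ≠ 0 := by exact_mod_cast (Fact.out : p.Prime).ne_zero
  have h1 : fracPart p x + fracPart p y
      = ((a * p ^ n + b * p ^ m : ℤ) : ℚ) / (p : ℚ) ^ (m + n) := by
    rw [ha, hb]; push_cast; field_simp; ring
  rw [chi_eq_of_norm_sub_le_one h1, chi, chi, ← Complex.exp_add]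
  · congr 1; push_cast; ring
  · have : x + y - ((fracPart p x + fracPart p y : ℚ) : ℚ_[p])
        = (x - fracPart p x) + (y - fracPart p y) := by push_cast; ring
    rw [this]
    exact (IsUltrametricDist.norm_add_le_max _ _).trans (max_le hx hy)

lemma chi_of_norm_le_one {y : ℚ_[p]} (h : ‖y‖ ≤ 1) : chi p y = 1 := by
  rw [chi_eq_of_norm_sub_le_one (q := 0) (a := 0) (n := 0) (by simp) (by simpa using h)]
  simp

lemma chi_zero : chi p 0 = 1 := chi_of_norm_le_one (by simp)

lemma norm_chi (y : ℚ_[p]) : ‖chi p y‖ = 1 := by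
  rw [chi, Complex.norm_exp]
  simp

lemma chi_ne_zero (y : ℚ_[p]) : chi p y ≠ 0 := fun h => by
  have := norm_chi y
  simp [h] at this

lemma chi_neg (y : ℚ_[p]) : chi p (-y) = starRingEnd ℂ (chi p y) := by
  have h : chi p (-y) * chi p y = 1 := by rw [← chi_add]; simp [chi_zero]
  have h' : starRingEnd ℂ (chi p y) * chi p y = 1 := by
    rw [mul_comm, Complex.mul_conj, Complex.normSq_eq_norm_sq, norm_chi]; simp
  exact mul_right_cancel₀ (chi_ne_zero y) (h.trans h'.symm)

/-- Together with triviality on `ℤ_p`, this pins the conductor of the character, which makes the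
duality of balls below exact. -/
lemma chi_inv_prime_ne_one : chi p ((p : ℚ_[p])⁻¹) ≠ 1 := by
  rw [chi_eq_of_norm_sub_le_one (q := (p : ℚ)⁻¹) (a := 1) (n := 1) (by simp) (by simp)]
  intro h
  rw [Complex.exp_eq_one_iff] at h
  obtain ⟨n, hn⟩ := h
  have hp1 : 1 < p := (Fact.out : p.Prime).one_lt
  have hp : (p : ℂ) ≠ 0 := by exact_mod_cast (by lia : p ≠ 0)
  have hpi : (2 * Real.pi * Complex.I : ℂ) ≠ 0 := Complex.two_pi_I_ne_zero
  rw [mul_comm (n : ℂ)] at hn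
  have h1 := mul_left_cancel₀ hpi hn
  push_cast at h1
  field_simp at h1
  have h2 : (1 : ℤ) = p * n := by exact_mod_cast h1
  have h3 : (p : ℤ) ∣ 1 := ⟨n, h2⟩
  have := Int.le_of_dvd one_pos h3
  lia

lemma continuous_chi : Continuous (chi p) := by
  refine continuous_iff_continuousAt.2 fun x => ?_
  have h : chi p =ᶠ[𝓝 x] fun _ => chi p x := by
    filter_upwards [Metric.closedBall_mem_nhds x one_pos] with y hy
    rw [mem_closedBall_iff_norm] at hy
    rw [show y = (y - x) + x by ring, chi_add, chi_of_norm_le_one hy, one_mul]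
  exact continuousAt_const.congr h.symm

end Character

/-! ### Fourier transforms of ball indicators. -/

section Fourier

variable {p : ℕ} [Fact p.Prime] {N : ℕ}

instance : (haar p N).IsAddHaarMeasure := by unfold haar; infer_instance

lemma norm_dotProduct_le (ξ x : Space p N) : ‖ξ ⬝ᵥ x‖ ≤ ‖ξ‖ * ‖x‖ := by
  refine IsUltrametricDist.norm_sum_le_of_forall_le_of_nonneg (by positivity) fun i _ => ?_
  rw [norm_mul]
  gcongr
  · exact norm_le_pi_norm ξ i
  · exact norm_le_pi_norm x i

/-- The phase `χ_p(-ξ · x)` of the Fourier transform. -/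
def phase (ξ x : Space p N) : ℂ := chi p (-(ξ ⬝ᵥ x))

lemma continuous_phase : Continuous fun z : Space p N × Space p N => phase z.1 z.2 :=
  continuous_chi.comp (by unfold dotProduct; fun_prop)

lemma measurable_phase : Measurable fun z : Space p N × Space p N => phase z.1 z.2 :=
  continuous_phase.measurable

lemma continuous_phase_right (ξ : Space p N) : Continuous (phase ξ) :=
  continuous_chi.comp (by unfold dotProduct; fun_prop)

lemma norm_phase (ξ x : Space p N) : ‖phase ξ x‖ = 1 := norm_chi _

lemma phase_add (ξ x y : Space p N) : phase ξ (x + y) = phase ξ x * phase ξ y := by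
  rw [phase, dotProduct_add, neg_add, chi_add]; rfl

lemma phase_neg (ξ x : Space p N) : phase ξ (-x) = starRingEnd ℂ (phase ξ x) := by
  rw [phase, dotProduct_neg, chi_neg]; rfl

lemma phase_sub (ξ x y : Space p N) :
    phase ξ (x - y) = phase ξ x * starRingEnd ℂ (phase ξ y) := by
  rw [sub_eq_add_neg, phase_add, phase_neg]

lemma phase_eq_one {ξ x : Space p N} (h : ‖ξ‖ * ‖x‖ ≤ 1) : phase ξ x = 1 :=
  chi_of_norm_le_one (by rw [norm_neg]; exact (norm_dotProduct_le ξ x).trans h)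

lemma prime_pos_real : (0 : ℝ) < p := by exact_mod_cast (Fact.out : p.Prime).pos

lemma exists_phase_ne_one {n : ℤ} {ξ : Space p N} (h : (p : ℝ) ^ n < ‖ξ‖) :
    ∃ x : Space p N, ‖x‖ ≤ (p : ℝ) ^ (-n) ∧ phase ξ x ≠ 1 := by
  have hp0 : (0 : ℝ) < p := prime_pos_real
  have hp1 : (1 : ℝ) < p := by exact_mod_cast (Fact.out : p.Prime).one_lt
  have hpn : (0 : ℝ) < (p : ℝ) ^ n := zpow_pos hp0 n
  obtain ⟨i, hi⟩ : ∃ i, (p : ℝ) ^ n < ‖ξ i‖ := by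
    by_contra! hc
    exact absurd ((pi_norm_le_iff_of_nonneg hpn.le).2 hc) (not_le.2 h)
  have hi0 : ξ i ≠ 0 := fun h0 => by simp [h0] at hi; linarith
  -- Supported on a large coordinate of ξ and chosen so that -ξ·x = 1/p. Its norm is p/|ξ_i|, and
  -- norms are powers of p, so |ξ_i| > p^n already gives |ξ_i| ≥ p^(n+1).
  refine ⟨Pi.single i (-(p : ℚ_[p])⁻¹ * (ξ i)⁻¹), ?_, ?_⟩
  · rw [Pi.norm_single, norm_mul, norm_neg, norm_inv, norm_inv, Padic.norm_p, inv_inv]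
    rw [Padic.norm_eq_zpow_neg_valuation hi0] at hi ⊢
    have := (zpow_lt_zpow_iff_right₀ hp1).1 hi
    rw [← zpow_neg, neg_neg, ← zpow_one_add₀ hp0.ne']
    exact zpow_le_zpow_right₀ hp1.le (by lia)
  · rw [phase, dotProduct_single]
    convert chi_inv_prime_ne_one (p := p) using 2
    field_simp

lemma fourier_eq (φ : Space p N → ℂ) (ξ : Space p N) :
    fourier φ ξ = ∫ x, phase ξ x * φ x ∂(haar p N) := rfl

lemma fourierMeasure_eq (y : Space p N → ℝ) (ν : Measure (Space p N)) (ξ : Space p N) :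
    fourierMeasure y ν ξ = ∫ x, phase ξ x * (y x : ℂ) ∂ν := rfl

/-- Translation by an invisible h multiplies the transform by `phase ξ h`, and h can be chosen so
that this factor is not 1. -/
lemma fourier_eq_zero {φ : Space p N → ℂ} {n : ℤ}
    (hφ : ∀ x h, ‖h‖ ≤ (p : ℝ) ^ (-n) → φ (x + h) = φ x) {ξ : Space p N}
    (hξ : (p : ℝ) ^ n < ‖ξ‖) : fourier φ ξ = 0 := by
  obtain ⟨h, hh, hne⟩ := exists_phase_ne_one hξ
  have : fourier φ ξ = phase ξ h * fourier φ ξ := by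
    conv_lhs => rw [fourier_eq, ← integral_add_right_eq_self _ h]
    rw [fourier_eq, ← integral_const_mul]
    congr 1 with x
    rw [phase_add, hφ x h hh]; ring
  by_contra h0
  exact hne (mul_right_cancel₀ h0 (by rw [one_mul]; exact this.symm))

attribute [irreducible] phase

/-- The approximate identity `1_{B(0, p^{-n})} / vol B(0, p^{-n})`. -/
def bump (p : ℕ) [Fact p.Prime] (N : ℕ) (n : ℤ) : Space p N → ℝ :=
  (Metric.closedBall 0 ((p : ℝ) ^ (-n))).indicator
    fun _ => ((haar p N).real (Metric.closedBall 0 ((p : ℝ) ^ (-n))))⁻¹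

lemma haar_real_closedBall_pos (n : ℤ) :
    0 < (haar p N).real (Metric.closedBall 0 ((p : ℝ) ^ n)) :=
  ENNReal.toReal_pos (Metric.measure_closedBall_pos _ _ (zpow_pos prime_pos_real n)).ne'
    (isCompact_closedBall _ _).measure_lt_top.ne

lemma bump_nonneg (n : ℤ) (x : Space p N) : 0 ≤ bump p N n x :=
  Set.indicator_nonneg (fun _ _ => by positivity) _

lemma bump_add (n : ℤ) (x : Space p N) {h : Space p N} (hh : ‖h‖ ≤ (p : ℝ) ^ (-n)) :
    bump p N n (x + h) = bump p N n x := by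
  have : x + h ∈ Metric.closedBall (0 : Space p N) ((p : ℝ) ^ (-n)) ↔
      x ∈ Metric.closedBall (0 : Space p N) ((p : ℝ) ^ (-n)) := by
    simp only [mem_closedBall_zero_iff]
    constructor
    · intro h1
      rw [show x = (x + h) - h by abel]
      exact (norm_sub_le_max' _ _).trans (max_le h1 hh)
    · intro h1
      exact (IsUltrametricDist.norm_add_le_max _ _).trans (max_le h1 hh)
  unfold bump
  by_cases hx : x ∈ Metric.closedBall (0 : Space p N) ((p : ℝ) ^ (-n))
  · rw [Set.indicator_of_mem hx, Set.indicator_of_mem (this.2 hx)]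
  · rw [Set.indicator_of_notMem hx, Set.indicator_of_notMem (fun h' => hx (this.1 h'))]

lemma measurable_bump (n : ℤ) : Measurable (bump p N n) :=
  measurable_const.indicator Metric.isClosed_closedBall.measurableSet

lemma integrable_bump (n : ℤ) : Integrable (bump p N n) (haar p N) :=
  (integrable_indicator_iff Metric.isClosed_closedBall.measurableSet).2
    (integrableOn_const (isCompact_closedBall _ _).measure_lt_top.ne)

lemma bump_eq_zero {n : ℤ} {x : Space p N} (hx : (p : ℝ) ^ (-n) < ‖x‖) : bump p N n x = 0 :=
  Set.indicator_of_notMem (by simpa using hx) _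

/-- On the dual ball the phase is 1 throughout the support; off it, invariance under small
translations kills the transform. A sharp frequency cutoff is therefore convolution with a
non-negative function. -/
lemma fourier_bump (n : ℤ) (ξ : Space p N) :
    fourier (fun x => (bump p N n x : ℂ)) ξ =
      (Metric.closedBall 0 ((p : ℝ) ^ n)).indicator (fun _ => 1) ξ := by
  by_cases hξ : ‖ξ‖ ≤ (p : ℝ) ^ n
  · rw [Set.indicator_of_mem (by simpa using hξ)]
    have h1 : ∀ x, phase ξ x * (bump p N n x : ℂ) = (bump p N n x : ℂ) := by
      intro x
      by_cases hx : ‖x‖ ≤ (p : ℝ) ^ (-n)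
      · rw [phase_eq_one, one_mul]
        calc ‖ξ‖ * ‖x‖ ≤ (p : ℝ) ^ n * (p : ℝ) ^ (-n) := by gcongr
          _ = 1 := by rw [← zpow_add₀ prime_pos_real.ne']; simp
      · simp [bump_eq_zero (not_le.1 hx)]
    rw [fourier_eq]
    simp_rw [h1]
    rw [integral_complex_ofReal, bump, integral_indicator_const _
      Metric.isClosed_closedBall.measurableSet, smul_eq_mul,
      mul_inv_cancel₀ (haar_real_closedBall_pos _).ne', Complex.ofReal_one]
  · rw [Set.indicator_of_notMem (by simpa using hξ)]
    refine fourier_eq_zero (n := n) (fun x h hh => ?_) (not_le.1 hξ)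
    rw [bump_add n x hh]

end Fourier

/-! ### Test functions, their transforms, and their density in U. -/

section TestFunction

variable {p : ℕ} [Fact p.Prime] {N : ℕ} {𝕜 : Type} [RCLike 𝕜]

lemma exists_zpow_neg_lt {ε : ℝ} (hε : 0 < ε) : ∃ n : ℤ, (p : ℝ) ^ (-n) < ε := by
  have hp1 : (1 : ℝ) < p := by exact_mod_cast (Fact.out : p.Prime).one_lt
  obtain ⟨n, hn⟩ := exists_pow_lt_of_lt_one hε (inv_lt_one_of_one_lt₀ hp1)
  exact ⟨n, by simpa [zpow_neg] using hn⟩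

lemma TestFunction.exists_add_eq (φ : TestFunction p N 𝕜) :
    ∃ n : ℤ, ∀ x h, ‖h‖ ≤ (p : ℝ) ^ (-n) → φ.1 (x + h) = φ.1 x := by
  obtain ⟨φ, hl, hc⟩ := φ
  -- The level sets form an open cover of the compact support; a Lebesgue number gives one scale of
  -- constancy valid on all of it.
  obtain ⟨δ, hδ, H⟩ := lebesgue_number_lemma_of_metric (c := fun y => φ ⁻¹' {y}) hc
    (fun y => hl {y}) (fun x _ => Set.mem_iUnion.2 ⟨φ x, rfl⟩)
  obtain ⟨n, hn⟩ := exists_zpow_neg_lt (p := p) hδ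
  have key : ∀ x ∈ tsupport φ, ∀ h, ‖h‖ ≤ (p : ℝ) ^ (-n) → φ (x + h) = φ x := by
    intro x hx h hh
    obtain ⟨y, hy⟩ := H x hx
    have h1 : φ x = y := hy (Metric.mem_ball_self hδ)
    have h2 : φ (x + h) = y := hy (by rw [mem_ball_iff_norm]; simpa using hh.trans_lt hn)
    rw [h1, h2]
  refine ⟨n, fun x h hh => ?_⟩
  change φ (x + h) = φ x
  by_cases hx : x ∈ tsupport φ
  · exact key x hx h hh
  -- The translate may enter the support; then one starts from x + h and moves back by -h.
  · by_cases hx' : x + h ∈ tsupport φ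
    · simpa using (key _ hx' (-h) (by simpa using hh)).symm
    · rw [image_eq_zero_of_notMem_tsupport hx, image_eq_zero_of_notMem_tsupport hx']

lemma TestFunction.exists_eq_zero (φ : TestFunction p N 𝕜) :
    ∃ R : ℝ, ∀ x, R < ‖x‖ → φ.1 x = 0 := by
  obtain ⟨R, hR⟩ := φ.2.2.isBounded.exists_norm_le
  refine ⟨R, fun x hx => ?_⟩
  by_contra h
  exact absurd (hR x (subset_tsupport _ h)) (not_le.2 hx)

lemma mem_testFunction {φ : Space p N → 𝕜} {n : ℤ} {R : ℝ}
    (h1 : ∀ x h, ‖h‖ ≤ (p : ℝ) ^ (-n) → φ (x + h) = φ x) (h2 : ∀ x, R < ‖x‖ → φ x = 0) :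
    φ ∈ TestFunction p N 𝕜 := by
  refine ⟨(IsLocallyConstant.iff_eventually_eq _).2 fun x => ?_,
    HasCompactSupport.intro (isCompact_closedBall 0 R) fun x hx => h2 x (by simpa using hx)⟩
  filter_upwards [Metric.closedBall_mem_nhds x (zpow_pos (prime_pos_real (p := p)) (-n))] with y hy
  rw [mem_closedBall_iff_norm] at hy
  simpa using h1 x (y - x) hy

lemma TestFunction.continuous (φ : TestFunction p N 𝕜) : Continuous φ.1 := φ.2.1.continuous

lemma TestFunction.integrable (φ : TestFunction p N 𝕜) (ν : Measure (Space p N))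
    [IsFiniteMeasureOnCompacts ν] : Integrable φ.1 ν :=
  (TestFunction.continuous φ).integrable_of_hasCompactSupport φ.2.2

/-- A real test function, viewed as a complex one. -/
def TestFunction.toComplex (φ : TestFunction p N ℝ) : TestFunction p N ℂ :=
  ⟨fun x => (φ.1 x : ℂ), φ.2.1.comp Complex.ofReal, φ.2.2.comp_left Complex.ofReal_zero⟩

lemma measurable_fourier (φ : TestFunction p N ℂ) : Measurable (fourier φ.1) := by
  have h : Measurable fun z : Space p N × Space p N => phase z.1 z.2 * φ.1 z.2 :=
    measurable_phase.mul ((TestFunction.continuous φ).measurable.comp measurable_snd)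
  simp_rw [funext (fourier_eq φ.1)]
  exact (h.stronglyMeasurable.integral_prod_right (ν := haar p N)).measurable

lemma norm_fourier_le (φ : Space p N → ℂ) (ξ : Space p N) :
    ‖fourier φ ξ‖ ≤ ∫ x, ‖φ x‖ ∂(haar p N) := by
  rw [fourier_eq]
  refine (norm_integral_le_integral_norm _).trans_eq ?_
  congr 1 with x
  rw [norm_mul, norm_phase, one_mul]

/-- A bounded measurable function with bounded support belongs to every `L^q`. -/
lemma memLp_of_bounded_support {μ : Measure (Space p N)} [IsFiniteMeasureOnCompacts μ]
    {q : ℝ≥0∞} {f : Space p N → ℂ} {R C : ℝ} (hf : AEStronglyMeasurable f μ)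
    (hC : ∀ ξ, ‖f ξ‖ ≤ C) (hR : ∀ ξ, R < ‖ξ‖ → f ξ = 0) : MemLp f q μ := by
  have e : f = (Metric.closedBall 0 R).indicator f := by
    ext ξ
    by_cases h : ‖ξ‖ ≤ R
    · rw [Set.indicator_of_mem (by simpa using h)]
    · rw [Set.indicator_of_notMem (by simpa using h), hR ξ (not_le.1 h)]
  rw [e, memLp_indicator_iff_restrict Metric.isClosed_closedBall.measurableSet]
  have : IsFiniteMeasure (μ.restrict (Metric.closedBall 0 R)) :=
    ⟨by simpa using (isCompact_closedBall _ _).measure_lt_top⟩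
  exact MemLp.of_bound hf.restrict C (.of_forall hC)

/-- The transform is bounded and, by local constancy at a uniform scale, vanishes outside a ball, so
finiteness of μ on compact sets is enough. -/
lemma memLp_fourier (μ : Measure (Space p N)) [IsFiniteMeasureOnCompacts μ]
    (φ : TestFunction p N ℂ) (q : ℝ≥0∞) : MemLp (fourier φ.1) q μ := by
  obtain ⟨n, hn⟩ := TestFunction.exists_add_eq φ
  exact memLp_of_bounded_support (measurable_fourier φ).aestronglyMeasurable
    (norm_fourier_le φ.1) (fun ξ => fourier_eq_zero hn)

lemma integrable_phase_mul {ν : Measure (Space p N)} {f : Space p N → ℂ} (hf : Integrable f ν)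
    (ξ : Space p N) : Integrable (fun x => phase ξ x * f x) ν :=
  hf.bdd_mul (continuous_phase_right ξ).aestronglyMeasurable
    (.of_forall fun x => (norm_phase ξ x).le)

lemma fourier_add (φ ψ : TestFunction p N ℂ) :
    fourier (φ + ψ).1 = fourier φ.1 + fourier ψ.1 := by
  ext ξ
  rw [Pi.add_apply, fourier_eq, fourier_eq, fourier_eq, ← integral_add
    (integrable_phase_mul (TestFunction.integrable φ _) ξ) (integrable_phase_mul (TestFunction.integrable ψ _) ξ)]
  congr 1 with x
  exact mul_add _ _ _

lemma fourier_smul (c : ℝ) (φ : Space p N → ℂ) :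
    fourier (fun x => (c : ℂ) * φ x) = c • fourier φ := by
  ext ξ
  rw [Pi.smul_apply, fourier_eq, fourier_eq, Complex.real_smul, ← integral_const_mul]
  congr 1 with x
  ring

variable (μ : Measure (Space p N)) [IsFiniteMeasureOnCompacts μ]

/-- The map `φ ↦ ℱφ` from the real test functions to `L²(μ)`. -/
def fourierLp : TestFunction p N ℝ →ₗ[ℝ] Lp ℂ 2 μ where
  toFun φ := (memLp_fourier μ (TestFunction.toComplex φ) 2).toLp _
  map_add' φ ψ := by
    rw [← MemLp.toLp_add]
    congr 1
    rw [← fourier_add]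
    congr 1 with x
    exact Complex.ofReal_add _ _
  map_smul' c φ := by
    rw [RingHom.id_apply, ← MemLp.toLp_const_smul]
    congr 1
    rw [← fourier_smul]
    congr 1 with x
    exact Complex.ofReal_mul _ _

lemma coeFn_fourierLp (φ : TestFunction p N ℝ) :
    fourierLp μ φ =ᵐ[μ] fourier (fun x => (φ.1 x : ℂ)) :=
  MemLp.coeFn_toLp (memLp_fourier μ (TestFunction.toComplex φ) 2)

lemma fourierLp_mem (φ : TestFunction p N ℝ) : fourierLp μ φ ∈ U μ :=
  Submodule.le_topologicalClosure _ (Submodule.subset_span ⟨φ, coeFn_fourierLp μ φ⟩)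

/-- The canonical map from the real test functions to their completion `U`. -/
def toU : TestFunction p N ℝ →ₗ[ℝ] U μ :=
  (fourierLp μ).codRestrict (U μ) (fourierLp_mem μ)

lemma coeFn_toU (φ : TestFunction p N ℝ) :
    (toU μ φ : Lp ℂ 2 μ) =ᵐ[μ] fourier (fun x => (φ.1 x : ℂ)) := coeFn_fourierLp μ φ

variable {μ} in
lemma eq_toU {φ : TestFunction p N ℝ} {u : U μ}
    (h : (u : Lp ℂ 2 μ) =ᵐ[μ] fourier (fun x => (φ.1 x : ℂ))) : u = toU μ φ :=
  Subtype.ext (Lp.ext (h.trans (coeFn_toU μ φ).symm))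

lemma denseRange_toU : DenseRange (toU μ) := by
  have hs : {u : Lp ℂ 2 μ | ∃ φ : TestFunction p N ℝ,
      u =ᵐ[μ] fourier (fun x => (φ.1 x : ℂ))} = LinearMap.range (fourierLp μ) := by
    ext u
    constructor
    · rintro ⟨φ, h⟩
      exact ⟨φ, Lp.ext ((coeFn_fourierLp μ φ).trans h.symm)⟩
    · rintro ⟨φ, rfl⟩
      exact ⟨φ, coeFn_fourierLp μ φ⟩
  intro u
  rw [closure_subtype, ← Set.range_comp]
  obtain ⟨u, hu⟩ := u
  rw [U, hs, Submodule.span_eq, ← SetLike.mem_coe, Submodule.topologicalClosure_coe] at hu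
  exact hu

end TestFunction

/-! ### The covariance as an inner product of U. -/

section Covariance

variable {p : ℕ} [Fact p.Prime] {N : ℕ}

/-- The correlation `z ↦ ∫ φ(x) ψ(x - z) dx` of two test functions. -/
def correlation (φ ψ : TestFunction p N ℂ) : TestFunction p N ℂ :=
  ⟨fun z => ∫ x, φ.1 x * ψ.1 (x - z) ∂(haar p N), by
    obtain ⟨n, hn⟩ := TestFunction.exists_add_eq ψ
    obtain ⟨R, hR⟩ := TestFunction.exists_eq_zero φ
    obtain ⟨R', hR'⟩ := TestFunction.exists_eq_zero ψ
    refine mem_testFunction (n := n) (R := max R R') (fun z h hh => ?_) (fun z hz => ?_)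
    · congr 1 with x
      rw [show x - (z + h) = (x - z) + -h by abel, hn _ _ (by simpa using hh)]
    · refine integral_eq_zero_of_ae (.of_forall fun x => ?_)
      by_contra hx
      have hx1 : ‖x‖ ≤ R := not_lt.1 fun h => hx (by simp [hR x h])
      have hx2 : ‖x - z‖ ≤ R' := not_lt.1 fun h => hx (by simp [hR' _ h])
      refine absurd hz (not_lt.2 ?_)
      rw [show z = x - (x - z) by abel]
      exact (norm_sub_le_max' _ _).trans (max_le_max hx1 hx2)⟩

lemma fourier_correlation (φ ψ : TestFunction p N ℝ) (ξ : Space p N) :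
    fourier (correlation (TestFunction.toComplex φ) (TestFunction.toComplex ψ)).1 ξ =
      fourier (fun x => (φ.1 x : ℂ)) ξ * starRingEnd ℂ (fourier (fun x => (ψ.1 x : ℂ)) ξ) := by
  have hint : Integrable (Function.uncurry fun z x : Space p N =>
      phase ξ z * ((φ.1 x : ℂ) * (ψ.1 (x - z) : ℂ))) ((haar p N).prod (haar p N)) := by
    obtain ⟨R, hR⟩ := TestFunction.exists_eq_zero φ
    obtain ⟨R', hR'⟩ := TestFunction.exists_eq_zero ψ
    refine Continuous.integrable_of_hasCompactSupport ?_ ?_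
    · have h1 := continuous_phase_right ξ
      have h2 := TestFunction.continuous φ
      have h3 := TestFunction.continuous ψ
      exact (h1.comp continuous_fst).mul ((Complex.continuous_ofReal.comp
        (h2.comp continuous_snd)).mul (Complex.continuous_ofReal.comp
          (h3.comp (continuous_snd.sub continuous_fst))))
    · refine HasCompactSupport.intro ((isCompact_closedBall 0 (max R R')).prod
        (isCompact_closedBall 0 R)) ?_
      rintro ⟨z, x⟩ hzx
      by_contra hx
      have hx1 : ‖x‖ ≤ R := not_lt.1 fun h => hx (by simp [hR x h])
      have hx2 : ‖x - z‖ ≤ R' := not_lt.1 fun h => hx (by simp [hR' _ h])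
      refine hzx ⟨?_, by simpa using hx1⟩
      rw [mem_closedBall_zero_iff]
      change ‖z‖ ≤ _
      rw [show z = x - (x - z) by abel]
      exact (norm_sub_le_max' _ _).trans (max_le_max hx1 hx2)
  calc fourier (correlation (TestFunction.toComplex φ) (TestFunction.toComplex ψ)).1 ξ
      = ∫ z, ∫ x, phase ξ z * ((φ.1 x : ℂ) * (ψ.1 (x - z) : ℂ)) ∂(haar p N) ∂(haar p N) := by
        rw [fourier_eq]
        congr 1 with z
        rw [integral_const_mul]; rfl
    _ = ∫ x, ∫ z, phase ξ z * ((φ.1 x : ℂ) * (ψ.1 (x - z) : ℂ)) ∂(haar p N) ∂(haar p N) :=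
        integral_integral_swap hint
    _ = ∫ x, phase ξ x * (φ.1 x : ℂ) *
          starRingEnd ℂ (fourier (fun x => (ψ.1 x : ℂ)) ξ) ∂(haar p N) := by
        congr 1 with x
        rw [← integral_sub_left_eq_self _ _ x, fourier_eq, ← integral_conj, ← integral_const_mul]
        congr 1 with w
        rw [phase_sub, map_mul, Complex.conj_ofReal, sub_sub_cancel]
        ring
    _ = _ := by rw [integral_mul_const, ← fourier_eq]

variable {Λ μ : Measure (Space p N)} [IsFiniteMeasureOnCompacts μ]

/-- The spectral relation tested on the correlation, whose transform is ℱφ · conj(ℱψ). It turns the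
covariance of the noise at each time into the inner product of U. -/
lemma integral_correlation (hμ : IsSpectralMeasure Λ μ) (φ ψ : TestFunction p N ℝ) :
    ∫ z, (∫ x, φ.1 x * ψ.1 (x - z) ∂(haar p N)) ∂Λ = inner ℝ (toU μ φ) (toU μ ψ) := by
  have h := hμ (correlation (TestFunction.toComplex φ) (TestFunction.toComplex ψ))
  simp_rw [fourier_correlation] at h
  have h1 : ∀ z, (correlation (TestFunction.toComplex φ) (TestFunction.toComplex ψ)).1 z =
      ((∫ x, φ.1 x * ψ.1 (x - z) ∂(haar p N) : ℝ) : ℂ) := by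
    intro z
    rw [← integral_complex_ofReal]
    refine integral_congr_ae (.of_forall fun x => ?_)
    exact (Complex.ofReal_mul _ _).symm
  simp_rw [h1] at h
  rw [integral_complex_ofReal] at h
  have hint : Integrable (fun ξ => fourier (fun x => (φ.1 x : ℂ)) ξ *
      starRingEnd ℂ (fourier (fun x => (ψ.1 x : ℂ)) ξ)) μ :=
    (memLp_fourier μ (TestFunction.toComplex φ) 2).integrable_mul (memLp_fourier μ (TestFunction.toComplex ψ) 2).star
  have h2 := congrArg Complex.re h
  rw [Complex.ofReal_re, ← RCLike.re_eq_complex_re, ← integral_re hint] at h2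
  rw [h2, Submodule.coe_inner, L2.inner_def]
  refine integral_congr_ae ?_
  filter_upwards [coeFn_toU μ φ, coeFn_toU μ ψ] with ξ h3 h4
  rw [h3, h4, Complex.inner]
  simp [mul_comm]

end Covariance

/-! ### Convergence in `L²` within closed subspaces. -/

section L2

variable {α E : Type*} {m : MeasurableSpace α} {μ : Measure α} [NormedAddCommGroup E]

lemma eLpNorm_two_sq (f : α → E) : eLpNorm f 2 μ ^ 2 = ∫⁻ a, ‖f a‖ₑ ^ 2 ∂μ := by
  have h := eLpNorm_nnreal_pow_eq_lintegral (f := f) (μ := μ) (p := 2) (by simp)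
  simpa using! h

lemma memLp_two_iff {f : α → E} (hf : AEStronglyMeasurable f μ) :
    MemLp f 2 μ ↔ ∫⁻ a, ‖f a‖ₑ ^ 2 ∂μ < ⊤ := by
  rw [← eLpNorm_two_sq, MemLp, and_iff_right hf]
  simp

/-- Dominated convergence in `L²`, for membership in a closed subspace. -/
lemma toLp_mem_of_dominated {K : Submodule ℝ (Lp ℂ 2 μ)} (hK : IsClosed (K : Set (Lp ℂ 2 μ)))
    {f : ℕ → α → ℂ} {g : α → ℂ} {b : α → ℂ} (hf : ∀ n, MemLp (f n) 2 μ) (hg : MemLp g 2 μ)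
    (hb : MemLp b 2 μ) (hfb : ∀ n a, ‖f n a‖ ≤ ‖b a‖)
    (hlim : ∀ a, Tendsto (fun n => f n a) atTop (𝓝 (g a)))
    (hmem : ∀ n, (hf n).toLp ∈ K) : hg.toLp ∈ K := by
  refine hK.mem_of_tendsto (f := fun n => (hf n).toLp) (b := atTop) ?_ (.of_forall hmem)
  rw [Lp.tendsto_Lp_iff_tendsto_eLpNorm'' f hf g hg]
  have hgb : ∀ a, ‖g a‖ ≤ ‖b a‖ := fun a =>
    le_of_tendsto (hlim a).norm (.of_forall fun n => hfb n a)
  have h2 : Tendsto (fun n => ∫⁻ a, ‖(f n - g) a‖ₑ ^ 2 ∂μ) atTop (𝓝 (∫⁻ _, 0 ∂μ)) := by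
    refine tendsto_lintegral_of_dominated_convergence' (fun a => (2 * ‖b a‖ₑ) ^ 2)
      (fun n => ((hf n).1.sub hg.1).enorm.pow_const 2) (fun n => .of_forall fun a => ?_) ?_
      (.of_forall fun a => ?_)
    · dsimp only
      gcongr
      calc ‖f n a - g a‖ₑ ≤ ‖f n a‖ₑ + ‖g a‖ₑ := enorm_sub_le
        _ ≤ ‖b a‖ₑ + ‖b a‖ₑ := by
          gcongr
          · exact enorm_le_iff_norm_le.2 (hfb n a)
          · exact enorm_le_iff_norm_le.2 (hgb a)
        _ = _ := by rw [two_mul]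
    · simp_rw [mul_pow]
      rw [lintegral_const_mul' _ _ (by simp)]
      exact ENNReal.mul_ne_top (by simp) ((memLp_two_iff hb.1).1 hb).ne
    · have : Tendsto (fun n => f n a - g a) atTop (𝓝 0) := by
        simpa using (hlim a).sub_const (g a)
      have h := ((continuous_enorm.tendsto _).comp this)
      have := (ENNReal.continuous_pow 2).tendsto _ |>.comp h
      simpa [Function.comp_def] using this
  have h3 : Tendsto (fun n => eLpNorm (f n - g) 2 μ ^ 2) atTop (𝓝 0) := by
    simp_rw [eLpNorm_two_sq]; simpa using h2
  have := ((ENNReal.continuous_rpow_const (y := 1 / 2)).tendsto _).comp h3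
  simp only [Function.comp_def, ← ENNReal.rpow_natCast, ← ENNReal.rpow_mul] at this
  norm_num at this
  exact this

end L2

/-! ### Signed measures with transform in `L²(μ)` belong to U. -/

section Smoothing

variable {p : ℕ} [Fact p.Prime] {N : ℕ}

lemma norm_fourierMeasure_le (y : Space p N → ℝ) (ν : Measure (Space p N)) (ξ : Space p N) :
    ‖fourierMeasure y ν ξ‖ ≤ ∫ x, |y x| ∂ν := by
  rw [fourierMeasure_eq]
  refine (norm_integral_le_integral_norm _).trans_eq ?_
  congr 1 with x
  rw [norm_mul, norm_phase, one_mul, Complex.norm_real, Real.norm_eq_abs]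

/-- The phase has modulus one, so it cannot repair a lack of integrability, and the integral takes
its default value 0. Upper bounds on transforms thus need no integrability assumption. -/
lemma fourierMeasure_of_not_integrable {y : Space p N → ℝ} {ν : Measure (Space p N)}
    (hy : Measurable y) (h : ¬ Integrable y ν) : fourierMeasure y ν = 0 := by
  ext ξ
  rw [fourierMeasure_eq]
  refine integral_undef fun hi => h ?_
  refine hi.norm.mono' hy.aestronglyMeasurable (.of_forall fun x => ?_)
  rw [norm_mul, norm_phase, one_mul, Complex.norm_real]

/-- Joint measurability of `(a, ξ) ↦ ℱ(y_a κ_a)(ξ)`. -/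
lemma measurable_fourierMeasure {α : Type*} [MeasurableSpace α] (κ : Kernel α (Space p N))
    [IsSFiniteKernel κ] {y : α → Space p N → ℝ} (hy : Measurable (Function.uncurry y)) :
    Measurable fun z : α × Space p N => fourierMeasure (y z.1) (κ z.1) z.2 := by
  have h : Measurable fun w : (α × Space p N) × Space p N =>
      phase w.1.2 w.2 * (y w.1.1 w.2 : ℂ) :=
    (measurable_phase.comp ((measurable_snd.comp measurable_fst).prodMk measurable_snd)).mul
      (Complex.measurable_ofReal.comp
        (hy.comp ((measurable_fst.comp measurable_fst).prodMk measurable_snd)))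
  simp_rw [fourierMeasure_eq]
  exact (h.stronglyMeasurable.integral_kernel_prod_right'
    (κ := κ.comap Prod.fst measurable_fst)).measurable

lemma measurable_fourierMeasure_right (ν : Measure (Space p N)) [SFinite ν] {y : Space p N → ℝ}
    (hy : Measurable y) : Measurable (fourierMeasure y ν) := by
  have h : Measurable fun z : Space p N × Space p N => phase z.1 z.2 * (y z.2 : ℂ) :=
    measurable_phase.mul (Complex.measurable_ofReal.comp (hy.comp measurable_snd))
  simp_rw [funext (fourierMeasure_eq y ν)]
  exact (h.stronglyMeasurable.integral_prod_right (ν := ν)).measurable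

/-- The convolution of `y ν` with the approximate identity. -/
def smooth (n : ℤ) (y : Space p N → ℝ) (ν : Measure (Space p N)) (w : Space p N) : ℝ :=
  ∫ x, bump p N n (w - x) * y x ∂ν

lemma smooth_mem {n : ℤ} {y : Space p N → ℝ} {ν : Measure (Space p N)} {R : ℝ}
    (hR : ∀ x, R < ‖x‖ → y x = 0) : smooth n y ν ∈ TestFunction p N ℝ := by
  refine mem_testFunction (n := n) (R := max R ((p : ℝ) ^ (-n))) (fun w h hh => ?_) fun w hw => ?_
  · unfold smooth
    congr 1 with x
    rw [show w + h - x = (w - x) + h by abel, bump_add n _ hh]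
  · refine integral_eq_zero_of_ae (.of_forall fun x => ?_)
    by_contra hx
    have hx1 : ‖x‖ ≤ R := not_lt.1 fun h => hx (by simp [hR x h])
    have hx2 : ‖w - x‖ ≤ (p : ℝ) ^ (-n) := not_lt.1 fun h => hx (by simp [bump_eq_zero h])
    refine absurd hw (not_lt.2 ?_)
    rw [show w = x + (w - x) by abel]
    exact (IsUltrametricDist.norm_add_le_max _ _).trans (max_le_max hx1 hx2)

lemma fourier_bump_sub (n : ℤ) (x ξ : Space p N) :
    fourier (fun w => (bump p N n (w - x) : ℂ)) ξ =
      phase ξ x * (Metric.closedBall 0 ((p : ℝ) ^ n)).indicator (fun _ => 1) ξ := by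
  rw [← fourier_bump, fourier_eq, ← integral_add_right_eq_self _ x, fourier_eq,
    ← integral_const_mul]
  congr 1 with w
  rw [add_sub_cancel_right, phase_add]; ring

/-- Convolution becomes a product, and the transform of `bump` is exactly the indicator of the dual
ball. -/
lemma fourier_smooth (n : ℤ) {y : Space p N → ℝ} {ν : Measure (Space p N)} [IsFiniteMeasure ν]
    (hy : Measurable y) (hi : Integrable y ν) :
    fourier (fun w => (smooth n y ν w : ℂ)) =
      (Metric.closedBall 0 ((p : ℝ) ^ n)).indicator (fourierMeasure y ν) := by
  ext ξ
  have hm : Measurable fun z : Space p N × Space p N =>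
      phase ξ z.2 * ((bump p N n (z.2 - z.1) : ℂ) * (y z.1 : ℂ)) :=
    ((continuous_phase_right ξ).measurable.comp measurable_snd).mul
      ((Complex.measurable_ofReal.comp ((measurable_bump n).comp
        (measurable_snd.sub measurable_fst))).mul
        (Complex.measurable_ofReal.comp (hy.comp measurable_fst)))
  have hint : Integrable (Function.uncurry fun x w : Space p N =>
      phase ξ w * ((bump p N n (w - x) : ℂ) * (y x : ℂ))) (ν.prod (haar p N)) := by
    refine (integrable_prod_iff hm.aestronglyMeasurable).2 ⟨.of_forall fun x => ?_, ?_⟩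
    · have h : Integrable (fun w => bump p N n (w - x)) (haar p N) :=
        (integrable_bump n).comp_sub_right x
      have h' : Integrable (fun w => (bump p N n (w - x) : ℂ) * (y x : ℂ)) (haar p N) :=
        h.ofReal.mul_const _
      exact integrable_phase_mul h' ξ
    · have : ∀ x, ∫ w, ‖phase ξ w * ((bump p N n (w - x) : ℂ) * (y x : ℂ))‖ ∂(haar p N)
          = (∫ w, bump p N n w ∂(haar p N)) * |y x| := by
        intro x
        rw [← integral_sub_right_eq_self (bump p N n) x, ← integral_mul_const]
        congr 1 with w
        rw [norm_mul, norm_phase, one_mul, norm_mul, Complex.norm_real, Complex.norm_real,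
          Real.norm_eq_abs, Real.norm_eq_abs, abs_of_nonneg (bump_nonneg _ _)]
      exact (hi.abs.const_mul (∫ w, bump p N n w ∂(haar p N))).congr
        (.of_forall fun x => (this x).symm)
  calc fourier (fun w => (smooth n y ν w : ℂ)) ξ
      = ∫ w, ∫ x, phase ξ w * ((bump p N n (w - x) : ℂ) * (y x : ℂ)) ∂ν ∂(haar p N) := by
        rw [fourier_eq]
        congr 1 with w
        rw [integral_const_mul, smooth, ← integral_complex_ofReal]
        push_cast; rfl
    _ = ∫ x, ∫ w, phase ξ w * ((bump p N n (w - x) : ℂ) * (y x : ℂ)) ∂(haar p N) ∂ν :=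
        (integral_integral_swap hint).symm
    _ = ∫ x, phase ξ x * (y x : ℂ) *
          (Metric.closedBall 0 ((p : ℝ) ^ n)).indicator (fun _ => 1) ξ ∂ν := by
        congr 1 with x
        rw [mul_right_comm, ← fourier_bump_sub, fourier_eq, ← integral_mul_const]
        congr 1 with w
        ring
    _ = _ := by
        rw [integral_mul_const, ← fourierMeasure_eq]
        by_cases h : ξ ∈ Metric.closedBall (0 : Space p N) ((p : ℝ) ^ n) <;> simp [h]

lemma exists_nat_norm_le (ξ : Space p N) : ∃ n : ℕ, ‖ξ‖ ≤ (p : ℝ) ^ (n : ℤ) := by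
  have hp1 : (1 : ℝ) < p := by exact_mod_cast (Fact.out : p.Prime).one_lt
  obtain ⟨n, hn⟩ := pow_unbounded_of_one_lt ‖ξ‖ hp1
  exact ⟨n, by simpa using hn.le⟩

lemma closedBall_zpow_mono {E : Type*} [SeminormedAddCommGroup E] :
    Monotone fun n : ℕ => Metric.closedBall (0 : E) ((p : ℝ) ^ (n : ℤ)) := fun m n h =>
  Metric.closedBall_subset_closedBall (zpow_le_zpow_right₀
    (by exact_mod_cast (Fact.out : p.Prime).one_lt.le) (by exact_mod_cast h))

lemma eventually_mem_closedBall (ξ : Space p N) :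
    ∀ᶠ n : ℕ in atTop, ξ ∈ Metric.closedBall (0 : Space p N) ((p : ℝ) ^ (n : ℤ)) := by
  obtain ⟨n, hn⟩ := exists_nat_norm_le ξ
  filter_upwards [eventually_ge_atTop n] with k hk
  exact closedBall_zpow_mono hk (by simpa using hn)

variable {μ : Measure (Space p N)} [IsFiniteMeasureOnCompacts μ]

/-- If `y ν` is a finite signed measure whose Fourier transform is in `L²(μ)`, then it belongs
to `U`. -/
lemma toLp_fourierMeasure_mem {y : Space p N → ℝ} {ν : Measure (Space p N)} [IsFiniteMeasure ν]
    (hy : Measurable y) (hi : Integrable y ν) (hF : MemLp (fourierMeasure y ν) 2 μ) :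
    hF.toLp ∈ U μ := by
  set B : ℕ → Set (Space p N) := fun n => Metric.closedBall (0 : Space p N) ((p : ℝ) ^ (n : ℤ))
  have hB : ∀ n, MeasurableSet (B n) := fun n => Metric.isClosed_closedBall.measurableSet
  have hU : IsClosed (U μ : Set (Lp ℂ 2 μ)) := Submodule.isClosed_topologicalClosure _
  -- Outer limit: the frequency cutoff is removed, with the full transform itself as dominating
  -- function.
  refine toLp_mem_of_dominated hU (f := fun n => (B n).indicator (fourierMeasure y ν))
    (fun n => hF.indicator (hB n)) hF hF (fun n ξ => norm_indicator_le_norm_self _ _)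
    (fun ξ => ?_) fun n => ?_
  · refine tendsto_const_nhds.congr' ?_
    filter_upwards [eventually_mem_closedBall ξ] with n hn
    exact (Set.indicator_of_mem hn _).symm
  -- Inner limit, with n fixed: y is cut off to balls in space. The resulting transforms need not be
  -- dominated by that of y, but all are bounded by the total variation of y ν, and constants are
  -- square integrable on `B n`.
  have hym : ∀ m, Measurable ((B m).indicator y) := fun m => hy.indicator (hB m)
  have him : ∀ m, Integrable ((B m).indicator y) ν := fun m => hi.indicator (hB m)
  have hb : MemLp ((B n).indicator fun _ => ((∫ x, |y x| ∂ν : ℝ) : ℂ)) 2 μ :=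
    memLp_indicator_const _ (hB n) _ (.inr (isCompact_closedBall _ _).measure_lt_top.ne)
  have hle : ∀ m ξ, ‖(B n).indicator (fourierMeasure ((B m).indicator y) ν) ξ‖ ≤
      ‖(B n).indicator (fun _ => ((∫ x, |y x| ∂ν : ℝ) : ℂ)) ξ‖ := by
    intro m ξ
    by_cases hξ : ξ ∈ B n
    · rw [Set.indicator_of_mem hξ, Set.indicator_of_mem hξ, Complex.norm_real, Real.norm_eq_abs]
      refine (norm_fourierMeasure_le _ _ _).trans ((integral_mono (him m).abs hi.abs
        fun x => ?_).trans (le_abs_self _))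
      simpa using norm_indicator_le_norm_self (s := B m) y x
    · simp [hξ]
  have hf : ∀ m, MemLp ((B n).indicator (fourierMeasure ((B m).indicator y) ν)) 2 μ := fun m =>
    hb.mono (((measurable_fourierMeasure_right ν (hym m)).indicator
      (hB n)).aestronglyMeasurable) (.of_forall (hle m))
  refine toLp_mem_of_dominated hU hf (hF.indicator (hB n)) hb hle (fun ξ => ?_) fun m => ?_
  · by_cases hξ : ξ ∈ B n
    · simp only [hξ, Set.indicator_of_mem, fourierMeasure_eq]
      refine tendsto_integral_of_dominated_convergence (fun x => |y x|) (fun m => ?_) hi.abs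
        (fun m => .of_forall fun x => ?_) (.of_forall fun x => ?_)
      · exact (integrable_phase_mul (him m).ofReal ξ).1
      · rw [norm_mul, norm_phase, one_mul, Complex.norm_real]
        exact norm_indicator_le_norm_self (s := B m) y x
      · refine tendsto_const_nhds.congr' ?_
        filter_upwards [eventually_mem_closedBall x] with m hm
        rw [Set.indicator_of_mem hm]
    · simp [hξ]
  · have hR : ∀ x, (p : ℝ) ^ (m : ℤ) < ‖x‖ → (B m).indicator y x = 0 := fun x hx =>
      Set.indicator_of_notMem (by simpa [B] using hx) _
    -- Smoothing the piece of bounded support gives a test function whose transform is exactly the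
    -- doubly truncated one.
    have h := fourierLp_mem μ (⟨_, smooth_mem (n := n) (ν := ν) hR⟩ : TestFunction p N ℝ)
    convert h using 1
    refine Lp.ext ((MemLp.coeFn_toLp (hf m)).trans ?_)
    refine (Filter.EventuallyEq.of_eq ?_).trans (coeFn_fourierLp μ _).symm
    exact (fourier_smooth n (hym m) (him m)).symm

end Smoothing

/-! ### The fundamental estimate, from positivity of Λ. -/

section Positivity

variable {p : ℕ} [Fact p.Prime] {N : ℕ} {Λ μ : Measure (Space p N)}

/-- The smoothed covariance kernel `z ↦ (Λ ∗ δ_n)(z)`. -/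
def smoothKernel (Λ : Measure (Space p N)) (n : ℤ) (z : Space p N) : ℝ :=
  ∫ w, bump p N n (w - z) ∂Λ

lemma smoothKernel_nonneg (n : ℤ) (z : Space p N) : 0 ≤ smoothKernel Λ n z :=
  integral_nonneg fun _ => bump_nonneg _ _

lemma measurable_smoothKernel (n : ℤ) : Measurable (smoothKernel Λ n) := by
  refine Continuous.measurable (IsLocallyConstant.continuous ?_)
  refine (IsLocallyConstant.iff_eventually_eq _).2 fun z => ?_
  filter_upwards [Metric.closedBall_mem_nhds z (zpow_pos (prime_pos_real (p := p)) (-n))] with z' hz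
  rw [mem_closedBall_iff_norm'] at hz
  unfold smoothKernel
  congr 1 with w
  rw [show w - z' = (w - z) + (z - z') by abel, bump_add n _ hz]

lemma bump_sub_mem (n : ℤ) (z : Space p N) :
    (fun w => (bump p N n (w - z) : ℂ)) ∈ TestFunction p N ℂ := by
  refine mem_testFunction (n := n) (R := max ‖z‖ ((p : ℝ) ^ (-n))) (fun w h hh => ?_)
    fun w hw => ?_
  · rw [show w + h - z = (w - z) + h by abel, bump_add n _ hh]
  · by_contra hx
    have hx2 : ‖w - z‖ ≤ (p : ℝ) ^ (-n) := not_lt.1 fun h => hx (by simp [bump_eq_zero h])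
    refine absurd hw (not_lt.2 ?_)
    nth_rewrite 1 [show w = z + (w - z) by abel]
    exact (IsUltrametricDist.norm_add_le_max _ _).trans (max_le_max le_rfl hx2)

/-- The spectral relation applied to the bump centred at z, whose transform is the phase times the
ball indicator. Non-negativity of Λ enters here: the truncated transform of μ is a non-negative
function. -/
lemma setIntegral_phase (hμ : IsSpectralMeasure Λ μ) (n : ℤ) (z : Space p N) :
    ∫ ξ in Metric.closedBall 0 ((p : ℝ) ^ n), phase ξ z ∂μ = (smoothKernel Λ n z : ℂ) := by
  have h := hμ ⟨_, bump_sub_mem n z⟩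
  simp_rw [fourier_bump_sub] at h
  rw [smoothKernel, ← integral_complex_ofReal, h,
    ← integral_indicator Metric.isClosed_closedBall.measurableSet]
  congr 1 with ξ
  by_cases hξ : ξ ∈ Metric.closedBall (0 : Space p N) ((p : ℝ) ^ n) <;> simp [hξ]

lemma lintegral_eq_iSup_closedBall (f : Space p N → ℝ≥0∞) :
    ∫⁻ ξ, f ξ ∂μ = ⨆ n : ℕ, ∫⁻ ξ in Metric.closedBall 0 ((p : ℝ) ^ (n : ℤ)), f ξ ∂μ := by
  rw [← setLIntegral_iUnion_of_directed f closedBall_zpow_mono.directed_le]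
  have : (⋃ n : ℕ, Metric.closedBall (0 : Space p N) ((p : ℝ) ^ (n : ℤ))) = Set.univ :=
    Set.eq_univ_of_forall fun ξ => Set.mem_iUnion.2 (by simpa using exists_nat_norm_le ξ)
  rw [this, setLIntegral_univ]

variable [IsFiniteMeasureOnCompacts μ]

/-- The square expands into a double integral against ν ⊗ ν. On the ball μ is finite, so Fubini
applies and leaves the smoothed kernel; integrability of the double integral comes with it. -/
lemma setIntegral_norm_fourierMeasure_sq (hμ : IsSpectralMeasure Λ μ) (n : ℤ)
    {ν : Measure (Space p N)} [IsFiniteMeasure ν] {y : Space p N → ℝ} (hi : Integrable y ν) :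
    Integrable (fun z : Space p N × Space p N =>
      y z.1 * y z.2 * smoothKernel Λ n (z.1 - z.2)) (ν.prod ν) ∧
    ∫ ξ in Metric.closedBall 0 ((p : ℝ) ^ n), ‖fourierMeasure y ν ξ‖ ^ 2 ∂μ =
      ∫ z, y z.1 * y z.2 * smoothKernel Λ n (z.1 - z.2) ∂(ν.prod ν) := by
  set B := Metric.closedBall (0 : Space p N) ((p : ℝ) ^ n)
  have : IsFiniteMeasure (μ.restrict B) := ⟨by simpa using (isCompact_closedBall _ _).measure_lt_top⟩
  have h1 : ∀ ξ, ((‖fourierMeasure y ν ξ‖ ^ 2 : ℝ) : ℂ) =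
      ∫ z, phase ξ (z.1 - z.2) * ((y z.1 : ℂ) * (y z.2 : ℂ)) ∂(ν.prod ν) := by
    intro ξ
    rw [← Complex.normSq_eq_norm_sq, ← Complex.mul_conj, fourierMeasure_eq, ← integral_conj,
      ← integral_prod_mul]
    congr 1 with z
    rw [phase_sub, map_mul, Complex.conj_ofReal]; ring
  have hyy : Integrable (fun z : Space p N × Space p N => (y z.1 : ℂ) * (y z.2 : ℂ))
      (ν.prod ν) := hi.ofReal.mul_prod hi.ofReal
  have hm : Measurable fun w : Space p N × (Space p N × Space p N) => phase w.1 (w.2.1 - w.2.2) :=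
    measurable_phase.comp (measurable_fst.prodMk
      ((measurable_fst.comp measurable_snd).sub (measurable_snd.comp measurable_snd)))
  have hint : Integrable (Function.uncurry fun (ξ : Space p N) (z : Space p N × Space p N) =>
      phase ξ (z.1 - z.2) * ((y z.1 : ℂ) * (y z.2 : ℂ))) ((μ.restrict B).prod (ν.prod ν)) := by
    have h2 : Integrable (fun w : Space p N × (Space p N × Space p N) =>
        (1 : ℂ) * ((y w.2.1 : ℂ) * (y w.2.2 : ℂ))) ((μ.restrict B).prod (ν.prod ν)) :=
      (integrable_const (1 : ℂ)).mul_prod hyy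
    simp_rw [one_mul] at h2
    exact h2.bdd_mul hm.aestronglyMeasurable (c := 1) (.of_forall fun w => (norm_phase _ _).le)
  have h3 : ∀ z : Space p N × Space p N,
      ∫ ξ in B, phase ξ (z.1 - z.2) * ((y z.1 : ℂ) * (y z.2 : ℂ)) ∂μ =
        ((y z.1 * y z.2 * smoothKernel Λ n (z.1 - z.2) : ℝ) : ℂ) := by
    intro z
    rw [integral_mul_const, setIntegral_phase hμ]
    push_cast; ring
  constructor
  · have h4 := hint.integral_prod_right
    simp only [Function.uncurry_apply_pair] at h4
    simp_rw [h3] at h4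
    simpa using h4.re
  · apply Complex.ofReal_injective
    rw [← integral_complex_ofReal, ← integral_complex_ofReal]
    simp_rw [h1]
    rw [integral_integral_swap hint]
    simp_rw [h3]

lemma setLIntegral_enorm_fourierMeasure_sq (n : ℤ)
    {ν : Measure (Space p N)} [IsFiniteMeasure ν] {y : Space p N → ℝ} (hy : Measurable y) :
    ∫⁻ ξ in Metric.closedBall 0 ((p : ℝ) ^ n), ‖fourierMeasure y ν ξ‖ₑ ^ 2 ∂μ =
      ENNReal.ofReal
        (∫ ξ in Metric.closedBall 0 ((p : ℝ) ^ n), ‖fourierMeasure y ν ξ‖ ^ 2 ∂μ) := by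
  set B := Metric.closedBall (0 : Space p N) ((p : ℝ) ^ n)
  have : IsFiniteMeasure (μ.restrict B) := ⟨by simpa using (isCompact_closedBall _ _).measure_lt_top⟩
  rw [ofReal_integral_eq_lintegral_ofReal]
  · congr 1 with ξ
    rw [ENNReal.ofReal_pow (norm_nonneg _), ofReal_norm]
  · refine Integrable.of_bound
      ((measurable_fourierMeasure_right ν hy).norm.pow_const 2).aestronglyMeasurable
      ((∫ x, |y x| ∂ν) ^ 2) (.of_forall fun ξ => ?_)
    rw [Real.norm_eq_abs, abs_of_nonneg (by positivity)]
    gcongr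
    exact norm_fourierMeasure_le y ν ξ
  · exact .of_forall fun ξ => by positivity

lemma setLIntegral_fourierMeasure_le (hμ : IsSpectralMeasure Λ μ) (n : ℤ)
    {ν : Measure (Space p N)} [IsFiniteMeasure ν] {y : Space p N → ℝ} (hy : Measurable y) :
    ∫⁻ ξ in Metric.closedBall 0 ((p : ℝ) ^ n), ‖fourierMeasure y ν ξ‖ₑ ^ 2 ∂μ ≤
      ∫⁻ z, ‖y z.1‖ₑ * ‖y z.2‖ₑ * ENNReal.ofReal (smoothKernel Λ n (z.1 - z.2)) ∂(ν.prod ν) := by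
  by_cases hi : Integrable y ν
  · rw [setLIntegral_enorm_fourierMeasure_sq n hy,
      (setIntegral_norm_fourierMeasure_sq hμ n hi).2]
    refine (Real.ofReal_le_enorm _).trans ((enorm_integral_le_lintegral_enorm _).trans_eq ?_)
    congr 1 with z
    rw [enorm_mul, enorm_mul, Real.enorm_eq_ofReal (smoothKernel_nonneg _ _)]
  · simp [fourierMeasure_of_not_integrable hy hi]

/-- For y = 1 nothing is lost by taking absolute values, because the kernel is non-negative. This
equality converts the final bound back into ℱν. -/
lemma setLIntegral_fourierPos (hμ : IsSpectralMeasure Λ μ) (n : ℤ)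
    {ν : Measure (Space p N)} [IsFiniteMeasure ν] :
    ∫⁻ ξ in Metric.closedBall 0 ((p : ℝ) ^ n), ‖fourierPos ν ξ‖ₑ ^ 2 ∂μ =
      ∫⁻ z, ENNReal.ofReal (smoothKernel Λ n (z.1 - z.2)) ∂(ν.prod ν) := by
  have h := setIntegral_norm_fourierMeasure_sq hμ n (integrable_const (μ := ν) (1 : ℝ))
  simp_rw [one_mul] at h
  rw [← ofReal_integral_eq_lintegral_ofReal h.1 (.of_forall fun z => smoothKernel_nonneg _ _),
    ← h.2, ← setLIntegral_enorm_fourierMeasure_sq n measurable_const]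
  rfl

lemma ENNReal.two_mul_mul_le_sq_add_sq (a b : ℝ≥0∞) : 2 * (a * b) ≤ a ^ 2 + b ^ 2 := by
  wlog h : a ≤ b generalizing a b
  · rw [mul_comm a, add_comm]
    exact this b a (not_le.1 h).le
  obtain ⟨c, rfl⟩ := exists_add_of_le h
  calc 2 * (a * (a + c)) ≤ 2 * (a * (a + c)) + c ^ 2 := le_self_add
    _ = _ := by ring

/-- The fundamental estimate: `E ∫ |ℱ(Y ν)|² dμ ≤ sup_x E|Y(x)|² ∫ |ℱν|² dμ`. -/
lemma lintegral_fourierMeasure_le {Ω : Type*} [MeasurableSpace Ω] (P : Measure Ω) [SFinite P]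
    [SFinite μ] (hμ : IsSpectralMeasure Λ μ) {ν : Measure (Space p N)} [IsFiniteMeasure ν]
    {Y : Ω → Space p N → ℝ} (hY : Measurable (Function.uncurry Y)) :
    ∫⁻ ω, ∫⁻ ξ, ‖fourierMeasure (Y ω) ν ξ‖ₑ ^ 2 ∂μ ∂P ≤
      (⨆ x, ∫⁻ ω, ‖Y ω x‖ₑ ^ 2 ∂P) * ∫⁻ ξ, ‖fourierPos ν ξ‖ₑ ^ 2 ∂μ := by
  set S := ⨆ x, ∫⁻ ω, ‖Y ω x‖ₑ ^ 2 ∂P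
  have hmF : Measurable fun z : Ω × Space p N => ‖fourierMeasure (Y z.1) ν z.2‖ₑ ^ 2 :=
    (measurable_fourierMeasure (Kernel.const Ω ν) hY).enorm.pow_const 2
  have hYx : ∀ x, Measurable fun ω => Y ω x := fun x =>
    hY.comp (measurable_id.prodMk measurable_const)
  -- The inequality 2ab ≤ a² + b² serves in place of Cauchy-Schwarz; the bound is uniform in both
  -- points, and S may be infinite.
  have hE : ∀ x x', ∫⁻ ω, ‖Y ω x‖ₑ * ‖Y ω x'‖ₑ ∂P ≤ S := by
    intro x x'
    have h2 : 2 * ∫⁻ ω, ‖Y ω x‖ₑ * ‖Y ω x'‖ₑ ∂P ≤ 2 * S := by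
      rw [← lintegral_const_mul' _ _ (by simp)]
      calc _ ≤ ∫⁻ ω, (‖Y ω x‖ₑ ^ 2 + ‖Y ω x'‖ₑ ^ 2) ∂P :=
            lintegral_mono fun ω => ENNReal.two_mul_mul_le_sq_add_sq _ _
        _ = (∫⁻ ω, ‖Y ω x‖ₑ ^ 2 ∂P) + ∫⁻ ω, ‖Y ω x'‖ₑ ^ 2 ∂P :=
            lintegral_add_left ((hYx x).enorm.pow_const 2) _
        _ ≤ S + S := add_le_add (le_iSup (fun x => ∫⁻ ω, ‖Y ω x‖ₑ ^ 2 ∂P) x)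
            (le_iSup (fun x => ∫⁻ ω, ‖Y ω x‖ₑ ^ 2 ∂P) x')
        _ = 2 * S := (two_mul S).symm
    exact (ENNReal.mul_le_mul_iff_right (by simp) (by simp)).1 h2
  -- The kernel is non-negative and not random, so the expectation passes to the product Y(x)Y(x')
  -- alone, where `hE` bounds it.
  have key : ∀ n : ℤ, ∫⁻ ω, ∫⁻ ξ in Metric.closedBall 0 ((p : ℝ) ^ n),
      ‖fourierMeasure (Y ω) ν ξ‖ₑ ^ 2 ∂μ ∂P ≤
        S * ∫⁻ ξ in Metric.closedBall 0 ((p : ℝ) ^ n), ‖fourierPos ν ξ‖ₑ ^ 2 ∂μ := by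
    intro n
    have hk : Measurable fun z : Space p N × Space p N =>
        ENNReal.ofReal (smoothKernel Λ n (z.1 - z.2)) :=
      ((measurable_smoothKernel n).comp (measurable_fst.sub measurable_snd)).ennreal_ofReal
    have hm1 : Measurable fun w : Ω × (Space p N × Space p N) => ‖Y w.1 w.2.1‖ₑ * ‖Y w.1 w.2.2‖ₑ :=
      (hY.comp (measurable_fst.prodMk (measurable_fst.comp measurable_snd))).enorm.mul
        (hY.comp (measurable_fst.prodMk (measurable_snd.comp measurable_snd))).enorm
    have hm2 : Measurable fun w : Ω × (Space p N × Space p N) => ‖Y w.1 w.2.1‖ₑ * ‖Y w.1 w.2.2‖ₑ *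
        ENNReal.ofReal (smoothKernel Λ n (w.2.1 - w.2.2)) := hm1.mul (hk.comp measurable_snd)
    calc _ ≤ ∫⁻ ω, ∫⁻ z, ‖Y ω z.1‖ₑ * ‖Y ω z.2‖ₑ *
          ENNReal.ofReal (smoothKernel Λ n (z.1 - z.2)) ∂(ν.prod ν) ∂P :=
          lintegral_mono fun ω => setLIntegral_fourierMeasure_le hμ n
            (hY.comp (measurable_const.prodMk measurable_id))
      _ = ∫⁻ z, ∫⁻ ω, ‖Y ω z.1‖ₑ * ‖Y ω z.2‖ₑ *
          ENNReal.ofReal (smoothKernel Λ n (z.1 - z.2)) ∂P ∂(ν.prod ν) :=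
          lintegral_lintegral_swap hm2.aemeasurable
      _ ≤ ∫⁻ z, S * ENNReal.ofReal (smoothKernel Λ n (z.1 - z.2)) ∂(ν.prod ν) := by
          refine lintegral_mono fun z => ?_
          rw [lintegral_mul_const' _ _ (by simp)]
          gcongr
          exact hE _ _
      _ = _ := by rw [lintegral_const_mul _ hk, setLIntegral_fourierPos hμ]
  calc _ = ∫⁻ ω, ⨆ n : ℕ, ∫⁻ ξ in Metric.closedBall 0 ((p : ℝ) ^ (n : ℤ)),
        ‖fourierMeasure (Y ω) ν ξ‖ₑ ^ 2 ∂μ ∂P := by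
        simp_rw [← lintegral_eq_iSup_closedBall]
    _ = ⨆ n : ℕ, ∫⁻ ω, ∫⁻ ξ in Metric.closedBall 0 ((p : ℝ) ^ (n : ℤ)),
        ‖fourierMeasure (Y ω) ν ξ‖ₑ ^ 2 ∂μ ∂P := by
        refine lintegral_iSup (fun n => hmF.lintegral_prod_right') fun m n h ω => ?_
        exact lintegral_mono_set (closedBall_zpow_mono h)
    _ ≤ _ := iSup_le fun n => (key n).trans (by gcongr; exact Measure.restrict_le_self)

end Positivity

/-! ### Measurability of U-valued maps given by their transforms. -/

section OfFourier

variable {p : ℕ} [Fact p.Prime] {N : ℕ} {μ : Measure (Space p N)}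

lemma coeFn_ofFourier {h : Space p N → ℂ} (H : ∃ u : U μ, (u : Lp ℂ 2 μ) =ᵐ[μ] h) :
    (ofFourier μ h : Lp ℂ 2 μ) =ᵐ[μ] h := by
  rw [ofFourier, dif_pos H]
  exact H.choose_spec

/-- In a second countable space every open set is a countable union of balls, so distances to fixed
points determine measurability. -/
lemma measurable_of_edist {α X : Type*} [MeasurableSpace α] [PseudoEMetricSpace X]
    [SecondCountableTopology X] [MeasurableSpace X] [BorelSpace X] {f : α → X}
    (hf : ∀ x, Measurable fun a => edist (f a) x) : Measurable f := by
  refine measurable_of_isOpen fun s hs => ?_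
  obtain ⟨T, hT, hTs⟩ := TopologicalSpace.isOpen_iUnion_countable
    (fun b : {b : X × ℝ≥0∞ // Metric.eball b.1 b.2 ⊆ s} => Metric.eball b.1.1 b.1.2)
    (fun _ => Metric.isOpen_eball)
  have : s = ⋃ i ∈ T, Metric.eball i.1.1 i.1.2 := by
    rw [hTs]
    refine subset_antisymm (fun x hx => ?_) (Set.iUnion_subset fun b => b.2)
    obtain ⟨ε, hε, h⟩ := EMetric.isOpen_iff.1 hs x hx
    exact Set.mem_iUnion.2 ⟨⟨(x, ε), h⟩, Metric.mem_eball_self hε⟩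
  rw [this, Set.preimage_iUnion₂]
  exact MeasurableSet.biUnion hT fun i _ => measurableSet_lt (hf _) measurable_const

variable [SFinite μ]

/-- The distance in `L²(μ)` to a fixed g is an integral over ξ, hence measurable in the parameter.
The choice made in `ofFourier` does no harm: it returns the `L²` class when that class exists and
lies in the closed set U, and 0 otherwise, both being measurable conditions. -/
lemma stronglyMeasurable_ofFourier {α : Type*} [MeasurableSpace α] {h : α → Space p N → ℂ}
    (hh : Measurable (Function.uncurry h)) : StronglyMeasurable fun a => ofFourier μ (h a) := by
  have : Fact ((2 : ℝ≥0∞) ≠ ⊤) := ⟨by simp⟩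
  rw [← Embedding.comp_stronglyMeasurable_iff Topology.IsEmbedding.subtypeVal]
  borelize ↥(Lp ℂ 2 μ)
  have hha : ∀ a, Measurable (h a) := fun a => hh.comp (measurable_const.prodMk measurable_id)
  have hM : MeasurableSet {a | MemLp (h a) 2 μ} := by
    have : {a | MemLp (h a) 2 μ} = {a | ∫⁻ ξ, ‖h a ξ‖ₑ ^ 2 ∂μ < ⊤} := by
      ext a
      exact memLp_two_iff (hha a).aestronglyMeasurable
    rw [this]
    exact measurableSet_lt (hh.enorm.pow_const 2).lintegral_prod_right' measurable_const
  classical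
  let v : α → Lp ℂ 2 μ := fun a => if H : MemLp (h a) 2 μ then H.toLp else 0
  have hv : Measurable v := by
    refine measurable_of_edist fun g => ?_
    have e : (fun a => edist (v a) g) = fun a => if MemLp (h a) 2 μ then
        (∫⁻ ξ, ‖h a ξ - g ξ‖ₑ ^ 2 ∂μ) ^ (1 / 2 : ℝ) else edist 0 g := by
      ext a
      by_cases H : MemLp (h a) 2 μ
      · simp only [v, dif_pos H, if_pos H]
        rw [Lp.edist_def, eLpNorm_congr_ae (H.coeFn_toLp.sub (ae_eq_refl _)),
          eLpNorm_eq_lintegral_rpow_enorm_toReal (by simp) (by simp)]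
        simp
      · simp only [v, dif_neg H, if_neg H]
    rw [e]
    refine Measurable.ite hM (Measurable.pow_const ?_ _) measurable_const
    have hg : Measurable fun z : α × Space p N => g z.2 :=
      (Lp.stronglyMeasurable g).measurable.comp measurable_snd
    exact ((hh.sub hg).enorm.pow_const 2).lintegral_prod_right'
  have hU : MeasurableSet (U μ : Set (Lp ℂ 2 μ)) :=
    (Submodule.isClosed_topologicalClosure _).measurableSet
  have e : (fun a => ((ofFourier μ (h a) : U μ) : Lp ℂ 2 μ)) =
      ({a | MemLp (h a) 2 μ} ∩ v ⁻¹' (U μ : Set (Lp ℂ 2 μ))).indicator v := by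
    ext1 a
    by_cases H : ∃ u : U μ, (u : Lp ℂ 2 μ) =ᵐ[μ] h a
    · have h1 := coeFn_ofFourier H
      have h2 : MemLp (h a) 2 μ := (memLp_congr_ae h1).1 (Lp.memLp _)
      have h3 : v a = ofFourier μ (h a) := by
        simp only [v, dif_pos h2]
        exact Lp.ext (h2.coeFn_toLp.trans h1.symm)
      rw [Set.indicator_of_mem, h3]
      exact ⟨h2, by rw [Set.mem_preimage, h3]; exact (ofFourier μ (h a)).2⟩
    · rw [Set.indicator_of_notMem]
      · rw [ofFourier, dif_neg H]; rfl
      · rintro ⟨h2, h3⟩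
        refine H ⟨⟨v a, h3⟩, ?_⟩
        simp only [v, dif_pos (show MemLp (h a) 2 μ from h2)]
        exact h2.coeFn_toLp
  rw [e]
  exact (hv.indicator (hM.inter (hv hU))).stronglyMeasurable

end OfFourier

/-! ### Gaussian subspaces of `L²(Ω)`: closure and independence. -/

section GaussianSubspace

variable {Ω : Type*} [MeasurableSpace Ω] {P : Measure Ω}

lemma integral_abs_le_norm [IsProbabilityMeasure P] (Z : Lp ℝ 2 P) : ∫ ω, |Z ω| ∂P ≤ ‖Z‖ := by
  have h1 : ∫ ω, |Z ω| ∂P = (eLpNorm Z 1 P).toReal := by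
    rw [eLpNorm_one_eq_lintegral_enorm, ← integral_norm_eq_lintegral_enorm Z.1.aestronglyMeasurable]
    rfl
  rw [h1, Lp.norm_def]
  exact ENNReal.toReal_mono (Lp.eLpNorm_ne_top Z)
    (eLpNorm_le_eLpNorm_of_exponent_le (by simp) Z.1.aestronglyMeasurable)

lemma norm_exp_mul_I_sub_le (x y : ℝ) :
    ‖Complex.exp (x * Complex.I) - Complex.exp (y * Complex.I)‖ ≤ |x - y| := by
  have : Complex.exp (x * Complex.I) - Complex.exp (y * Complex.I) =
      Complex.exp (y * Complex.I) * (Complex.exp (Complex.I * ((x - y : ℝ) : ℂ)) - 1) := by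
    rw [mul_sub, ← Complex.exp_add, mul_one]
    congr 2
    push_cast; ring
  rw [this, norm_mul, Complex.norm_exp_ofReal_mul_I, one_mul]
  exact Real.norm_exp_I_mul_ofReal_sub_one_le

/-- The map is Lipschitz with constant |u|, because the `L¹` norm is at most the `L²` norm on a
probability space. -/
lemma continuous_integral_exp [IsProbabilityMeasure P] (u : ℝ) :
    Continuous fun Z : Lp ℝ 2 P => ∫ ω, Complex.exp (((u * Z ω : ℝ) : ℂ) * Complex.I) ∂P := by
  have hint : ∀ Z : Lp ℝ 2 P,
      Integrable (fun ω => Complex.exp (((u * Z ω : ℝ) : ℂ) * Complex.I)) P := by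
    intro Z
    refine Integrable.of_bound ?_ 1 (.of_forall fun ω => (Complex.norm_exp_ofReal_mul_I _).le)
    exact (by fun_prop : Continuous fun x : ℝ =>
      Complex.exp (((u * x : ℝ) : ℂ) * Complex.I)).comp_aestronglyMeasurable
        Z.1.aestronglyMeasurable
  refine LipschitzWith.continuous (K := ‖u‖₊) (LipschitzWith.of_dist_le_mul fun Z Z' => ?_)
  rw [dist_eq_norm, dist_eq_norm, ← integral_sub (hint Z) (hint Z')]
  calc _ ≤ ∫ ω, |u| * |(Z - Z' : Lp ℝ 2 P) ω| ∂P := by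
        refine norm_integral_le_of_norm_le ?_ ?_
        · exact ((Lp.memLp (Z - Z')).integrable (by norm_num)).abs.const_mul _
        · filter_upwards [Lp.coeFn_sub Z Z'] with ω h
          rw [h, Pi.sub_apply, ← abs_mul, mul_sub]
          exact norm_exp_mul_I_sub_le _ _
    _ ≤ _ := by
        rw [integral_const_mul]
        exact mul_le_mul_of_nonneg_left (integral_abs_le_norm _) (abs_nonneg u)

/-- Centered Gaussian laws are preserved by `L²` limits. -/
lemma hasLaw_gaussianReal_of_mem_closure [IsProbabilityMeasure P] {s : Set (Lp ℝ 2 P)}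
    (hs : ∀ Z ∈ s, HasLaw Z (gaussianReal 0 (‖Z‖₊ ^ 2)) P) {Z : Lp ℝ 2 P} (hZ : Z ∈ closure s) :
    HasLaw Z (gaussianReal 0 (‖Z‖₊ ^ 2)) P := by
  have hcf : ∀ (Z : Lp ℝ 2 P) (u : ℝ), charFun (P.map Z) u =
      ∫ ω, Complex.exp (((u * Z ω : ℝ) : ℂ) * Complex.I) ∂P := by
    intro Z u
    rw [charFun_apply_real, integral_map Z.1.aemeasurable (by fun_prop)]
    simp
  have key : ∀ u : ℝ, ∫ ω, Complex.exp (((u * Z ω : ℝ) : ℂ) * Complex.I) ∂P =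
      Complex.exp (-(((‖Z‖ ^ 2 * u ^ 2 / 2 : ℝ)) : ℂ)) := by
    intro u
    -- Both sides of the characteristic function identity are continuous in Z, so it holds on a
    -- closed set.
    refine closure_minimal (s := s) (t := {Z : Lp ℝ 2 P |
      ∫ ω, Complex.exp (((u * Z ω : ℝ) : ℂ) * Complex.I) ∂P =
      Complex.exp (-(((‖Z‖ ^ 2 * u ^ 2 / 2 : ℝ)) : ℂ))}) (fun Z hZ => ?_) ?_ hZ
    · rw [Set.mem_ofPred_eq, ← hcf, (hs Z hZ).map_eq, charFun_gaussianReal]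
      congr 1
      push_cast; ring
    · exact isClosed_eq (continuous_integral_exp u) (by fun_prop)
  refine ⟨Z.1.aemeasurable, ?_⟩
  have : IsProbabilityMeasure (P.map Z) := Measure.isProbabilityMeasure_map Z.1.aemeasurable
  refine Measure.ext_of_charFun (funext fun u => ?_)
  rw [hcf, key, charFun_gaussianReal]
  congr 1
  push_cast; ring

variable {K : Submodule ℝ (Lp ℝ 2 P)}

/-- A linear functional of finitely many members of K is almost surely again a member of K. Joint
Gaussianity follows, being tested on linear functionals. -/
lemma isGaussianProcess_of_submodule (hK : ∀ Z ∈ K, HasGaussianLaw Z P) :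
    IsGaussianProcess (fun Z : K => ((Z : Lp ℝ 2 P) : Ω → ℝ)) P := by
  classical
  refine ⟨fun I => ⟨?_⟩⟩
  have hm : AEMeasurable (fun ω => I.restrict fun Z : K => (Z : Lp ℝ 2 P) ω) P :=
    aemeasurable_pi_lambda _ fun Z => (Z : K).1.1.aemeasurable
  refine isGaussian_of_isGaussian_map fun L => ?_
  rw [AEMeasurable.map_map_of_aemeasurable (by fun_prop) hm]
  let Z₀ : K := ∑ i : I, L (Pi.single i 1) • (i : K)
  have e : (Z₀ : Lp ℝ 2 P) =ᵐ[P] L ∘ fun ω => I.restrict fun Z : K => (Z : Lp ℝ 2 P) ω := by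
    have h1 : (Z₀ : Lp ℝ 2 P) = ∑ i : I, L (Pi.single i 1) • ((i : K) : Lp ℝ 2 P) := by
      simp [Z₀]
    have h2 : ∀ᵐ ω ∂P, ∀ i : I, (L (Pi.single i 1) • ((i : K) : Lp ℝ 2 P) : Lp ℝ 2 P) ω =
        L (Pi.single i 1) • ((i : K) : Lp ℝ 2 P) ω := ae_all_iff.2 fun i => Lp.coeFn_smul _ _
    rw [h1]
    filter_upwards [Lp.coeFn_finsetSum Finset.univ
      (fun i : I => (L (Pi.single i 1) • ((i : K) : Lp ℝ 2 P) : Lp ℝ 2 P)), h2] with ω h3 h4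
    rw [h3, Finset.sum_apply, Function.comp_apply]
    have h5 : (I.restrict fun Z : K => (Z : Lp ℝ 2 P) ω) =
        ∑ i : I, ((i : K) : Lp ℝ 2 P) ω • (Pi.single i 1 : I → ℝ) := by
      ext j
      simp [Finset.sum_apply, Pi.single_apply]
    rw [h5, map_sum]
    refine Finset.sum_congr rfl fun i _ => ?_
    rw [h4 i, map_smul, smul_eq_mul, smul_eq_mul, mul_comm]
  rw [← Measure.map_congr e]
  exact (hK _ Z₀.2).isGaussian_map

/-- For centred jointly Gaussian variables orthogonality is vanishing covariance, and vanishing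
covariance is independence. -/
lemma indep_of_inner_eq_zero [IsProbabilityMeasure P]
    (hK : ∀ Z ∈ K, HasLaw Z (gaussianReal 0 (‖Z‖₊ ^ 2)) P)
    {S : Type*} (X : S → Lp ℝ 2 P) (hX : ∀ s, X s ∈ K) {Z : Lp ℝ 2 P} (hZ : Z ∈ K)
    (h : ∀ s, inner ℝ (X s) Z = 0) :
    Indep (⨆ s, MeasurableSpace.comap (X s) (borel ℝ)) (MeasurableSpace.comap Z (borel ℝ)) P := by
  have hmean : ∀ Z ∈ K, ∫ ω, Z ω ∂P = 0 := fun Z hZ => by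
    rw [(hK Z hZ).integral_eq, integral_id_gaussianReal]
  let f : S ⊕ Unit → K := Sum.elim (fun s => ⟨X s, hX s⟩) (fun _ => ⟨Z, hZ⟩)
  have hG := (isGaussianProcess_of_submodule fun Z hZ => (hK Z hZ).hasGaussianLaw).comp_right f
  have e : (fun Z : K => ((Z : Lp ℝ 2 P) : Ω → ℝ)) ∘ f =
      Sum.elim (fun s => (X s : Ω → ℝ)) (fun _ => (Z : Ω → ℝ)) := by
    ext s; rcases s with s | s <;> rfl
  rw [e] at hG
  have hI := hG.indepFun_of_covariance_eq_zero (fun s => (X s).1.aemeasurable)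
    (fun _ => Z.1.aemeasurable) fun s _ => by
      rw [covariance_eq_sub (Lp.memLp _) (Lp.memLp _), hmean _ (hX s), hmean _ hZ, mul_zero,
        sub_zero]
      have := h s
      rw [L2.inner_def] at this
      simpa [mul_comm] using this
  have h1 : MeasurableSpace.comap (fun ω s => X s ω) MeasurableSpace.pi =
      ⨆ s, MeasurableSpace.comap (X s) (borel ℝ) := by
    rw [MeasurableSpace.pi, MeasurableSpace.comap_iSup]
    simp_rw [MeasurableSpace.comap_comp]
    rw [← BorelSpace.measurable_eq (α := ℝ)]
    rfl
  have h2 : MeasurableSpace.comap (fun ω (_ : Unit) => Z ω) MeasurableSpace.pi =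
      MeasurableSpace.comap Z (borel ℝ) := by
    rw [MeasurableSpace.pi, MeasurableSpace.comap_iSup]
    simp_rw [MeasurableSpace.comap_comp]
    rw [← BorelSpace.measurable_eq (α := ℝ), iSup_unique]
    rfl
  rw [IndepFun_iff_Indep, h1, h2] at hI
  exact hI

/-- Each set of the augmented field differs from a set of m by a null set, which no probability
detects. -/
lemma indep_sup_null {m m' : MeasurableSpace Ω} (h : Indep m m' P) :
    Indep (m ⊔ MeasurableSpace.generateFrom {A | P A = 0}) m' P := by
  have hle : m ⊔ MeasurableSpace.generateFrom {A | P A = 0} ≤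
      eventuallyMeasurableSpace m (ae P) := by
    refine sup_le le_eventuallyMeasurableSpace (MeasurableSpace.generateFrom_le fun A hA => ?_)
    exact ⟨∅, @MeasurableSet.empty _ m, ae_eq_empty.2 hA⟩
  rw [Indep_iff] at h ⊢
  intro A B hA hB
  obtain ⟨A', hA', e⟩ := hle A hA
  rw [measure_congr e, measure_congr (e.inter (ae_eq_refl B))]
  exact h A' B hA' hB

end GaussianSubspace

/-! ### Linearity forced by inner products. -/

section GenericInner

variable {E H G : Type*} [AddCommGroup E] [Module ℝ E] [NormedAddCommGroup H]
  [InnerProductSpace ℝ H] [NormedAddCommGroup G] [InnerProductSpace ℝ G]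

lemma inner_smul_smul (a b : ℝ) (u v : H) : inner ℝ (a • u) (b • v) = a * b * inner ℝ u v := by
  rw [real_inner_smul_left, real_inner_smul_right, mul_assoc]

/-- The squared norms of f(x+y) - f(x) - f(y) and of f(cx) - c f(x) involve only inner products, so
they are those of the linear map A, namely 0. Applied to the noise, which is not assumed linear. -/
lemma isLinearMap_of_inner_eq_inner {f : E → G} {A : E → H} (hA : IsLinearMap ℝ A)
    (h : ∀ x y, inner ℝ (f x) (f y) = inner ℝ (A x) (A y)) : IsLinearMap ℝ f where
  map_add x y := by
    rw [← sub_eq_zero, ← inner_self_eq_zero (𝕜 := ℝ)]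
    simp only [inner_sub_left, inner_sub_right, inner_add_left, inner_add_right, h, hA.map_add]
    ring
  map_smul c x := by
    rw [← sub_eq_zero, ← inner_self_eq_zero (𝕜 := ℝ)]
    simp only [inner_sub_left, inner_sub_right, real_inner_smul_left, real_inner_smul_right, h,
      hA.map_smul]
    ring

lemma isLinearMap_of_inner_eq_integral {α : Type*} [MeasurableSpace α] {ν : Measure α}
    (T : α → E →ₗ[ℝ] H) (hT : ∀ x, MemLp (fun t => T t x) 2 ν) {f : E → G}
    (h : ∀ x y, inner ℝ (f x) (f y) = ∫ t, inner ℝ (T t x) (T t y) ∂ν) : IsLinearMap ℝ f := by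
  refine isLinearMap_of_inner_eq_inner (A := fun x => (hT x).toLp) ⟨fun x y => ?_, fun c x => ?_⟩
    fun x y => ?_
  · rw [← MemLp.toLp_add]
    congr 1
    ext1 t
    exact map_add (T t) x y
  · rw [← MemLp.toLp_const_smul]
    congr 1
    ext1 t
    exact map_smul (T t) c x
  · rw [h, L2.inner_def]
    refine integral_congr_ae ?_
    filter_upwards [(hT x).coeFn_toLp, (hT y).coeFn_toLp] with t h1 h2
    rw [h1, h2]

end GenericInner

/-! ### The noise as an isometry, and its cylindrical Wiener process. -/

section Noise

variable {p : ℕ} [Fact p.Prime] {N : ℕ}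

lemma memLp_stepFunction {c : ℝ → ℝ} (hc : c ∈ StepFunction) : MemLp c 2 volume := by
  induction hc using Submodule.span_induction with
  | mem c hc =>
    obtain ⟨I, hI, hb, rfl⟩ := hc
    exact memLp_indicator_const _ hI.measurableSet _ (.inr hb.measure_lt_top.ne)
  | zero => exact MemLp.zero
  | add c d _ _ hc hd => exact hc.add hd
  | smul a c _ hc => exact hc.const_smul a

lemma noiseTest_slice_mem {φ : ℝ → Space p N → ℝ} (hφ : φ ∈ NoiseTest p N) (t : ℝ) :
    φ t ∈ TestFunction p N ℝ := by
  induction hφ using Submodule.span_induction with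
  | mem φ h =>
    obtain ⟨c, -, φ, hφ, rfl⟩ := h
    exact (TestFunction p N ℝ).smul_mem (c t) hφ
  | zero => exact (TestFunction p N ℝ).zero_mem
  | add φ ψ _ _ h1 h2 => exact (TestFunction p N ℝ).add_mem h1 h2
  | smul a φ _ h => exact (TestFunction p N ℝ).smul_mem a h

/-- The spatial test function `φ(t, ·)`. -/
def slice (t : ℝ) : NoiseTest p N →ₗ[ℝ] TestFunction p N ℝ where
  toFun φ := ⟨φ.1 t, noiseTest_slice_mem φ.2 t⟩
  map_add' _ _ := rfl
  map_smul' _ _ := rfl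

variable (μ : Measure (Space p N)) [IsFiniteMeasureOnCompacts μ]

lemma memLp_toU_slice (φ : NoiseTest p N) :
    MemLp (fun t => toU μ (slice t φ)) 2 (volume.restrict (Set.Ioi (0 : ℝ))) := by
  obtain ⟨φ, hφ⟩ := φ
  induction hφ using Submodule.span_induction with
  | mem φ h =>
    obtain ⟨c, hc, φ, hφ, rfl⟩ := h
    have e : (fun t => toU μ (slice t ⟨fun t x => c t * φ x, Submodule.subset_span
        ⟨c, hc, φ, hφ, rfl⟩⟩)) = fun t => c t • toU μ ⟨φ, hφ⟩ := by
      ext1 t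
      rw [← map_smul]; rfl
    rw [e]
    have hc2 := (memLp_stepFunction hc).restrict (Set.Ioi (0 : ℝ))
    exact ((ContinuousLinearMap.toSpanSingleton ℝ (toU μ ⟨φ, hφ⟩)).comp_memLp' hc2)
  | zero =>
    have e : (fun t => toU μ (slice t ⟨0, (NoiseTest p N).zero_mem⟩)) = fun _ => 0 := by
      ext1 t
      exact map_zero (toU μ ∘ₗ slice t)
    rw [e]
    exact MemLp.zero'
  | add φ ψ h1 h2 h3 h4 =>
    have e : (fun t => toU μ (slice t ⟨φ + ψ, (NoiseTest p N).add_mem h1 h2⟩)) =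
        (fun t => toU μ (slice t ⟨φ, h1⟩)) + fun t => toU μ (slice t ⟨ψ, h2⟩) := by
      ext1 t
      exact map_add (toU μ ∘ₗ slice t) ⟨φ, h1⟩ ⟨ψ, h2⟩
    rw [e]
    exact h3.add h4
  | smul a φ h1 h2 =>
    have e : (fun t => toU μ (slice t ⟨a • φ, (NoiseTest p N).smul_mem a h1⟩)) =
        a • fun t => toU μ (slice t ⟨φ, h1⟩) := by
      ext1 t
      exact map_smul (toU μ ∘ₗ slice t) a ⟨φ, h1⟩
    rw [e]
    exact h2.const_smul a

lemma integral_inner_cylTest {s t : ℝ} (hs : 0 ≤ s) (ht : 0 ≤ t) (φ ψ : TestFunction p N ℝ) :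
    ∫ r in Set.Ioi (0 : ℝ), inner ℝ (toU μ (slice r (cylTest s φ)))
      (toU μ (slice r (cylTest t ψ))) = min s t * inner ℝ (toU μ φ) (toU μ ψ) := by
  have h : ∀ (s r : ℝ) (φ : TestFunction p N ℝ), toU μ (slice r (cylTest s φ)) =
      (Set.Icc (0 : ℝ) s).indicator (fun _ => (1 : ℝ)) r • toU μ φ := by
    intro s r φ
    rw [← map_smul]; rfl
  have hi : ∀ (a b : ℝ) (u v : U μ), inner ℝ (a • u) (b • v) = a * b * inner ℝ u v :=
    inner_smul_smul (H := U μ)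
  simp_rw [h, hi]
  rw [integral_mul_const]
  congr 1
  have e : ∀ r, (Set.Icc (0 : ℝ) s).indicator (fun _ => (1 : ℝ)) r *
      (Set.Icc (0 : ℝ) t).indicator (fun _ => (1 : ℝ)) r =
      (Set.Icc (0 : ℝ) (min s t)).indicator (fun _ => (1 : ℝ)) r := by
    intro r
    rw [← Set.inter_indicator_mul, Set.Icc_inter_Icc]
    simp
  simp_rw [e]
  rw [integral_indicator_const _ measurableSet_Icc, smul_eq_mul, mul_one, measureReal_def,
    Measure.restrict_apply measurableSet_Icc]
  have : Set.Icc 0 (min s t) ∩ Set.Ioi 0 = Set.Ioc 0 (min s t) := by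
    ext r; simp only [Set.mem_inter_iff, Set.mem_Icc, Set.mem_Ioi, Set.mem_Ioc]
    constructor
    · rintro ⟨⟨_, h1⟩, h2⟩; exact ⟨h2, h1⟩
    · rintro ⟨h1, h2⟩; exact ⟨⟨h1.le, h2⟩, h1⟩
  rw [this, Real.volume_Ioc, sub_zero, ENNReal.toReal_ofReal (le_min hs ht)]

variable {μ} {Ω : Type*} [MeasurableSpace Ω] {P : Measure Ω}
  {Λ : Measure (Space p N)} {W : NoiseTest p N → Ω → ℝ}

lemma IsGaussianNoise.memLp (hW : IsGaussianNoise Λ P W) (φ : NoiseTest p N) :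
    MemLp (W φ) 2 P := by
  obtain ⟨v, hv⟩ := hW.gaussian φ
  exact hv.hasGaussianLaw.memLp_two

lemma IsGaussianNoise.inner_toLp (hW : IsGaussianNoise Λ P W) (hμ : IsSpectralMeasure Λ μ)
    (φ ψ : NoiseTest p N) :
    inner ℝ (hW.memLp φ).toLp (hW.memLp ψ).toLp =
      ∫ t in Set.Ioi (0 : ℝ), inner ℝ (toU μ (slice t φ)) (toU μ (slice t ψ)) := by
  rw [L2.inner_def]
  simp_rw [← integral_correlation hμ]
  rw [← show _ = ∫ t in Set.Ioi (0 : ℝ), ∫ z, ∫ x, (slice t φ).1 x *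
    (slice t ψ).1 (x - z) ∂(haar p N) ∂Λ from hW.covariance φ ψ]
  refine integral_congr_ae ?_
  filter_upwards [(hW.memLp φ).coeFn_toLp, (hW.memLp ψ).coeFn_toLp] with ω h1 h2
  rw [h1, h2]
  simp [mul_comm]

/-- The noise as a linear map to `L²(Ω)`. -/
def noiseL2 (hW : IsGaussianNoise Λ P W) (hμ : IsSpectralMeasure Λ μ) :
    NoiseTest p N →ₗ[ℝ] Lp ℝ 2 P :=
  IsLinearMap.mk' (fun φ => (hW.memLp φ).toLp)
    (isLinearMap_of_inner_eq_integral (H := U μ) (fun t => toU μ ∘ₗ slice t)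
      (memLp_toU_slice μ) (hW.inner_toLp hμ))

lemma hasLaw_noiseL2 (hW : IsGaussianNoise Λ P W) (hμ : IsSpectralMeasure Λ μ)
    (φ : NoiseTest p N) : HasLaw (noiseL2 hW hμ φ) (gaussianReal 0 (‖noiseL2 hW hμ φ‖₊ ^ 2)) P := by
  obtain ⟨v, hv⟩ := hW.gaussian φ
  have := hv.hasGaussianLaw.isProbabilityMeasure
  have e : noiseL2 hW hμ φ =ᵐ[P] W φ := (hW.memLp φ).coeFn_toLp
  have hv' := hv.congr e
  convert hv' using 2
  -- The unspecified variance v is the second moment of a centred variable, that is, the squared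
  -- norm in `L²(Ω)`.
  apply NNReal.coe_injective
  rw [← variance_id_gaussianReal (μ := 0) (v := v), ← hv'.variance_eq,
    variance_eq_sub (Lp.memLp _), hv'.integral_eq, integral_id_gaussianReal]
  have : inner ℝ (noiseL2 hW hμ φ) (noiseL2 hW hμ φ) = ‖noiseL2 hW hμ φ‖ ^ 2 :=
    real_inner_self_eq_norm_sq _
  rw [L2.inner_def] at this
  push_cast
  rw [← this]
  simp [pow_two]

lemma cylTest_linear (t : ℝ) : IsLinearMap ℝ (cylTest (p := p) (N := N) t) where
  map_add _ _ := Subtype.ext (funext fun _ => funext fun _ => mul_add _ _ _)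
  map_smul _ _ := Subtype.ext (funext fun _ => funext fun _ => mul_left_comm _ _ _)

lemma exists_isWienerExtension (hW : IsGaussianNoise Λ P W) (hμ : IsSpectralMeasure Λ μ) {t : ℝ}
    (ht : 0 ≤ t) : ∃ L, IsWienerExtension μ P W t L := by
  let f : TestFunction p N ℝ →ₗ[ℝ] Lp ℝ 2 P := noiseL2 hW hμ ∘ₗ (cylTest_linear t).mk'
  have hf : ∀ φ, ‖f φ‖ ≤ √t * ‖toU μ φ‖ := by
    intro φ
    refine le_of_eq ?_
    rw [← sq_eq_sq₀ (norm_nonneg _) (by positivity), mul_pow, Real.sq_sqrt ht,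
      ← real_inner_self_eq_norm_sq, ← real_inner_self_eq_norm_sq]
    have h := integral_inner_cylTest μ ht ht φ φ
    rw [min_self] at h
    rw [← h]
    exact hW.inner_toLp hμ _ _
  refine ⟨f.extendOfNorm (toU μ), fun φ u hu => ?_⟩
  rw [eq_toU hu, LinearMap.extendOfNorm_eq (denseRange_toU μ) ⟨_, hf⟩]
  exact (hW.memLp _).coeFn_toLp

lemma isWienerExtension_wiener (hW : IsGaussianNoise Λ P W) (hμ : IsSpectralMeasure Λ μ) {t : ℝ}
    (ht : 0 ≤ t) : IsWienerExtension μ P W t (wiener μ P W t) := by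
  have H := exists_isWienerExtension hW hμ ht
  rw [wiener, dif_pos H]
  exact H.choose_spec

lemma wiener_toU (hW : IsGaussianNoise Λ P W) (hμ : IsSpectralMeasure Λ μ) {t : ℝ} (ht : 0 ≤ t)
    (φ : TestFunction p N ℝ) : wiener μ P W t (toU μ φ) = noiseL2 hW hμ (cylTest t φ) :=
  Lp.ext ((isWienerExtension_wiener hW hμ ht φ _ (coeFn_toU μ φ)).trans
    (hW.memLp _).coeFn_toLp.symm)

lemma inner_wiener (hW : IsGaussianNoise Λ P W) (hμ : IsSpectralMeasure Λ μ) {s t : ℝ}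
    (hs : 0 ≤ s) (ht : 0 ≤ t) (h h' : U μ) :
    inner ℝ (wiener μ P W s h) (wiener μ P W t h') = min s t * inner ℝ h h' := by
  refine (denseRange_toU μ).induction_on₂ (isClosed_eq (by fun_prop) (by fun_prop))
    (fun φ ψ => ?_) h h'
  rw [wiener_toU hW hμ hs, wiener_toU hW hμ ht, ← integral_inner_cylTest μ hs ht]
  exact hW.inner_toLp hμ _ _

/-- The closed subspace of `L²(Ω)` generated by the noise. -/
def gaussianSpace (hW : IsGaussianNoise Λ P W) (hμ : IsSpectralMeasure Λ μ) :
    Submodule ℝ (Lp ℝ 2 P) := (LinearMap.range (noiseL2 hW hμ)).topologicalClosure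

lemma hasLaw_of_mem_gaussianSpace [IsProbabilityMeasure P] (hW : IsGaussianNoise Λ P W)
    (hμ : IsSpectralMeasure Λ μ) {Z : Lp ℝ 2 P} (hZ : Z ∈ gaussianSpace hW hμ) :
    HasLaw Z (gaussianReal 0 (‖Z‖₊ ^ 2)) P := by
  rw [gaussianSpace, ← SetLike.mem_coe, Submodule.topologicalClosure_coe] at hZ
  refine hasLaw_gaussianReal_of_mem_closure ?_ hZ
  rintro _ ⟨φ, rfl⟩
  exact hasLaw_noiseL2 hW hμ φ

lemma wiener_mem_gaussianSpace (hW : IsGaussianNoise Λ P W) (hμ : IsSpectralMeasure Λ μ) {t : ℝ}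
    (ht : 0 ≤ t) (h : U μ) : wiener μ P W t h ∈ gaussianSpace hW hμ := by
  refine (denseRange_toU μ).induction_on (p := fun h => wiener μ P W t h ∈ gaussianSpace hW hμ) h
    ?_ fun φ => ?_
  · exact (Submodule.isClosed_topologicalClosure _).preimage (wiener μ P W t).continuous
  · rw [wiener_toU hW hμ ht]
    exact Submodule.le_topologicalClosure _ ⟨_, rfl⟩

end Noise

/-! ### The filtration and independence of increments. -/

section Filtration

variable {p : ℕ} [Fact p.Prime] {N : ℕ} {μ : Measure (Space p N)}
  {Ω : Type*} [MeasurableSpace Ω] {P : Measure Ω} {W : NoiseTest p N → Ω → ℝ}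

lemma sigmaField_mono {s t : ℝ} (h : s ≤ t) : sigmaField μ P W s ≤ sigmaField μ P W t :=
  sup_le_sup_right (biSup_mono fun _ hr => ⟨hr.1, hr.2.trans h⟩) _

lemma sigmaField_le [P.IsComplete] (t : ℝ) : sigmaField μ P W t ≤ ‹MeasurableSpace Ω› := by
  refine sup_le (iSup₂_le fun s _ => iSup_le fun h => ?_)
    (MeasurableSpace.generateFrom_le fun A hA => Measure.IsComplete.out' A hA)
  rw [← BorelSpace.measurable_eq (α := ℝ)]
  exact (Lp.stronglyMeasurable _).measurable.comap_le

lemma measurable_wiener {s t : ℝ} (hs : 0 ≤ s) (hst : s ≤ t) (h : U μ) :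
    Measurable[sigmaField μ P W t] (wiener μ P W s h) := by
  rw [measurable_iff_comap_le, BorelSpace.measurable_eq (α := ℝ)]
  exact (le_iSup (fun h : U μ => MeasurableSpace.comap (wiener μ P W s h) (borel ℝ)) h).trans
    ((le_iSup₂ (f := fun s (_ : s ∈ Set.Icc (0 : ℝ) t) =>
      ⨆ h : U μ, MeasurableSpace.comap (wiener μ P W s h) (borel ℝ)) s ⟨hs, hst⟩).trans
      le_sup_left)

/-- Increments of the Wiener process are independent of the past. -/
lemma indep_increment [IsFiniteMeasureOnCompacts μ] [IsProbabilityMeasure P]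
    {Λ : Measure (Space p N)} (hW : IsGaussianNoise Λ P W) (hμ : IsSpectralMeasure Λ μ) {a b : ℝ}
    (ha : 0 ≤ a) (hab : a ≤ b) (h : U μ) :
    Indep (sigmaField μ P W a)
      (MeasurableSpace.comap (wiener μ P W b h - wiener μ P W a h : Lp ℝ 2 P) (borel ℝ)) P := by
  have key := indep_of_inner_eq_zero (K := gaussianSpace hW hμ)
    (fun Z hZ => hasLaw_of_mem_gaussianSpace hW hμ hZ)
    (fun i : Set.Icc (0 : ℝ) a × U μ => wiener μ P W i.1 i.2)
    (fun i => wiener_mem_gaussianSpace hW hμ i.1.2.1 i.2)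
    (Z := wiener μ P W b h - wiener μ P W a h)
    (Submodule.sub_mem _ (wiener_mem_gaussianSpace hW hμ (ha.trans hab) h)
      (wiener_mem_gaussianSpace hW hμ ha h)) fun i => by
      -- A past time lies below both a and b, so both minima equal that time and the two covariances
      -- cancel.
      rw [inner_sub_right, inner_wiener hW hμ i.1.2.1 (ha.trans hab),
        inner_wiener hW hμ i.1.2.1 ha, min_eq_left (i.1.2.2.trans hab), min_eq_left i.1.2.2,
        sub_self]
  have e : (⨆ i : Set.Icc (0 : ℝ) a × U μ,
      MeasurableSpace.comap (wiener μ P W i.1 i.2) (borel ℝ)) =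
      ⨆ s ∈ Set.Icc (0 : ℝ) a, ⨆ h : U μ,
        MeasurableSpace.comap (wiener μ P W s h) (borel ℝ) := by
    rw [iSup_prod, iSup_subtype]
  rw [e] at key
  exact indep_sup_null key

end Filtration

/-! ### Products of square integrable variables with bounded factors. -/

section BoundedProducts

variable {Ω : Type*} {m₀ : MeasurableSpace Ω} {P : Measure Ω}

lemma memLp_bdd_mul {X Y : Ω → ℝ} (hX : Measurable X) (hb : ∃ C : ℝ, ∀ ω, |X ω| ≤ C)
    (hY : MemLp Y 2 P) : MemLp (fun ω => X ω * Y ω) 2 P := by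
  obtain ⟨C, hC⟩ := hb
  refine (hY.norm.const_mul C).mono (hX.aestronglyMeasurable.mul hY.1) (.of_forall fun ω => ?_)
  rw [norm_mul]
  refine (mul_le_mul_of_nonneg_right (hC ω) (norm_nonneg _)).trans ?_
  exact le_abs_self _

lemma memLp_of_bdd {X : Ω → ℝ} (hX : Measurable X) (hb : ∃ C : ℝ, ∀ ω, |X ω| ≤ C) (q : ℝ≥0∞)
    [IsFiniteMeasure P] : MemLp X q P := by
  obtain ⟨C, hC⟩ := hb
  exact MemLp.of_bound hX.aestronglyMeasurable C (.of_forall hC)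

lemma bdd_mul {X Y : Ω → ℝ} (hX : ∃ C : ℝ, ∀ ω, |X ω| ≤ C) (hY : ∃ C : ℝ, ∀ ω, |Y ω| ≤ C) :
    ∃ C : ℝ, ∀ ω, |X ω * Y ω| ≤ C := by
  obtain ⟨C, hC⟩ := hX
  obtain ⟨D, hD⟩ := hY
  refine ⟨C * D, fun ω => ?_⟩
  rw [abs_mul]
  exact mul_le_mul (hC ω) (hD ω) (abs_nonneg _) ((abs_nonneg _).trans (hC ω))

lemma integral_add_two_mul_add {f g k : Ω → ℝ} (hf : Integrable f P) (hg : Integrable g P)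
    (hk : Integrable k P) :
    ∫ ω, (f ω + 2 * g ω + k ω) ∂P = ∫ ω, f ω ∂P + 2 * ∫ ω, g ω ∂P + ∫ ω, k ω ∂P := by
  have h1 : Integrable (fun ω => 2 * g ω) P := hg.const_mul 2
  have h2 : Integrable (fun ω => f ω + 2 * g ω) P := hf.add h1
  rw [integral_add h2 hk, integral_add hf h1, integral_const_mul]

lemma integral_mul_of_indep {m : MeasurableSpace Ω} (hm : m ≤ m₀) {Z D : Ω → ℝ}
    (h : Indep m (MeasurableSpace.comap D (borel ℝ)) P) (hZ : Measurable[m] Z)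
    (hD : AEMeasurable D P) {f : ℝ → ℝ} (hf : Measurable f) :
    ∫ ω, Z ω * f (D ω) ∂P = (∫ ω, Z ω ∂P) * ∫ ω, f (D ω) ∂P := by
  have hI : IndepFun Z D P := by
    rw [IndepFun_iff_Indep]
    rw [← BorelSpace.measurable_eq (α := ℝ)] at h
    exact indep_of_indep_of_le_left h hZ.comap_le
  exact hI.integral_comp_mul_comp (f := id) (g := f) (hZ.mono hm le_rfl).aemeasurable
    hD aestronglyMeasurable_id hf.aestronglyMeasurable

end BoundedProducts

/-! ### Second moments of weighted increments. -/

section Increment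

variable {p : ℕ} [Fact p.Prime] {N : ℕ} {μ : Measure (Space p N)}
  {Ω : Type*} [mΩ : MeasurableSpace Ω] {P : Measure Ω} {W : NoiseTest p N → Ω → ℝ}

variable (μ P W) in
/-- The increment `W_b(h) - W_a(h)`. -/
def increment (a b : ℝ) (h : U μ) (ω : Ω) : ℝ := wiener μ P W b h ω - wiener μ P W a h ω

lemma increment_add (a b c : ℝ) (h : U μ) (ω : Ω) :
    increment μ P W a b h ω + increment μ P W b c h ω = increment μ P W a c h ω := by
  unfold increment; ring

lemma increment_ae (a b : ℝ) (h : U μ) :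
    (wiener μ P W b h - wiener μ P W a h : Lp ℝ 2 P) =ᵐ[P] increment μ P W a b h :=
  Lp.coeFn_sub _ _

lemma memLp_increment (a b : ℝ) (h : U μ) : MemLp (increment μ P W a b h) 2 P :=
  (Lp.memLp _).sub (Lp.memLp _)

lemma measurable_increment {a b t : ℝ} (ha : 0 ≤ a) (hab : a ≤ b) (hb : b ≤ t) (h : U μ) :
    Measurable[sigmaField μ P W t] (increment μ P W a b h) := by
  have h1 := measurable_wiener (P := P) (W := W) (ha.trans hab) hb h
  have h2 := measurable_wiener (P := P) (W := W) ha (hab.trans hb) h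
  exact h1.sub h2

/-- Additivity in time holds at every ω, but additivity in the direction only almost surely, since
each direction has its own representative. -/
lemma increment_map_add (a b : ℝ) (h h' : U μ) :
    increment μ P W a b (h + h') =ᵐ[P]
      fun ω => increment μ P W a b h ω + increment μ P W a b h' ω := by
  have h1 := Lp.coeFn_add (wiener μ P W b h) (wiener μ P W b h')
  have h2 := Lp.coeFn_add (wiener μ P W a h) (wiener μ P W a h')
  rw [← map_add] at h1 h2
  filter_upwards [h1, h2] with ω e1 e2
  simp only [increment, e1, e2, Pi.add_apply]
  ring

variable [IsFiniteMeasureOnCompacts μ] {Λ : Measure (Space p N)}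

lemma integral_increment_mul_increment (hW : IsGaussianNoise Λ P W) (hμ : IsSpectralMeasure Λ μ)
    {a b : ℝ} (ha : 0 ≤ a) (hab : a ≤ b) (h h' : U μ) :
    ∫ ω, increment μ P W a b h ω * increment μ P W a b h' ω ∂P = (b - a) * inner ℝ h h' := by
  have hb := ha.trans hab
  have e : inner ℝ (wiener μ P W b h - wiener μ P W a h) (wiener μ P W b h' - wiener μ P W a h') =
      (b - a) * inner ℝ h h' := by
    rw [inner_sub_left, inner_sub_right, inner_sub_right, inner_wiener hW hμ hb hb,
      inner_wiener hW hμ hb ha, inner_wiener hW hμ ha hb, inner_wiener hW hμ ha ha,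
      min_eq_right hab, min_eq_left hab, min_self, min_self]
    ring
  rw [← e, L2.inner_def]
  refine integral_congr_ae ?_
  filter_upwards [increment_ae (μ := μ) (P := P) (W := W) a b h,
    increment_ae (μ := μ) (P := P) (W := W) a b h'] with ω h1 h2
  rw [h1, h2]
  simp [mul_comm]

variable [IsProbabilityMeasure P]

lemma integral_mul_comp_increment [P.IsComplete] (hW : IsGaussianNoise Λ P W)
    (hμ : IsSpectralMeasure Λ μ) {a b : ℝ} (ha : 0 ≤ a) (hab : a ≤ b) (h : U μ) {Z : Ω → ℝ}
    (hZ : Measurable[sigmaField μ P W a] Z) {f : ℝ → ℝ} (hf : Measurable f) :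
    ∫ ω, Z ω * f (increment μ P W a b h ω) ∂P =
      (∫ ω, Z ω ∂P) * ∫ ω, f (increment μ P W a b h ω) ∂P := by
  have h1 := integral_mul_of_indep (sigmaField_le a) (indep_increment hW hμ ha hab h) hZ
    (wiener μ P W b h - wiener μ P W a h : Lp ℝ 2 P).1.aemeasurable hf
  have e := increment_ae (μ := μ) (P := P) (W := W) a b h
  rw [← integral_congr_ae (e.mono fun ω hω => congrArg f hω),
    ← integral_congr_ae (e.mono fun ω hω => congrArg (fun x => Z ω * f x) hω)]
  exact h1

lemma integral_increment (hW : IsGaussianNoise Λ P W) (hμ : IsSpectralMeasure Λ μ) {a b : ℝ}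
    (ha : 0 ≤ a) (hab : a ≤ b) (h : U μ) : ∫ ω, increment μ P W a b h ω ∂P = 0 := by
  have hK : (wiener μ P W b h - wiener μ P W a h : Lp ℝ 2 P) ∈ gaussianSpace hW hμ :=
    Submodule.sub_mem _ (wiener_mem_gaussianSpace hW hμ (ha.trans hab) h)
      (wiener_mem_gaussianSpace hW hμ ha h)
  have h0 := (hasLaw_of_mem_gaussianSpace hW hμ hK).integral_eq
  rw [integral_id_gaussianReal] at h0
  rw [← h0]
  exact integral_congr_ae (increment_ae a b h).symm

lemma integral_mul_increment [P.IsComplete] (hW : IsGaussianNoise Λ P W)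
    (hμ : IsSpectralMeasure Λ μ) {a b : ℝ} (ha : 0 ≤ a) (hab : a ≤ b) (h : U μ) {Z : Ω → ℝ}
    (hZ : Measurable[sigmaField μ P W a] Z) : ∫ ω, Z ω * increment μ P W a b h ω ∂P = 0 := by
  have := integral_mul_comp_increment hW hμ ha hab h hZ measurable_id
  simp only [id] at this
  rw [this, integral_increment hW hμ ha hab h, mul_zero]

/-- Polarisation: independence from the past, applied to the squares of the increments in the
directions h, h' and h + h', determines the mixed product without joint independence of the pair. -/
lemma integral_mul_increment_mul_increment [P.IsComplete] (hW : IsGaussianNoise Λ P W)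
    (hμ : IsSpectralMeasure Λ μ) {a b : ℝ} (ha : 0 ≤ a) (hab : a ≤ b) (h h' : U μ) {Z : Ω → ℝ}
    (hZ : Measurable[sigmaField μ P W a] Z) (hb : ∃ C : ℝ, ∀ ω, |Z ω| ≤ C) :
    ∫ ω, Z ω * (increment μ P W a b h ω * increment μ P W a b h' ω) ∂P =
      (∫ ω, Z ω ∂P) * ((b - a) * inner ℝ h h') := by
  set D := increment μ P W a b h with hD
  set D' := increment μ P W a b h' with hD'
  have hm : MemLp D 2 P := memLp_increment a b h
  have hm' : MemLp D' 2 P := memLp_increment a b h'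
  have hZ0 : Measurable Z := hZ.mono (sigmaField_le a) le_rfl
  have hsq : Measurable fun x : ℝ => x ^ 2 := by fun_prop
  have e1 := integral_mul_comp_increment hW hμ ha hab h hZ hsq
  have e2 := integral_mul_comp_increment hW hμ ha hab h' hZ hsq
  have e3 := integral_mul_comp_increment hW hμ ha hab (h + h') hZ hsq
  have ea := increment_map_add (P := P) (W := W) a b h h'
  rw [integral_congr_ae (ea.mono fun ω hω => congrArg (fun x => Z ω * x ^ 2) hω),
    integral_congr_ae (ea.mono fun ω hω => congrArg (fun x => x ^ 2) hω)] at e3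
  rw [← integral_increment_mul_increment hW hμ ha hab h h']
  have i1 : Integrable (fun ω => D ω ^ 2) P := hm.integrable_sq
  have i2 : Integrable (fun ω => D' ω ^ 2) P := hm'.integrable_sq
  have i3 : Integrable (fun ω => D ω * D' ω) P := hm.integrable_mul hm'
  have j : ∀ {f : Ω → ℝ}, Integrable f P → Integrable (fun ω => Z ω * f ω) P := by
    intro f hf
    obtain ⟨C, hC⟩ := hb
    exact hf.bdd_mul hZ0.aestronglyMeasurable (.of_forall hC)
  have s1 : ∫ ω, (D ω + D' ω) ^ 2 ∂P =
      ∫ ω, D ω ^ 2 ∂P + 2 * ∫ ω, D ω * D' ω ∂P + ∫ ω, D' ω ^ 2 ∂P := by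
    rw [← integral_add_two_mul_add i1 i3 i2]
    congr 1 with ω
    ring
  have s2 : ∫ ω, Z ω * (D ω + D' ω) ^ 2 ∂P = ∫ ω, Z ω * D ω ^ 2 ∂P +
      2 * ∫ ω, Z ω * (D ω * D' ω) ∂P + ∫ ω, Z ω * D' ω ^ 2 ∂P := by
    rw [← integral_add_two_mul_add (j i1) (j i3) (j i2)]
    congr 1 with ω
    ring
  rw [s1, s2, e1, e2] at e3
  linarith

/-- The length of the intersection of two half-open intervals. -/
def overlap (a b a' b' : ℝ) : ℝ := max 0 (min b b' - max a a')

/-- The longer interval is split at b. Its part after b is centred and independent of everything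
known at time b, so only the common interval contributes. -/
lemma integral_pair_of_start_eq [P.IsComplete] (hW : IsGaussianNoise Λ P W)
    (hμ : IsSpectralMeasure Λ μ) {a b b' : ℝ} (ha : 0 ≤ a) (hab : a ≤ b) (hbb : b ≤ b')
    (h h' : U μ) {X X' : Ω → ℝ} (hX : Measurable[sigmaField μ P W a] X)
    (hX' : Measurable[sigmaField μ P W a] X') (hb : ∃ C : ℝ, ∀ ω, |X ω| ≤ C)
    (hb' : ∃ C : ℝ, ∀ ω, |X' ω| ≤ C) :
    ∫ ω, (X ω * increment μ P W a b h ω) * (X' ω * increment μ P W a b' h' ω) ∂P =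
      (∫ ω, X ω * X' ω ∂P) * ((b - a) * inner ℝ h h') := by
  have hX0 : Measurable X := hX.mono (sigmaField_le a) le_rfl
  have hX0' : Measurable X' := hX'.mono (sigmaField_le a) le_rfl
  have hXb := hX.mono (sigmaField_mono hab) le_rfl
  have hXb' := hX'.mono (sigmaField_mono hab) le_rfl
  have hDb := measurable_increment (P := P) (W := W) ha hab le_rfl h
  have e : ∀ ω, (X ω * increment μ P W a b h ω) * (X' ω * increment μ P W a b' h' ω) =
      (X ω * X' ω) * (increment μ P W a b h ω * increment μ P W a b h' ω) +
      (X ω * increment μ P W a b h ω * X' ω) * increment μ P W b b' h' ω := by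
    intro ω
    rw [← increment_add a b b' h' ω]; ring
  simp_rw [e]
  rw [integral_add, integral_mul_increment_mul_increment (Z := fun ω => X ω * X' ω) hW hμ ha hab h h'
    (hX.mul hX') (bdd_mul hb hb'), integral_mul_increment
      (Z := fun ω => X ω * increment μ P W a b h ω * X' ω) hW hμ (ha.trans hab) hbb h'
      ((hXb.mul hDb).mul hXb'), add_zero]
  · refine ((memLp_bdd_mul hX0 hb (memLp_increment (W := W) a b h)).integrable_mul
      (memLp_bdd_mul hX0' hb' (memLp_increment (W := W) a b h'))).congr (.of_forall fun ω => ?_)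
    simp only [Pi.mul_apply]; ring
  · refine ((memLp_bdd_mul hX0 hb (memLp_increment (W := W) a b h)).integrable_mul
      (memLp_bdd_mul hX0' hb' (memLp_increment (W := W) b b' h'))).congr (.of_forall fun ω => ?_)
    simp only [Pi.mul_apply]; ring

/-- The first interval is split at a'. What precedes a' is known when the second increment starts
and contributes nothing; the rest starts at the same time as the second interval. -/
lemma integral_pair_of_start_le [P.IsComplete] (hW : IsGaussianNoise Λ P W)
    (hμ : IsSpectralMeasure Λ μ) {a b a' b' : ℝ} (ha : 0 ≤ a) (hab : a ≤ b) (haa : a ≤ a')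
    (hab' : a' ≤ b') (h h' : U μ) {X X' : Ω → ℝ} (hX : Measurable[sigmaField μ P W a] X)
    (hX' : Measurable[sigmaField μ P W a'] X') (hb : ∃ C : ℝ, ∀ ω, |X ω| ≤ C)
    (hb' : ∃ C : ℝ, ∀ ω, |X' ω| ≤ C) :
    ∫ ω, (X ω * increment μ P W a b h ω) * (X' ω * increment μ P W a' b' h' ω) ∂P =
      (∫ ω, X ω * X' ω ∂P) * (overlap a b a' b' * inner ℝ h h') := by
  have ha' := ha.trans haa
  have hX0 : Measurable X := hX.mono (sigmaField_le a) le_rfl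
  have hX0' : Measurable X' := hX'.mono (sigmaField_le a') le_rfl
  have hXa := hX.mono (sigmaField_mono haa) le_rfl
  have disj : ∀ c, a ≤ c → c ≤ a' →
      ∫ ω, (X ω * increment μ P W a c h ω) * (X' ω * increment μ P W a' b' h' ω) ∂P = 0 := by
    intro c hac hca
    have := integral_mul_increment hW hμ ha' hab' h'
      ((hXa.mul (measurable_increment ha hac hca h)).mul hX')
    rw [← this]
    congr 1 with ω
    simp only [Pi.mul_apply]; ring
  rcases le_or_gt b a' with hba | hba
  · rw [disj b hab hba, overlap, max_eq_left]
    · ring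
    · have := min_le_left b b'
      have := le_max_right a a'
      linarith
  · have hsplit : ∀ ω, (X ω * increment μ P W a b h ω) * (X' ω * increment μ P W a' b' h' ω) =
        (X ω * increment μ P W a a' h ω) * (X' ω * increment μ P W a' b' h' ω) +
        (X ω * increment μ P W a' b h ω) * (X' ω * increment μ P W a' b' h' ω) := by
      intro ω
      rw [← increment_add a a' b h ω]; ring
    have m1 : ∀ c d, MemLp (fun ω => X ω * increment μ P W c d h ω) 2 P := fun c d =>
      memLp_bdd_mul hX0 hb (memLp_increment c d h)
    have m2 : MemLp (fun ω => X' ω * increment μ P W a' b' h' ω) 2 P :=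
      memLp_bdd_mul hX0' hb' (memLp_increment a' b' h')
    have m3 : ∀ c d, Integrable (fun ω =>
        (X ω * increment μ P W c d h ω) * (X' ω * increment μ P W a' b' h' ω)) P := fun c d =>
      (m1 c d).integrable_mul m2
    simp_rw [hsplit]
    rw [integral_add (m3 a a') (m3 a' b),
      disj a' haa le_rfl, zero_add, overlap, max_eq_right haa,
      max_eq_right (sub_nonneg.2 (le_min hba.le hab'))]
    rcases le_total b b' with hbb | hbb
    · rw [integral_pair_of_start_eq hW hμ ha' hba.le hbb h h' hXa hX' hb hb', min_eq_left hbb]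
    · have := integral_pair_of_start_eq hW hμ ha' hab' hbb h' h hX' hXa hb' hb
      rw [min_eq_right hbb, real_inner_comm]
      rw [← integral_congr_ae (.of_forall fun ω => mul_comm (X' ω) (X ω)), ← this]
      exact integral_congr_ae (.of_forall fun ω => mul_comm _ _)

lemma integral_pair [P.IsComplete] (hW : IsGaussianNoise Λ P W)
    (hμ : IsSpectralMeasure Λ μ) {a b a' b' : ℝ} (ha : 0 ≤ a) (hab : a ≤ b) (ha' : 0 ≤ a')
    (hab' : a' ≤ b') (h h' : U μ) {X X' : Ω → ℝ} (hX : Measurable[sigmaField μ P W a] X)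
    (hX' : Measurable[sigmaField μ P W a'] X') (hb : ∃ C : ℝ, ∀ ω, |X ω| ≤ C)
    (hb' : ∃ C : ℝ, ∀ ω, |X' ω| ≤ C) :
    ∫ ω, (X ω * increment μ P W a b h ω) * (X' ω * increment μ P W a' b' h' ω) ∂P =
      (∫ ω, X ω * X' ω ∂P) * (overlap a b a' b' * inner ℝ h h') := by
  rcases le_total a a' with haa | haa
  · exact integral_pair_of_start_le hW hμ ha hab haa hab' h h' hX hX' hb hb'
  · have := integral_pair_of_start_le hW hμ ha' hab' haa hab h' h hX' hX hb' hb
    rw [real_inner_comm, overlap, min_comm b, max_comm a, ← overlap]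
    rw [← integral_congr_ae (.of_forall fun ω => mul_comm (X' ω) (X ω)), ← this]
    exact integral_congr_ae (.of_forall fun ω => mul_comm _ _)

end Increment

/-! ### Density of indicators of a π-system in `L²`. -/

section Density

variable {α : Type*} {m : MeasurableSpace α} {ν : Measure α}

lemma memLp_of_mem_span_indicator [IsFiniteMeasure ν] {C : Set (Set α)}
    (hC : ∀ s ∈ C, MeasurableSet s) {f : α → ℝ}
    (hf : f ∈ Submodule.span ℝ {f | ∃ s ∈ C, f = s.indicator fun _ => (1 : ℝ)}) :
    StronglyMeasurable f ∧ MemLp f 2 ν := by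
  induction hf using Submodule.span_induction with
  | mem f hf =>
    obtain ⟨s, hs, rfl⟩ := hf
    exact ⟨stronglyMeasurable_const.indicator (hC s hs), (memLp_const 1).indicator (hC s hs)⟩
  | zero => exact ⟨stronglyMeasurable_zero, MemLp.zero⟩
  | add f g _ _ hf hg => exact ⟨hf.1.add hg.1, hf.2.add hg.2⟩
  | smul c f _ hf => exact ⟨hf.1.const_smul c, hf.2.const_smul c⟩

/-- The sets over which f integrates to 0 form a λ-system; the total integral is needed for
complements. -/
lemma ae_eq_zero_of_forall_piSystem {C : Set (Set α)} (hm : m = MeasurableSpace.generateFrom C)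
    (hpi : IsPiSystem C) {f : α → ℝ} (hf : Integrable f ν) (h0 : ∫ x, f x ∂ν = 0)
    (h : ∀ s ∈ C, ∫ x in s, f x ∂ν = 0) : f =ᵐ[ν] 0 := by
  refine hf.ae_eq_zero_of_forall_setIntegral_eq_zero fun s hs _ => ?_
  clear * - hm hpi hf h0 h hs
  induction s, hs using MeasurableSpace.induction_on_inter hm hpi with
  | empty => simp
  | basic s hs => exact h s hs
  | compl s hs ih =>
    have := integral_add_compl hs hf
    simp_all
  | iUnion t hd ht ih =>
    rw [integral_iUnion ht hd hf.integrableOn]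
    simp [ih]

/-- Linear combinations of indicators of sets of a generating `π`-system are dense in `L²`. -/
lemma exists_mem_span_indicator_eLpNorm_lt [IsFiniteMeasure ν] {C : Set (Set α)}
    (hm : m = MeasurableSpace.generateFrom C) (hpi : IsPiSystem C)
    (hone : ∃ s ∈ C, s =ᵐ[ν] Set.univ) {f : α → ℝ} (hf : MemLp f 2 ν) {ε : ℝ≥0∞} (hε : 0 < ε) :
    ∃ g ∈ Submodule.span ℝ {f | ∃ s ∈ C, f = s.indicator fun _ => (1 : ℝ)},
      eLpNorm (g - f) 2 ν < ε := by
  have hC : ∀ s ∈ C, MeasurableSet s := fun s hs => by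
    rw [hm]; exact MeasurableSpace.measurableSet_generateFrom hs
  set V := Submodule.span ℝ {f : α → ℝ | ∃ s ∈ C, f = s.indicator fun _ => (1 : ℝ)} with hV
  let K : Submodule ℝ (Lp ℝ 2 ν) :=
    { carrier := {u | ∃ g ∈ V, u =ᵐ[ν] g}
      add_mem' := by
        rintro u v ⟨g, hg, hu⟩ ⟨g', hg', hv⟩
        exact ⟨g + g', V.add_mem hg hg', (Lp.coeFn_add u v).trans (hu.add hv)⟩
      zero_mem' := ⟨0, V.zero_mem, Lp.coeFn_zero _ _ _⟩
      smul_mem' := by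
        rintro c u ⟨g, hg, hu⟩
        exact ⟨c • g, V.smul_mem c hg, (Lp.coeFn_smul c u).trans (hu.const_smul c)⟩ }
  -- Density means trivial orthogonal complement, and orthogonality to indicators is vanishing of
  -- the integrals over the π-system.
  have hK : K.topologicalClosure = ⊤ := by
    rw [Submodule.topologicalClosure_eq_top_iff, Submodule.eq_bot_iff]
    intro u hu
    have hui : Integrable u ν := (Lp.memLp u).integrable (by norm_num)
    have hset : ∀ s ∈ C, ∫ x in s, u x ∂ν = 0 := by
      intro s hs
      have hmem : indicatorConstLp 2 (hC s hs) (measure_ne_top ν s) (1 : ℝ) ∈ K :=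
        ⟨_, Submodule.subset_span ⟨s, hs, rfl⟩, indicatorConstLp_coeFn⟩
      have := (Submodule.mem_orthogonal K u).1 hu _ hmem
      rwa [L2.inner_indicatorConstLp_one] at this
    obtain ⟨s, hs, hsu⟩ := hone
    have h0 : ∫ x, u x ∂ν = 0 := by
      rw [← hset s hs, setIntegral_congr_set hsu, setIntegral_univ]
    refine Lp.ext ?_
    exact (ae_eq_zero_of_forall_piSystem hm hpi hui h0 hset).trans (Lp.coeFn_zero _ _ _).symm
  have hmem : hf.toLp f ∈ closure (K : Set (Lp ℝ 2 ν)) := by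
    rw [← Submodule.topologicalClosure_coe, hK]; trivial
  obtain ⟨u, ⟨g, hg, hug⟩, hu⟩ := EMetric.mem_closure_iff.1 hmem ε hε
  refine ⟨g, hg, ?_⟩
  rw [edist_comm, Lp.edist_def] at hu
  refine lt_of_eq_of_lt (eLpNorm_congr_ae ?_) hu
  exact (hug.sub hf.coeFn_toLp).symm

end Density

/-! ### Lebesgue measure on the time interval. -/

section Lebesgue

variable {T : ℝ}

lemma lebesgue_preimage (s : Set ℝ) :
    lebesgue T (Subtype.val ⁻¹' s) = volume (s ∩ Set.Icc 0 T) := by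
  rw [lebesgue, comap_subtype_coe_apply measurableSet_Icc, Subtype.image_preimage_coe,
    Set.inter_comm]

instance instIsFiniteMeasureLebesgue : IsFiniteMeasure (lebesgue T) := by
  refine ⟨?_⟩
  have := lebesgue_preimage (T := T) Set.univ
  rw [Set.preimage_univ, Set.univ_inter] at this
  rw [this]
  exact measure_Icc_lt_top

lemma integral_indicator_mul_indicator {a b a' b' : ℝ} (ha : 0 ≤ a) (hb : b ≤ T) :
    ∫ t : Time T, (Set.Ioc a b).indicator (fun _ => (1 : ℝ)) (t : ℝ) *
      (Set.Ioc a' b').indicator (fun _ => (1 : ℝ)) (t : ℝ) ∂(lebesgue T) = overlap a b a' b' := by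
  have e : ∀ t : Time T, (Set.Ioc a b).indicator (fun _ => (1 : ℝ)) (t : ℝ) *
      (Set.Ioc a' b').indicator (fun _ => (1 : ℝ)) (t : ℝ) =
      (Subtype.val ⁻¹' (Set.Ioc a b ∩ Set.Ioc a' b')).indicator (fun _ : Time T => (1 : ℝ)) t := by
    intro t
    by_cases h1 : (t : ℝ) ∈ Set.Ioc a b <;> by_cases h2 : (t : ℝ) ∈ Set.Ioc a' b' <;>
      simp [Set.indicator, h1, h2, -Set.mem_Ioc]
  simp_rw [e]
  have hm : MeasurableSet (Set.Ioc a b ∩ Set.Ioc a' b') := measurableSet_Ioc.inter measurableSet_Ioc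
  rw [integral_indicator (measurable_subtype_coe hm), setIntegral_const, smul_eq_mul, mul_one,
    measureReal_def, lebesgue_preimage, Set.inter_eq_left.2, Set.Ioc_inter_Ioc, Real.volume_Ioc,
    ENNReal.toReal_ofReal', max_comm]
  · rfl
  · exact fun t ht => ⟨ha.trans ht.1.1.le, ht.1.2.trans hb⟩

end Lebesgue

/-! ### Simple processes and their isometry. -/

section Simple

variable {p : ℕ} [Fact p.Prime] {N : ℕ} {μ : Measure (Space p N)}
  {Ω : Type*} [MeasurableSpace Ω] {P : Measure Ω} {W : NoiseTest p N → Ω → ℝ} {T : ℝ}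

lemma indicator_eq_mul (s : Set ℝ) (c t : ℝ) :
    s.indicator (fun _ => c) t = s.indicator (fun _ => (1 : ℝ)) t * c := by
  by_cases h : t ∈ s <;> simp [h]

lemma SimpleProcess.integral_eq (S : SimpleProcess μ P W T) (h : U μ) (ω : Ω) :
    S.integral h ω = ∑ k, S.X k ω * increment μ P W (S.a k) (S.b k) h ω := rfl

lemma SimpleProcess.eval_eq (S : SimpleProcess μ P W T) (q : Time T × Ω) :
    S.eval q = ∑ k, (Set.Ioc (S.a k) (S.b k)).indicator (fun _ => (1 : ℝ)) (q.1 : ℝ) *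
      S.X k q.2 :=
  Finset.sum_congr rfl fun _ _ => indicator_eq_mul _ _ _

lemma SimpleProcess.measurable_X [P.IsComplete] (S : SimpleProcess μ P W T) (k) : Measurable (S.X k) :=
  (S.meas k).mono (sigmaField_le _) le_rfl

lemma SimpleProcess.memLp_integral [P.IsComplete] (S : SimpleProcess μ P W T) (h : U μ) :
    MemLp (S.integral h) 2 P := by
  refine memLp_finsetSum (f := fun k ω => S.X k ω * increment μ P W (S.a k) (S.b k) h ω)
    Finset.univ fun k _ => ?_
  exact memLp_bdd_mul (S.measurable_X k) (S.bdd k) (memLp_increment _ _ h)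

variable [IsProbabilityMeasure P] [P.IsComplete]

lemma SimpleProcess.memLp_term (S : SimpleProcess μ P W T) (k) :
    MemLp (fun q : Time T × Ω => (Set.Ioc (S.a k) (S.b k)).indicator (fun _ => (1 : ℝ)) (q.1 : ℝ) *
      S.X k q.2) 2 ((lebesgue T).prod P) := by
  refine memLp_of_bdd ?_ ?_ 2
  · refine Measurable.mul ?_ ((S.measurable_X k).comp measurable_snd)
    exact (measurable_const.indicator measurableSet_Ioc).comp
      (measurable_subtype_coe.comp measurable_fst)
  · refine bdd_mul ⟨1, fun q => ?_⟩ ?_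
    · by_cases hq : (q.1 : ℝ) ∈ Set.Ioc (S.a k) (S.b k) <;> simp [hq, -Set.mem_Ioc]
    · obtain ⟨C, hC⟩ := S.bdd k
      exact ⟨C, fun q => hC q.2⟩

lemma SimpleProcess.memLp_eval (S : SimpleProcess μ P W T) :
    MemLp S.eval 2 ((lebesgue T).prod P) := by
  have e : S.eval = fun q => ∑ k, (Set.Ioc (S.a k) (S.b k)).indicator (fun _ => (1 : ℝ)) (q.1 : ℝ) *
      S.X k q.2 := funext S.eval_eq
  rw [e]
  exact memLp_finsetSum Finset.univ fun k _ => S.memLp_term k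

lemma SimpleProcess.integral_eval_mul_eval (S S' : SimpleProcess μ P W T) :
    ∫ q, S.eval q * S'.eval q ∂((lebesgue T).prod P) = ∑ k, ∑ k',
      overlap (S.a k) (S.b k) (S'.a k') (S'.b k') * ∫ ω, S.X k ω * S'.X k' ω ∂P := by
  simp_rw [S.eval_eq, S'.eval_eq, Finset.sum_mul_sum]
  have hi : ∀ k k', Integrable (fun q : Time T × Ω =>
      ((Set.Ioc (S.a k) (S.b k)).indicator (fun _ => (1 : ℝ)) (q.1 : ℝ) * S.X k q.2) *
      ((Set.Ioc (S'.a k') (S'.b k')).indicator (fun _ => (1 : ℝ)) (q.1 : ℝ) * S'.X k' q.2))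
      ((lebesgue T).prod P) := fun k k' => (S.memLp_term k).integrable_mul (S'.memLp_term k')
  rw [integral_finsetSum _ fun k _ => integrable_finsetSum _ fun k' _ => hi k k']
  refine Finset.sum_congr rfl fun k _ => ?_
  rw [integral_finsetSum _ fun k' _ => hi k k']
  refine Finset.sum_congr rfl fun k' _ => ?_
  rw [← integral_indicator_mul_indicator (a' := S'.a k') (b' := S'.b k') (S.nonneg k) (S.le k),
    ← integral_prod_mul]
  congr 1 with q
  ring

/-- The isometry is kept bilinear, with two integrands and two directions, because the series over a
basis compares different directions. -/
lemma SimpleProcess.integral_integral_mul_integral [IsFiniteMeasureOnCompacts μ]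
    {Λ : Measure (Space p N)} (hW : IsGaussianNoise Λ P W) (hμ : IsSpectralMeasure Λ μ)
    (S S' : SimpleProcess μ P W T) (h h' : U μ) :
    ∫ ω, S.integral h ω * S'.integral h' ω ∂P =
      inner ℝ h h' * ∫ q, S.eval q * S'.eval q ∂((lebesgue T).prod P) := by
  rw [S.integral_eval_mul_eval S', Finset.mul_sum]
  simp_rw [SimpleProcess.integral_eq, Finset.sum_mul_sum]
  have hi : ∀ k k', Integrable (fun ω => (S.X k ω * increment μ P W (S.a k) (S.b k) h ω) *
      (S'.X k' ω * increment μ P W (S'.a k') (S'.b k') h' ω)) P := fun k k' =>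
    (memLp_bdd_mul (S.measurable_X k) (S.bdd k) (memLp_increment _ _ h)).integrable_mul
      (memLp_bdd_mul (S'.measurable_X k') (S'.bdd k') (memLp_increment _ _ h'))
  rw [integral_finsetSum _ fun k _ => integrable_finsetSum _ fun k' _ => hi k k']
  refine Finset.sum_congr rfl fun k _ => ?_
  rw [integral_finsetSum _ fun k' _ => hi k k', Finset.mul_sum]
  refine Finset.sum_congr rfl fun k' _ => ?_
  rw [integral_pair hW hμ (S.nonneg k) (S.lt k).le (S'.nonneg k') (S'.lt k').le h h' (S.meas k)
    (S'.meas k') (S.bdd k) (S'.bdd k')]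
  ring

end Simple

/-! ### Simple processes approximate predictable ones. -/

section Approximation

variable {p : ℕ} [Fact p.Prime] {N : ℕ} {μ : Measure (Space p N)}
  {Ω : Type*} [MeasurableSpace Ω] {P : Measure Ω} {W : NoiseTest p N → Ω → ℝ} {T : ℝ}

variable (μ P W T) in
/-- The rectangles that generate the predictable `σ`-field. -/
def rectangles : Set (Set (Time T × Ω)) :=
  {S | ∃ (s t : ℝ) (A : Set Ω), 0 ≤ s ∧ s < t ∧ t ≤ T ∧
    MeasurableSet[sigmaField μ P W s] A ∧ S = {q | s < q.1 ∧ (q.1 : ℝ) ≤ t ∧ q.2 ∈ A}}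

/-- The intersection starts at the later left endpoint, where both events are already observable; a
common point shows that its time interval is not degenerate. -/
lemma isPiSystem_rectangles : IsPiSystem (rectangles μ P W T) := by
  rintro _ ⟨s, t, A, hs, hst, ht, hA, rfl⟩ _ ⟨s', t', A', hs', hst', ht', hA', rfl⟩ ⟨q, hq, hq'⟩
  refine ⟨max s s', min t t', A ∩ A', le_max_of_le_left hs, ?_, min_le_of_left_le ht, ?_, ?_⟩
  · exact (max_lt hq.1 hq'.1).trans_le (le_min hq.2.1 hq'.2.1)
  · exact MeasurableSet.inter (sigmaField_mono (le_max_left _ _) _ hA)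
      (sigmaField_mono (le_max_right _ _) _ hA')
  · ext q
    simp only [Set.mem_inter_iff, Set.mem_ofPred_eq, max_lt_iff, le_min_iff]
    tauto

lemma predictable_le [P.IsComplete] :
    predictable μ P W T ≤ (inferInstance : MeasurableSpace (Time T × Ω)) := by
  refine MeasurableSpace.generateFrom_le ?_
  rintro _ ⟨s, t, A, hs, hst, ht, hA, rfl⟩
  have h1 : MeasurableSet {r : Time T | s < r ∧ (r : ℝ) ≤ t} :=
    measurable_subtype_coe (measurableSet_Ioc (a := s) (b := t))
  have h2 := h1.prod (sigmaField_le s A hA)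
  convert h2 using 1
  ext q
  simp [and_assoc]

/-- The zero process. -/
def SimpleProcess.zero : SimpleProcess μ P W T where
  n := 0
  a := Fin.elim0
  b := Fin.elim0
  X := fun k => k.elim0
  nonneg := fun k => k.elim0
  lt := fun k => k.elim0
  le := fun k => k.elim0
  meas := fun k => k.elim0
  bdd := fun k => k.elim0

/-- The sum of two simple processes. -/
def SimpleProcess.add (S S' : SimpleProcess μ P W T) : SimpleProcess μ P W T where
  n := S.n + S'.n
  a := Fin.append S.a S'.a
  b := Fin.append S.b S'.b
  X := Fin.append S.X S'.X
  nonneg := fun k => by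
    refine Fin.addCases (fun i => ?_) (fun i => ?_) k <;> simp [S.nonneg, S'.nonneg]
  lt := fun k => by
    refine Fin.addCases (fun i => ?_) (fun i => ?_) k <;> simp [S.lt, S'.lt]
  le := fun k => by
    refine Fin.addCases (fun i => ?_) (fun i => ?_) k <;> simp [S.le, S'.le]
  meas := fun k => by
    refine Fin.addCases (fun i => ?_) (fun i => ?_) k
    · rw [Fin.append_left, Fin.append_left]; exact S.meas i
    · rw [Fin.append_right, Fin.append_right]; exact S'.meas i
  bdd := fun k => by
    refine Fin.addCases (fun i => ?_) (fun i => ?_) k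
    · simpa using S.bdd i
    · simpa using S'.bdd i

lemma SimpleProcess.eval_add (S S' : SimpleProcess μ P W T) :
    (S.add S').eval = S.eval + S'.eval := by
  ext q
  simp only [SimpleProcess.eval, Pi.add_apply]
  refine (Fin.sum_univ_add _).trans ?_
  simp [SimpleProcess.add]

/-- A scalar multiple of a simple process. -/
def SimpleProcess.smul (c : ℝ) (S : SimpleProcess μ P W T) : SimpleProcess μ P W T where
  n := S.n
  a := S.a
  b := S.b
  X := fun k ω => c * S.X k ω
  nonneg := S.nonneg
  lt := S.lt
  le := S.le
  meas := fun k => (S.meas k).const_mul c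
  bdd := fun k => by
    obtain ⟨C, hC⟩ := S.bdd k
    exact ⟨|c| * C, fun ω => by
      rw [abs_mul]; exact mul_le_mul_of_nonneg_left (hC ω) (abs_nonneg c)⟩

lemma SimpleProcess.eval_smul (c : ℝ) (S : SimpleProcess μ P W T) :
    (S.smul c).eval = c • S.eval := by
  ext q
  simp only [SimpleProcess.eval_eq, Pi.smul_apply, smul_eq_mul, Finset.mul_sum]
  refine Finset.sum_congr rfl fun k _ => ?_
  simp only [SimpleProcess.smul]
  ring

lemma exists_eval_eq_indicator {s : Set (Time T × Ω)} (hs : s ∈ rectangles μ P W T) :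
    ∃ S : SimpleProcess μ P W T, S.eval = s.indicator fun _ => (1 : ℝ) := by
  obtain ⟨a, b, A, ha, hab, hb, hA, rfl⟩ := hs
  refine ⟨⟨1, fun _ => a, fun _ => b, fun _ => A.indicator fun _ => 1, fun _ => ha, fun _ => hab,
    fun _ => hb, fun _ => measurable_const.indicator hA, fun _ => ⟨1, fun ω => ?_⟩⟩, ?_⟩
  · by_cases h : ω ∈ A <;> simp [h]
  · ext q
    simp only [SimpleProcess.eval, Finset.univ_unique, Finset.sum_singleton]
    by_cases h1 : a < (q.1 : ℝ) <;> by_cases h2 : (q.1 : ℝ) ≤ b <;> by_cases h3 : q.2 ∈ A <;>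
      simp [Set.indicator, h1, h2, h3]

lemma exists_eval_eq_of_mem_span {f : Time T × Ω → ℝ}
    (hf : f ∈ Submodule.span ℝ {f | ∃ s ∈ rectangles μ P W T, f = s.indicator fun _ => (1 : ℝ)}) :
    ∃ S : SimpleProcess μ P W T, S.eval = f := by
  induction hf using Submodule.span_induction with
  | mem f hf =>
    obtain ⟨s, hs, rfl⟩ := hf
    exact exists_eval_eq_indicator hs
  | zero => exact ⟨.zero, by ext q; simp [SimpleProcess.eval, SimpleProcess.zero]⟩
  | add f g _ _ hf hg =>
    obtain ⟨S, rfl⟩ := hf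
    obtain ⟨S', rfl⟩ := hg
    exact ⟨S.add S', S.eval_add S'⟩
  | smul c f _ hf =>
    obtain ⟨S, rfl⟩ := hf
    exact ⟨S.smul c, S.eval_smul c⟩

/-- Simple processes are dense among the square integrable predictable processes. -/
lemma exists_simpleProcess_eLpNorm_lt [IsProbabilityMeasure P] [P.IsComplete] (hT : 0 < T)
    {ψ : Time T × Ω → ℝ} (hψ : StronglyMeasurable[predictable μ P W T] ψ)
    (hψ2 : MemLp ψ 2 ((lebesgue T).prod P)) {ε : ℝ≥0∞} (hε : 0 < ε) :
    ∃ S : SimpleProcess μ P W T, eLpNorm (S.eval - ψ) 2 ((lebesgue T).prod P) < ε := by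
  have hle : predictable μ P W T ≤ (inferInstance : MeasurableSpace (Time T × Ω)) := predictable_le
  -- The rectangle (0, T] × Ω misses only {0} × Ω, which is null.
  have hone : ∃ s ∈ rectangles μ P W T, s =ᵐ[((lebesgue T).prod P).trim hle] Set.univ := by
    refine ⟨{q | 0 < (q.1 : ℝ) ∧ (q.1 : ℝ) ≤ T ∧ q.2 ∈ Set.univ},
      ⟨0, T, Set.univ, le_rfl, hT, le_rfl, MeasurableSet.univ, rfl⟩, ?_⟩
    have hmem : MeasurableSet[predictable μ P W T]
        {q : Time T × Ω | 0 < (q.1 : ℝ) ∧ (q.1 : ℝ) ≤ T ∧ q.2 ∈ Set.univ} :=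
      MeasurableSpace.measurableSet_generateFrom
        ⟨0, T, Set.univ, le_rfl, hT, le_rfl, MeasurableSet.univ, rfl⟩
    rw [ae_eq_univ, trim_measurableSet_eq hle hmem.compl]
    have e : {q : Time T × Ω | 0 < (q.1 : ℝ) ∧ (q.1 : ℝ) ≤ T ∧ q.2 ∈ Set.univ}ᶜ =
        (Subtype.val ⁻¹' {(0 : ℝ)}) ×ˢ Set.univ := by
      ext q
      have h1 := q.1.2.1
      have h2 := q.1.2.2
      simp [h2]
      constructor
      · intro h; exact le_antisymm h h1
      · intro h; exact h.le
    rw [e, Measure.prod_prod, lebesgue_preimage,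
      measure_mono_null Set.inter_subset_left Real.volume_singleton, zero_mul]
  -- Density is applied on the predictable σ-field with the trimmed measure, which leaves the norms
  -- of predictable functions unchanged.
  have hψt : @MemLp _ _ (predictable μ P W T) _ _ ψ 2 (((lebesgue T).prod P).trim hle) := by
    refine ⟨hψ.aestronglyMeasurable, ?_⟩
    rw [eLpNorm_trim hle hψ]
    exact hψ2.2
  obtain ⟨g, hg, hgε⟩ := @exists_mem_span_indicator_eLpNorm_lt _ (predictable μ P W T)
    (((lebesgue T).prod P).trim hle) _ (rectangles μ P W T) rfl isPiSystem_rectangles hone ψ hψt ε hε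
  obtain ⟨hgm, -⟩ := @memLp_of_mem_span_indicator _ (predictable μ P W T)
    (((lebesgue T).prod P).trim hle) _ (rectangles μ P W T)
    (fun s hs => MeasurableSpace.measurableSet_generateFrom hs) g hg
  obtain ⟨S, rfl⟩ := exists_eval_eq_of_mem_span hg
  refine ⟨S, ?_⟩
  rwa [eLpNorm_trim hle (hgm.sub hψ)] at hgε

end Approximation

/-! ### Sequences with proportional Gram matrices. -/

section Limits

variable {H K : Type*} [NormedAddCommGroup H] [InnerProductSpace ℝ H]
  [NormedAddCommGroup K] [InnerProductSpace ℝ K]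

lemma norm_sub_eq_of_inner_eq {c : ℝ} (hc : 0 ≤ c) {x y : H} {x' y' : K}
    (hx : inner ℝ x x = c * inner ℝ x' x') (hy : inner ℝ y y = c * inner ℝ y' y')
    (hxy : inner ℝ x y = c * inner ℝ x' y') : ‖x - y‖ = √c * ‖x' - y'‖ := by
  rw [← sq_eq_sq₀ (norm_nonneg _) (by positivity), mul_pow, Real.sq_sqrt hc, norm_sub_sq_real,
    norm_sub_sq_real, ← real_inner_self_eq_norm_sq, ← real_inner_self_eq_norm_sq,
    ← real_inner_self_eq_norm_sq, ← real_inner_self_eq_norm_sq, hx, hy, hxy]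
  ring

lemma cauchySeq_of_inner_eq {c : ℝ} (hc : 0 ≤ c) {x : ℕ → H} {x' : ℕ → K}
    (h : ∀ i j, inner ℝ (x i) (x j) = c * inner ℝ (x' i) (x' j)) (hx' : CauchySeq x') :
    CauchySeq x := by
  rw [Metric.cauchySeq_iff'] at hx' ⊢
  intro ε hε
  -- The added 1 covers c = 0.
  obtain ⟨n, hn⟩ := hx' (ε / (√c + 1)) (by positivity)
  refine ⟨n, fun m hm => ?_⟩
  have := hn m hm
  rw [dist_eq_norm, lt_div_iff₀ (by positivity)] at this
  rw [dist_eq_norm, norm_sub_eq_of_inner_eq hc (h _ _) (h _ _) (h _ _)]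
  nlinarith [norm_nonneg (x' m - x' n)]

end Limits

/-! ### The scalar Itô integral. -/

section Ito

variable {p : ℕ} [Fact p.Prime] {N : ℕ} {μ : Measure (Space p N)}
  {Ω : Type*} [MeasurableSpace Ω] {P : Measure Ω} {W : NoiseTest p N → Ω → ℝ} {T : ℝ}
  [IsProbabilityMeasure P] [P.IsComplete]

lemma isItoIntegral_iff {h : U μ} {ψ : Time T × Ω → ℝ} (hψ : MemLp ψ 2 ((lebesgue T).prod P))
    {I : Lp ℝ 2 P} : IsItoIntegral μ P W T h ψ I ↔ ∃ S : ℕ → SimpleProcess μ P W T,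
      Tendsto (fun n => ((S n).memLp_eval).toLp (S n).eval) atTop (𝓝 (hψ.toLp ψ)) ∧
      Tendsto (fun n => ((S n).memLp_integral h).toLp ((S n).integral h)) atTop (𝓝 I) := by
  refine exists_congr fun S => and_congr ?_ ?_
  · exact (Lp.tendsto_Lp_iff_tendsto_eLpNorm'' _ _ _ _).symm
  · rw [Lp.tendsto_Lp_iff_tendsto_eLpNorm']
    refine tendsto_congr fun n => eLpNorm_congr_ae ?_
    exact ((((S n).memLp_integral h).coeFn_toLp).sub .rfl).symm

variable [IsFiniteMeasureOnCompacts μ] {Λ : Measure (Space p N)}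

lemma SimpleProcess.inner_toLp (hW : IsGaussianNoise Λ P W) (hμ : IsSpectralMeasure Λ μ)
    (S S' : SimpleProcess μ P W T) (h h' : U μ) :
    inner ℝ ((S.memLp_integral h).toLp (S.integral h))
        ((S'.memLp_integral h').toLp (S'.integral h')) =
      inner ℝ h h' * inner ℝ (S.memLp_eval.toLp S.eval) (S'.memLp_eval.toLp S'.eval) := by
  have e1 : inner ℝ ((S.memLp_integral h).toLp (S.integral h))
        ((S'.memLp_integral h').toLp (S'.integral h')) =
        ∫ ω, S.integral h ω * S'.integral h' ω ∂P := by
    rw [L2.inner_def]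
    refine integral_congr_ae ?_
    filter_upwards [(S.memLp_integral h).coeFn_toLp, (S'.memLp_integral h').coeFn_toLp] with ω h1 h2
    rw [h1, h2]
    exact mul_comm _ _
  have e2 : inner ℝ (S.memLp_eval.toLp S.eval) (S'.memLp_eval.toLp S'.eval) =
      ∫ q, S.eval q * S'.eval q ∂((lebesgue T).prod P) := by
    rw [L2.inner_def]
    refine integral_congr_ae ?_
    filter_upwards [S.memLp_eval.coeFn_toLp, S'.memLp_eval.coeFn_toLp] with ω h1 h2
    rw [h1, h2]
    exact mul_comm _ _
  rw [e1, e2]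
  exact S.integral_integral_mul_integral hW hμ S' _ _

/-- The Itô isometry. -/
lemma IsItoIntegral.inner_eq (hW : IsGaussianNoise Λ P W) (hμ : IsSpectralMeasure Λ μ)
    {h h' : U μ} {ψ ψ' : Time T × Ω → ℝ} (hψ : MemLp ψ 2 ((lebesgue T).prod P))
    (hψ' : MemLp ψ' 2 ((lebesgue T).prod P)) {I I' : Lp ℝ 2 P}
    (hI : IsItoIntegral μ P W T h ψ I) (hI' : IsItoIntegral μ P W T h' ψ' I') :
    inner ℝ I I' = inner ℝ h h' * inner ℝ (hψ.toLp ψ) (hψ'.toLp ψ') := by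
  obtain ⟨S, h1, h2⟩ := (isItoIntegral_iff hψ).1 hI
  obtain ⟨S', h1', h2'⟩ := (isItoIntegral_iff hψ').1 hI'
  refine tendsto_nhds_unique (h2.inner h2') ?_
  simp_rw [SimpleProcess.inner_toLp hW hμ]
  exact (h1.inner h1').const_mul _

lemma IsItoIntegral.unique (hW : IsGaussianNoise Λ P W) (hμ : IsSpectralMeasure Λ μ)
    {h : U μ} {ψ : Time T × Ω → ℝ} (hψ : MemLp ψ 2 ((lebesgue T).prod P)) {I I' : Lp ℝ 2 P}
    (hI : IsItoIntegral μ P W T h ψ I) (hI' : IsItoIntegral μ P W T h ψ I') : I = I' := by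
  have := norm_sub_eq_of_inner_eq (c := inner ℝ h h) real_inner_self_nonneg
    (hI.inner_eq hW hμ hψ hψ hI) (hI'.inner_eq hW hμ hψ hψ hI') (hI.inner_eq hW hμ hψ hψ hI')
  rwa [sub_self, norm_zero, mul_zero, norm_eq_zero, sub_eq_zero] at this

lemma exists_isItoIntegral (hW : IsGaussianNoise Λ P W) (hμ : IsSpectralMeasure Λ μ) (hT : 0 < T)
    (h : U μ) {ψ : Time T × Ω → ℝ} (hψm : StronglyMeasurable[predictable μ P W T] ψ)
    (hψ : MemLp ψ 2 ((lebesgue T).prod P)) : ∃ I : Lp ℝ 2 P, IsItoIntegral μ P W T h ψ I := by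
  have hex : ∀ n : ℕ, ∃ S : SimpleProcess μ P W T,
      eLpNorm (S.eval - ψ) 2 ((lebesgue T).prod P) < ((n : ℝ≥0∞) + 1)⁻¹ := fun n =>
    exists_simpleProcess_eLpNorm_lt hT hψm hψ (by simp)
  choose S hS using hex
  have hlim : Tendsto (fun n => eLpNorm ((S n).eval - ψ) 2 ((lebesgue T).prod P)) atTop (𝓝 0) := by
    refine tendsto_of_tendsto_of_tendsto_of_le_of_le tendsto_const_nhds ?_ (fun _ => zero_le)
      fun n => (hS n).le
    have := (tendsto_add_atTop_iff_nat 1).2 ENNReal.tendsto_inv_nat_nhds_zero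
    simpa using this
  have hL : Tendsto (fun n => ((S n).memLp_eval).toLp (S n).eval) atTop (𝓝 (hψ.toLp ψ)) :=
    (Lp.tendsto_Lp_iff_tendsto_eLpNorm'' _ _ _ _).2 hlim
  have hc := cauchySeq_of_inner_eq (c := inner ℝ h h) real_inner_self_nonneg
    (x := fun n => ((S n).memLp_integral h).toLp ((S n).integral h))
    (fun i j => (S i).inner_toLp hW hμ (S j) h h) hL.cauchySeq
  obtain ⟨I, hI⟩ := cauchySeq_tendsto_of_complete hc
  exact ⟨I, (isItoIntegral_iff hψ).2 ⟨S, hL, hI⟩⟩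

end Ito

/-! ### Series over an orthonormal basis. -/

section Series

variable {H K L : Type*} [NormedAddCommGroup H] [InnerProductSpace ℝ H]
  [NormedAddCommGroup K] [InnerProductSpace ℝ K] [NormedAddCommGroup L] [InnerProductSpace ℝ L]

lemma norm_sum_sq_of_pairwise_inner_eq_zero {ι : Type*} {J : ι → K}
    (hJ : Pairwise fun i j => inner ℝ (J i) (J j) = 0) (s : Finset ι) :
    ‖∑ i ∈ s, J i‖ ^ 2 = ∑ i ∈ s, ‖J i‖ ^ 2 := by
  rw [← real_inner_self_eq_norm_sq, sum_inner]
  refine Finset.sum_congr rfl fun i hi => ?_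
  rw [inner_sum, Finset.sum_eq_single_of_mem i hi fun j _ hj => hJ hj.symm,
    real_inner_self_eq_norm_sq]

lemma summable_of_pairwise_inner_eq_zero [CompleteSpace K] {ι : Type*} {J : ι → K}
    (hJ : Pairwise fun i j => inner ℝ (J i) (J j) = 0) {C : ℝ}
    (hC : ∀ s : Finset ι, ∑ i ∈ s, ‖J i‖ ^ 2 ≤ C) : Summable J := by
  have hs : Summable fun i => ‖J i‖ ^ 2 :=
    summable_of_sum_le (fun _ => by positivity) hC
  rw [summable_iff_vanishing_norm] at hs ⊢
  intro ε hε
  obtain ⟨s, hs⟩ := hs (ε ^ 2) (by positivity)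
  refine ⟨s, fun t ht => ?_⟩
  have h := hs t ht
  rw [← norm_sum_sq_of_pairwise_inner_eq_zero hJ, Real.norm_of_nonneg (by positivity)] at h
  exact lt_of_pow_lt_pow_left₀ 2 hε.le h

variable {A : H →L[ℝ] L} {J : H → K}

/-- Termwise ⟨J h, J e_i⟩ = ⟨A h, A(⟨e_i, h⟩ e_i)⟩, and these sum to ⟨A h, A h⟩ by expanding h. The
result does not mention the basis. -/
lemma hasSum_inner_series (hJ : ∀ h h', inner ℝ (J h) (J h') = inner ℝ h h' * inner ℝ (A h) (A h'))
    {ι : Type*} (e : HilbertBasis ι ℝ H) {I : K} (hI : HasSum (fun i => J (e i)) I) (h : H) :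
    inner ℝ I (J h) = ‖A h‖ ^ 2 := by
  have h1 : HasSum (fun i => inner ℝ (J h) (J (e i))) (inner ℝ (J h) I) :=
    hI.mapL (innerSL ℝ (J h))
  have h2 : HasSum (fun i => inner ℝ (A h) (A (e.repr h i • e i))) (inner ℝ (A h) (A h)) :=
    ((e.hasSum_repr h).mapL A).mapL (innerSL ℝ (A h))
  rw [real_inner_comm, ← real_inner_self_eq_norm_sq]
  refine h1.unique ?_
  convert h2 using 2 with i
  rw [hJ, map_smul, real_inner_smul_right, HilbertBasis.repr_apply_apply, real_inner_comm]

/-- A series over an orthonormal basis whose terms satisfy an Itô isometry converges, and its sum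
does not depend on the basis. -/
lemma exists_hasSum_series [CompleteSpace K]
    (hJ : ∀ h h', inner ℝ (J h) (J h') = inner ℝ h h' * inner ℝ (A h) (A h')) {C : ℝ}
    (hC : ∀ {ι : Type} {v : ι → H}, Orthonormal ℝ v → ∀ s : Finset ι, ∑ i ∈ s, ‖A (v i)‖ ^ 2 ≤ C)
    {ι₀ : Type} (e₀ : HilbertBasis ι₀ ℝ H) :
    ∃ I : K, ‖I‖ ^ 2 ≤ C ∧
      ∀ {ι : Type} (e : HilbertBasis ι ℝ H), HasSum (fun i => J (e i)) I := by
  have hnorm : ∀ h, ‖h‖ = 1 → ‖J h‖ ^ 2 = ‖A h‖ ^ 2 := fun h hh => by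
    rw [← real_inner_self_eq_norm_sq, hJ, real_inner_self_eq_norm_sq, real_inner_self_eq_norm_sq,
      hh, one_pow, one_mul]
  have horth : ∀ {ι : Type} (e : HilbertBasis ι ℝ H),
      Pairwise fun i j => inner ℝ (J (e i)) (J (e j)) = 0 := fun e i j hij => by
    change inner ℝ (J (e i)) (J (e j)) = 0
    rw [hJ, e.orthonormal.2 hij, zero_mul]
  have hC' : ∀ {ι : Type} (e : HilbertBasis ι ℝ H) (s : Finset ι), ∑ i ∈ s, ‖J (e i)‖ ^ 2 ≤ C :=
    fun e s => by
      rw [Finset.sum_congr rfl fun i _ => hnorm _ (e.orthonormal.1 i)]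
      exact hC e.orthonormal s
  have hsum : ∀ {ι : Type} (e : HilbertBasis ι ℝ H), Summable fun i => J (e i) := fun e =>
    summable_of_pairwise_inner_eq_zero (horth e) (hC' e)
  -- Expanding I' along the second basis, both inner products are the sum of ‖A f_j‖². By symmetry
  -- ‖I - I'‖² = 0.
  have hinner : ∀ {ι κ : Type} (e : HilbertBasis ι ℝ H) (f : HilbertBasis κ ℝ H) {I I' : K},
      HasSum (fun i => J (e i)) I → HasSum (fun i => J (f i)) I' →
      inner ℝ I I' = inner ℝ I' I' := fun e f I I' hI hI' => by
    have h1 := hI'.mapL (innerSL ℝ I)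
    have h2 := hI'.mapL (innerSL ℝ I')
    simp only [innerSL_apply_apply, hasSum_inner_series hJ e hI] at h1
    simp only [innerSL_apply_apply, hasSum_inner_series hJ f hI'] at h2
    exact h1.unique h2
  obtain ⟨I, hI⟩ := hsum e₀
  refine ⟨I, ?_, fun {ι} e => ?_⟩
  · refine le_of_tendsto ((hI : Tendsto _ _ _).norm.pow 2) (.of_forall fun s => ?_)
    rw [norm_sum_sq_of_pairwise_inner_eq_zero (horth e₀)]
    exact hC' e₀ s
  · obtain ⟨I', hI'⟩ := hsum e
    have h1 := hinner e₀ e hI hI'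
    have h2 := hinner e e₀ hI' hI
    have : I = I' := by
      rw [← sub_eq_zero, ← inner_self_eq_zero (𝕜 := ℝ), inner_sub_left, inner_sub_right,
        inner_sub_right, h1, h2]
      ring
    rwa [this]

end Series

/-! ### Coordinates of a square integrable vector process. -/

section Coordinates

variable {α : Type*} {m : MeasurableSpace α} {ν : Measure α}
  {H : Type*} [NormedAddCommGroup H] [InnerProductSpace ℝ H] {g : α → H}

lemma memLp_inner_const (hg : MemLp g 2 ν) (h : H) : MemLp (fun q => inner ℝ (g q) h) 2 ν := by
  refine (hg.norm.mul_const ‖h‖).mono (hg.1.inner aestronglyMeasurable_const)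
    (.of_forall fun q => ?_)
  rw [norm_mul, norm_norm, norm_norm]
  exact norm_inner_le_norm _ _

/-- The operator `h ↦ ⟨g, h⟩` from `H` to `L²`. -/
def coordinateL (hg : MemLp g 2 ν) : H →L[ℝ] Lp ℝ 2 ν :=
  LinearMap.mkContinuous
    { toFun := fun h => (memLp_inner_const hg h).toLp _
      map_add' := fun h h' => by
        rw [← MemLp.toLp_add]
        refine MemLp.toLp_congr _ _ (.of_forall fun q => ?_)
        exact inner_add_right _ _ _
      map_smul' := fun c h => by
        rw [RingHom.id_apply, ← MemLp.toLp_const_smul]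
        refine MemLp.toLp_congr _ _ (.of_forall fun q => ?_)
        exact real_inner_smul_right _ _ _ }
    ‖hg.toLp g‖ fun h => by
      rw [mul_comm]
      refine Lp.norm_le_mul_norm_of_ae_le_mul ?_
      filter_upwards [(memLp_inner_const hg h).coeFn_toLp, hg.coeFn_toLp] with q h1 h2
      change ‖((memLp_inner_const hg h).toLp _ : α → ℝ) q‖ ≤ _
      rw [h1, h2, mul_comm]
      exact norm_inner_le_norm _ _

lemma coordinateL_apply (hg : MemLp g 2 ν) (h : H) :
    coordinateL hg h = (memLp_inner_const hg h).toLp _ := rfl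

lemma norm_toLp_sq {E : Type*} [NormedAddCommGroup E] {f : α → E} (hf : MemLp f 2 ν) :
    ‖hf.toLp f‖ ^ 2 = ∫ q, ‖f q‖ ^ 2 ∂ν := by
  have hm : AEStronglyMeasurable (fun q => ‖f q‖ ^ 2) ν := hf.1.norm.pow 2
  rw [Lp.norm_toLp, ← ENNReal.toReal_pow, eLpNorm_two_sq, integral_eq_lintegral_of_nonneg_ae
    (.of_forall fun _ => by positivity) hm]
  congr 1
  refine lintegral_congr fun q => ?_
  rw [ENNReal.ofReal_pow (norm_nonneg _), ofReal_norm]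

/-- Bessel's inequality at each point, then integrated. -/
lemma sum_norm_coordinateL_sq_le (hg : MemLp g 2 ν) {ι : Type*} {v : ι → H}
    (hv : Orthonormal ℝ v) (s : Finset ι) :
    ∑ i ∈ s, ‖coordinateL hg (v i)‖ ^ 2 ≤ ‖hg.toLp g‖ ^ 2 := by
  have hi : ∀ i, Integrable (fun q => ‖inner ℝ (g q) (v i)‖ ^ 2) ν := fun i =>
    (memLp_inner_const hg (v i)).integrable_norm_pow (by norm_num)
  have hgi : Integrable (fun q => ‖g q‖ ^ 2) ν := hg.integrable_norm_pow (by norm_num)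
  simp_rw [coordinateL_apply, norm_toLp_sq]
  rw [← integral_finsetSum _ fun i _ => hi i]
  refine integral_mono (integrable_finsetSum _ fun i _ => hi i) hgi fun q => ?_
  refine le_trans (le_of_eq (Finset.sum_congr rfl fun i _ => ?_)) (hv.sum_inner_products_le (g q))
  rw [real_inner_comm]

end Coordinates

/-! ### The U-valued stochastic integral. -/

section StochasticIntegral

variable {p : ℕ} [Fact p.Prime] {N : ℕ} {μ : Measure (Space p N)}

instance instCompleteSpaceU : CompleteSpace (U μ) := by
  unfold U
  exact (Submodule.isClosed_topologicalClosure _).completeSpace_coe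

variable [IsFiniteMeasureOnCompacts μ]
  {Ω : Type*} [MeasurableSpace Ω] {P : Measure Ω} {W : NoiseTest p N → Ω → ℝ} {T : ℝ}
  [IsProbabilityMeasure P] [P.IsComplete] {Λ : Measure (Space p N)}

lemma stronglyMeasurable_inner_const {α H : Type*} {m : MeasurableSpace α} [NormedAddCommGroup H]
    [InnerProductSpace ℝ H] {g : α → H} (hg : StronglyMeasurable g) (h : H) :
    StronglyMeasurable fun q => inner ℝ (g q) h :=
  hg.inner stronglyMeasurable_const

/-- Existence, uniqueness and the isometric estimate for the stochastic integral of a square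
integrable predictable process. -/
lemma exists_isStochasticIntegral (hW : IsGaussianNoise Λ P W) (hμ : IsSpectralMeasure Λ μ)
    (hT : 0 < T) {g : Time T × Ω → U μ} (hgm : StronglyMeasurable[predictable μ P W T] g)
    (hg : MemLp g 2 ((lebesgue T).prod P)) :
    ∃ I : Lp ℝ 2 P, IsStochasticIntegral μ P W T g I ∧
      (∀ I', IsStochasticIntegral μ P W T g I' → I' = I) ∧
      ∫⁻ ω, ‖I ω‖ₑ ^ 2 ∂P ≤ ∫⁻ q, ‖g q‖ₑ ^ 2 ∂((lebesgue T).prod P) := by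
  have hex : ∀ h : U μ, ∃ I : Lp ℝ 2 P, IsItoIntegral μ P W T h (fun q => inner ℝ (g q) h) I :=
    fun h => exists_isItoIntegral hW hμ hT h
      (@stronglyMeasurable_inner_const _ (U μ) (predictable μ P W T) _ _ g hgm h)
      (memLp_inner_const (H := U μ) hg h)
  choose J hJ using hex
  obtain ⟨w, e₀, -⟩ := exists_hilbertBasis ℝ (U μ)
  obtain ⟨I, hIC, hI⟩ := exists_hasSum_series (H := U μ) (K := Lp ℝ 2 P)
    (L := Lp ℝ 2 ((lebesgue T).prod P)) (A := coordinateL hg) (J := J)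
    (fun h h' => (hJ h).inner_eq hW hμ (memLp_inner_const hg h) (memLp_inner_const hg h') (hJ h'))
    (C := ‖hg.toLp g‖ ^ 2) (fun hv s => sum_norm_coordinateL_sq_le hg hv s) e₀
  refine ⟨I, fun ι e => ⟨fun i => J (e i), fun i => hJ _, hI e⟩, fun I' hI' => ?_, ?_⟩
  -- One basis suffices for uniqueness: the scalar Itô integrals determine every term of the series.
  · obtain ⟨J', hJ', hs⟩ := hI' _ e₀
    have : J' = fun i => J (e₀ i) := funext fun i =>
      (hJ' i).unique hW hμ (memLp_inner_const (H := U μ) hg (e₀ i)) (hJ _)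
    rw [this] at hs
    exact hs.unique (hI e₀)
  · rw [← eLpNorm_two_sq, ← eLpNorm_two_sq]
    refine pow_le_pow_left' ?_ 2
    rw [Lp.norm_toLp, sq_le_sq₀ (norm_nonneg I) ENNReal.toReal_nonneg, Lp.norm_def] at hIC
    exact (ENNReal.toReal_le_toReal (Lp.eLpNorm_ne_top I) hg.2.ne).1 hIC

end StochasticIntegral

/-! ### The integrand Y(t, x) Γ(t, dx). -/

section Integrand

variable {p : ℕ} [Fact p.Prime] {N : ℕ} {μ : Measure (Space p N)}
  {Ω : Type*} [mΩ : MeasurableSpace Ω] {P : Measure Ω} {W : NoiseTest p N → Ω → ℝ} {T : ℝ}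

/-- For 0 ≤ x < T the set where time exceeds x is the generator (x, T] × Ω; for other x it is
everything or empty. Hence the point t = 0, absent from the generators, causes no trouble. -/
lemma measurable_fst_predictable :
    Measurable[predictable μ P W T] (Prod.fst : Time T × Ω → Time T) := by
  have h : Measurable[predictable μ P W T] fun q : Time T × Ω => (q.1 : ℝ) := by
    refine @measurable_of_Ioi _ _ _ _ _ (predictable μ P W T) _ _ _ _ fun x => ?_
    rcases lt_or_ge x 0 with hx | hx
    · convert @MeasurableSet.univ _ (predictable μ P W T)
      exact Set.eq_univ_of_forall fun q => hx.trans_le q.1.2.1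
    rcases lt_or_ge x T with hxT | hxT
    · refine MeasurableSpace.measurableSet_generateFrom
        ⟨x, T, Set.univ, hx, hxT, le_rfl, MeasurableSet.univ, ?_⟩
      ext q
      have := q.1.2.2
      simp [this]
    · convert @MeasurableSet.empty _ (predictable μ P W T)
      exact Set.eq_empty_of_forall_notMem fun q hq => (hq.trans_le q.1.2.2).not_ge hxT
  exact @Measurable.subtype_mk _ _ (predictable μ P W T) _ _ _ h fun q => q.1.2

variable {Γ : ℝ → Measure (Space p N)}

/-- The kernel `t ↦ Γ(t, dx)` on `[0, T]`. -/
def HypothesisA.kernel (hΓ : HypothesisA μ T Γ) : Kernel (Time T) (Space p N) where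
  toFun t := Γ t
  measurable' := hΓ.measurable.comp
    (Measurable.subtype_mk (p := fun t => t ∈ Set.Ici (0 : ℝ)) measurable_subtype_coe
      (h := fun t : Time T => t.2.1))

lemma HypothesisA.isFiniteKernel (hΓ : HypothesisA μ T Γ) (hT : 0 < T) :
    IsFiniteKernel hΓ.kernel :=
  ⟨⟨_, hΓ.sup_mass_lt_top T hT, fun t => le_iSup₂ (f := fun t (_ : t ∈ Set.Icc (0 : ℝ) T) =>
    Γ t Set.univ) (t : ℝ) t.2⟩⟩

lemma lintegral_enorm_le_one_add [IsProbabilityMeasure P] (X : Ω → ℝ) :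
    ∫⁻ ω, ‖X ω‖ₑ ∂P ≤ 1 + ∫⁻ ω, ‖X ω‖ₑ ^ 2 ∂P := by
  calc ∫⁻ ω, ‖X ω‖ₑ ∂P ≤ ∫⁻ ω, (1 + ‖X ω‖ₑ ^ 2) ∂P := lintegral_mono fun ω => by
        rcases le_total ‖X ω‖ₑ 1 with h | h
        · exact h.trans le_self_add
        · refine le_trans ?_ le_add_self
          calc ‖X ω‖ₑ = ‖X ω‖ₑ * 1 := (mul_one _).symm
            _ ≤ ‖X ω‖ₑ * ‖X ω‖ₑ := by gcongr
            _ = ‖X ω‖ₑ ^ 2 := (sq _).symm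
    _ = 1 + ∫⁻ ω, ‖X ω‖ₑ ^ 2 ∂P := by
        rw [lintegral_add_left measurable_const]; simp

variable {Y : Time T → Space p N → Ω → ℝ}

lemma IsPredictableField.measurable [P.IsComplete] (hY : IsPredictableField μ P W T Y) :
    Measurable fun z : (Time T × Ω) × Space p N => Y z.1.1 z.2 z.1.2 :=
  hY.mono (sup_le_sup_right (MeasurableSpace.comap_mono predictable_le) _) le_rfl

/-- For almost all `(t, ω)` the function `Y(t, ·, ω)` is integrable for `Γ(t)`. -/
lemma ae_integrable [IsProbabilityMeasure P] (κ : Kernel (Time T) (Space p N)) [IsFiniteKernel κ]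
    (hY : Measurable fun z : (Time T × Ω) × Space p N => Y z.1.1 z.2 z.1.2)
    (hY2 : (⨆ (t : Time T) (x : Space p N), ∫⁻ ω, ‖Y t x ω‖ₑ ^ 2 ∂P) < ⊤) :
    ∀ᵐ q ∂((lebesgue T).prod P), Integrable (fun x => Y q.1 x q.2) (κ q.1) := by
  set C := ⨆ (t : Time T) (x : Space p N), ∫⁻ ω, ‖Y t x ω‖ₑ ^ 2 ∂P with hC
  have hYe : Measurable fun z : (Time T × Ω) × Space p N => ‖Y z.1.1 z.2 z.1.2‖ₑ := hY.enorm
  have hm : Measurable fun q : Time T × Ω => ∫⁻ x, ‖Y q.1 x q.2‖ₑ ∂(κ q.1) :=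
    Measurable.lintegral_kernel_prod_right (κ := κ.comap Prod.fst measurable_fst)
      (f := fun q x => ‖Y q.1 x q.2‖ₑ) hYe
  -- The second moment controls the first through |X| ≤ 1 + X², and the masses are uniformly bounded
  -- in t.
  have hb : ∀ t, ∫⁻ ω, ∫⁻ x, ‖Y t x ω‖ₑ ∂(κ t) ∂P ≤ (1 + C) * κ.bound := by
    intro t
    have hs : Measurable (Function.uncurry fun (ω : Ω) (x : Space p N) => ‖Y t x ω‖ₑ) :=
      hYe.comp (f := fun z : Ω × Space p N => ((t, z.1), z.2))
        ((measurable_const.prodMk measurable_fst).prodMk measurable_snd)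
    rw [lintegral_lintegral_swap hs.aemeasurable]
    calc ∫⁻ x, ∫⁻ ω, ‖Y t x ω‖ₑ ∂P ∂(κ t) ≤ ∫⁻ _, (1 + C) ∂(κ t) := lintegral_mono fun x =>
          (lintegral_enorm_le_one_add _).trans (by
            gcongr
            exact le_iSup₂ (f := fun t x => ∫⁻ ω, ‖Y t x ω‖ₑ ^ 2 ∂P) t x)
      _ = (1 + C) * κ t Set.univ := lintegral_const _
      _ ≤ (1 + C) * κ.bound := by gcongr; exact Kernel.measure_le_bound _ _ _
  have hfin : ∫⁻ q, ∫⁻ x, ‖Y q.1 x q.2‖ₑ ∂(κ q.1) ∂((lebesgue T).prod P) ≠ ⊤ := by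
    rw [lintegral_prod _ hm.aemeasurable]
    refine ((lintegral_mono hb).trans_lt ?_).ne
    rw [lintegral_const]
    exact ENNReal.mul_lt_top (ENNReal.mul_lt_top (ENNReal.add_lt_top.2 ⟨ENNReal.one_lt_top, hY2⟩)
      κ.bound_lt_top) (measure_lt_top _ _)
  filter_upwards [ae_lt_top hm hfin] with q hq
  refine ⟨?_, hq⟩
  exact (hY.comp (f := fun x => (q, x)) measurable_prodMk_left).aestronglyMeasurable

/-- The σ-field on time × Ω' is left free so that the statement serves both predictability of G and
Fubini on the full product. -/
lemma measurable_fourier_field {Ω' : Type*} {Z : Time T → Space p N → Ω' → ℝ}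
    (κ : Kernel (Time T) (Space p N)) [IsFiniteKernel κ]
    (mα : MeasurableSpace (Time T × Ω')) (hfst : Measurable[mα] (Prod.fst : Time T × Ω' → Time T))
    (hZ : Measurable[mα.prod MeasurableSpace.pi]
      fun z : (Time T × Ω') × Space p N => Z z.1.1 z.2 z.1.2) :
    Measurable[mα.prod MeasurableSpace.pi] fun z : (Time T × Ω') × Space p N =>
      fourierMeasure (fun x => Z z.1.1 x z.1.2) (κ z.1.1) z.2 :=
  @measurable_fourierMeasure p _ N (Time T × Ω') mα (@Kernel.comap _ _ _ _ _ mα κ Prod.fst hfst) _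
    (fun q x => Z q.1 x q.2) hZ

lemma enorm_sq_of_ae_eq {u : U μ} {h : Space p N → ℂ} (hu : (u : Lp ℂ 2 μ) =ᵐ[μ] h) :
    ‖u‖ₑ ^ 2 = ∫⁻ ξ, ‖h ξ‖ₑ ^ 2 ∂μ := by
  have h1 : ‖u‖ₑ = eLpNorm (u : Lp ℂ 2 μ) 2 μ := Lp.enorm_def _
  rw [h1, eLpNorm_congr_ae hu, eLpNorm_two_sq]

lemma lintegral_sup_mul_le (hY2 : (⨆ (t : Time T) (x : Space p N), ∫⁻ ω, ‖Y t x ω‖ₑ ^ 2 ∂P) < ⊤) :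
    ∫⁻ t : Time T, (⨆ x : Space p N, ∫⁻ ω, ‖Y t x ω‖ₑ ^ 2 ∂P) *
        ∫⁻ ξ, ‖fourierPos (Γ t) ξ‖ₑ ^ 2 ∂μ ∂(lebesgue T) ≤
      (⨆ (t : Time T) (x : Space p N), ∫⁻ ω, ‖Y t x ω‖ₑ ^ 2 ∂P) *
        ∫⁻ t : Time T, ∫⁻ ξ, ‖fourierPos (Γ t) ξ‖ₑ ^ 2 ∂μ ∂(lebesgue T) := by
  rw [← lintegral_const_mul' _ _ hY2.ne]
  refine lintegral_mono fun t => ?_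
  gcongr
  exact le_iSup (fun t => ⨆ x : Space p N, ∫⁻ ω, ‖Y t x ω‖ₑ ^ 2 ∂P) t

lemma stronglyMeasurable_integrand [SFinite μ] [IsFiniteMeasureOnCompacts μ] (hT : 0 < T)
    (hΓ : HypothesisA μ T Γ) (hY : IsPredictableField μ P W T Y) :
    StronglyMeasurable[predictable μ P W T] (integrand μ Γ Y) := by
  have := hΓ.isFiniteKernel hT
  exact @stronglyMeasurable_ofFourier p _ N μ _ _ (predictable μ P W T) _
    (measurable_fourier_field hΓ.kernel (predictable μ P W T) measurable_fst_predictable hY)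

lemma measurable_lintegral_fourier_field [P.IsComplete] [SFinite μ] (hT : 0 < T)
    (hΓ : HypothesisA μ T Γ) (hY : IsPredictableField μ P W T Y) :
    Measurable fun q : Time T × Ω =>
      ∫⁻ ξ, ‖fourierMeasure (fun x => Y q.1 x q.2) (Γ q.1) ξ‖ₑ ^ 2 ∂μ := by
  have := hΓ.isFiniteKernel hT
  have hF := measurable_fourier_field hΓ.kernel _ measurable_fst hY.measurable
  exact (hF.enorm.pow_const 2).lintegral_prod_right'

variable [IsProbabilityMeasure P] [P.IsComplete] [SFinite μ] [IsFiniteMeasureOnCompacts μ]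
  {Λ : Measure (Space p N)}

/-- The fundamental estimate is applied at each fixed t. The supremum over x stays inside the time
integral, as the final bound on the stochastic integral requires. -/
lemma lintegral_fourier_field_le (hμ : IsSpectralMeasure Λ μ) (hT : 0 < T)
    (hΓ : HypothesisA μ T Γ) (hY : IsPredictableField μ P W T Y) :
    ∫⁻ q, ∫⁻ ξ, ‖fourierMeasure (fun x => Y q.1 x q.2) (Γ q.1) ξ‖ₑ ^ 2 ∂μ ∂((lebesgue T).prod P) ≤
      ∫⁻ t : Time T, (⨆ x : Space p N, ∫⁻ ω, ‖Y t x ω‖ₑ ^ 2 ∂P) *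
        ∫⁻ ξ, ‖fourierPos (Γ t) ξ‖ₑ ^ 2 ∂μ ∂(lebesgue T) := by
  have hfin := hΓ.isFiniteKernel hT
  rw [lintegral_prod _ (measurable_lintegral_fourier_field hT hΓ hY).aemeasurable]
  refine lintegral_mono fun t => ?_
  have : IsFiniteMeasure (Γ t) := hfin.isFiniteMeasure t
  exact lintegral_fourierMeasure_le P hμ (Y := fun ω x => Y t x ω)
    (hY.measurable.comp (f := fun z : Ω × Space p N => ((t, z.1), z.2))
      ((measurable_const.prodMk measurable_fst).prodMk measurable_snd))

/-- A finite total integral makes the transform square integrable for almost every (t, ω); there the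
choice in `ofFourier` is not the default 0. -/
lemma ae_integrand_eq (hμ : IsSpectralMeasure Λ μ) (hT : 0 < T)
    (hΓ : HypothesisA μ T Γ) (hY : IsPredictableField μ P W T Y)
    (hY2 : (⨆ (t : Time T) (x : Space p N), ∫⁻ ω, ‖Y t x ω‖ₑ ^ 2 ∂P) < ⊤) :
    ∀ᵐ q ∂((lebesgue T).prod P), Integrable (fun x => Y q.1 x q.2) (Γ q.1) ∧
      (integrand μ Γ Y q : Lp ℂ 2 μ) =ᵐ[μ] fourierMeasure (fun x => Y q.1 x q.2) (Γ q.1) := by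
  have hfin := hΓ.isFiniteKernel hT
  have hF := measurable_fourier_field hΓ.kernel _ measurable_fst hY.measurable
  have hlt : ∫⁻ q, ∫⁻ ξ, ‖fourierMeasure (fun x => Y q.1 x q.2) (Γ q.1) ξ‖ₑ ^ 2 ∂μ
      ∂((lebesgue T).prod P) ≠ ⊤ :=
    (((lintegral_fourier_field_le hμ hT hΓ hY).trans (lintegral_sup_mul_le hY2)).trans_lt
      (ENNReal.mul_lt_top hY2 hΓ.integral_lt_top)).ne
  filter_upwards [ae_integrable hΓ.kernel hY.measurable hY2,
    ae_lt_top (measurable_lintegral_fourier_field hT hΓ hY) hlt] with q hq1 hq2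
  have : IsFiniteMeasure (Γ q.1) := hfin.isFiniteMeasure q.1
  have hYq : Measurable fun x => Y q.1 x q.2 :=
    hY.measurable.comp (f := fun x => (q, x)) measurable_prodMk_left
  have hL : MemLp (fourierMeasure (fun x => Y q.1 x q.2) (Γ q.1)) 2 μ :=
    (memLp_two_iff (hF.comp (f := fun ξ => (q, ξ)) measurable_prodMk_left).aestronglyMeasurable).2
      hq2
  exact ⟨hq1, coeFn_ofFourier ⟨⟨_, toLp_fourierMeasure_mem hYq hq1 hL⟩, hL.coeFn_toLp⟩⟩

end Integrand

end PadicNoise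

end

theorem mainTheorem4 (p : ℕ) [Fact p.Prime] (N : ℕ)
    {Ω : Type*} [MeasurableSpace Ω] (P : Measure Ω) [IsProbabilityMeasure P] [P.IsComplete]
    (Λ μ : Measure (PadicNoise.Space p N)) [Λ.Regular] [μ.Regular]
    (hμ : PadicNoise.IsSpectralMeasure Λ μ)
    (W : PadicNoise.NoiseTest p N → Ω → ℝ) (hW : PadicNoise.IsGaussianNoise Λ P W)
    (T : ℝ) (hT : 0 < T)
    (Γ : ℝ → Measure (PadicNoise.Space p N)) (hΓ : PadicNoise.HypothesisA μ T Γ)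
    (Y : PadicNoise.Time T → PadicNoise.Space p N → Ω → ℝ)
    (hY : PadicNoise.IsPredictableField μ P W T Y)
    (hY2 : (⨆ (t : PadicNoise.Time T) (x : PadicNoise.Space p N),
      ∫⁻ ω, ‖Y t x ω‖ₑ ^ 2 ∂P) < ⊤) :
    -- the cylindrical Wiener process associated with `W` is well defined
    (∀ t : ℝ, 0 ≤ t → PadicNoise.IsWienerExtension μ P W t (PadicNoise.wiener μ P W t)) ∧
    -- almost everywhere, `Y(t) Γ(t)` is a finite signed measure that belongs to `U`
    (∀ᵐ q ∂((PadicNoise.lebesgue T).prod P),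
      Integrable (fun x => Y q.1 x q.2) (Γ q.1) ∧
      (PadicNoise.integrand μ Γ Y q : Lp ℂ 2 μ) =ᵐ[μ]
        PadicNoise.fourierMeasure (fun x => Y q.1 x q.2) (Γ q.1)) ∧
    -- `G` is predictable and square integrable
    StronglyMeasurable[PadicNoise.predictable μ P W T] (PadicNoise.integrand μ Γ Y) ∧
    MemLp (PadicNoise.integrand μ Γ Y) 2 ((PadicNoise.lebesgue T).prod P) ∧
    -- the norm of `G`
    ∫⁻ ω, ∫⁻ t, ‖PadicNoise.integrand μ Γ Y (t, ω)‖ₑ ^ 2 ∂(PadicNoise.lebesgue T) ∂P =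
      ∫⁻ ω, ∫⁻ t : PadicNoise.Time T, ∫⁻ ξ,
        ‖PadicNoise.fourierMeasure (fun x => Y t x ω) (Γ t) ξ‖ₑ ^ 2 ∂μ ∂(PadicNoise.lebesgue T) ∂P ∧
    ∫⁻ ω, ∫⁻ t, ‖PadicNoise.integrand μ Γ Y (t, ω)‖ₑ ^ 2 ∂(PadicNoise.lebesgue T) ∂P ≤
      (⨆ (t : PadicNoise.Time T) (x : PadicNoise.Space p N), ∫⁻ ω, ‖Y t x ω‖ₑ ^ 2 ∂P) *
        ∫⁻ t : PadicNoise.Time T, ∫⁻ ξ, ‖PadicNoise.fourierPos (Γ t) ξ‖ₑ ^ 2 ∂μ ∂(PadicNoise.lebesgue T) ∧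
    -- the stochastic integral `G · W` and its second moment
    ∃ I : Lp ℝ 2 P, PadicNoise.IsStochasticIntegral μ P W T (PadicNoise.integrand μ Γ Y) I ∧
      (∀ I', PadicNoise.IsStochasticIntegral μ P W T (PadicNoise.integrand μ Γ Y) I' →
        I' = I) ∧
      ∫⁻ ω, ‖I ω‖ₑ ^ 2 ∂P ≤
        ∫⁻ t : PadicNoise.Time T, (⨆ x : PadicNoise.Space p N, ∫⁻ ω, ‖Y t x ω‖ₑ ^ 2 ∂P) *
          ∫⁻ ξ, ‖PadicNoise.fourierPos (Γ t) ξ‖ₑ ^ 2 ∂μ ∂(PadicNoise.lebesgue T) := by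
  have hG := PadicNoise.stronglyMeasurable_integrand hT hΓ hY
  have hae := PadicNoise.ae_integrand_eq hμ hT hΓ hY hY2
  have hFle := PadicNoise.lintegral_fourier_field_le hμ hT hΓ hY
  have hsup := PadicNoise.lintegral_sup_mul_le (μ := μ) (Γ := Γ) hY2
  have hGe : Measurable fun q => ‖PadicNoise.integrand μ Γ Y q‖ₑ ^ 2 :=
    ((hG.mono PadicNoise.predictable_le).enorm).pow_const 2
  have hFe := (PadicNoise.measurable_lintegral_fourier_field hT hΓ hY).aemeasurable
    (μ := (PadicNoise.lebesgue T).prod P)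
  -- The norm of U is the `L²(μ)` norm of the transform, so this identity carries all bounds on
  -- ℱ(YΓ) over to G.
  have heq : ∫⁻ q, ‖PadicNoise.integrand μ Γ Y q‖ₑ ^ 2 ∂((PadicNoise.lebesgue T).prod P) =
      ∫⁻ q, ∫⁻ ξ, ‖PadicNoise.fourierMeasure (fun x => Y q.1 x q.2) (Γ q.1) ξ‖ₑ ^ 2 ∂μ
        ∂((PadicNoise.lebesgue T).prod P) :=
    lintegral_congr_ae (hae.mono fun q hq => PadicNoise.enorm_sq_of_ae_eq hq.2)
  have hswap := lintegral_prod_symm _ (hGe.aemeasurable (μ := (PadicNoise.lebesgue T).prod P))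
  have hswapF := lintegral_prod_symm _ hFe
  have hmem : MemLp (PadicNoise.integrand μ Γ Y) 2 ((PadicNoise.lebesgue T).prod P) := by
    refine (PadicNoise.memLp_two_iff
      (hG.mono PadicNoise.predictable_le).aestronglyMeasurable).2 ?_
    rw [heq]
    exact (hFle.trans hsup).trans_lt (ENNReal.mul_lt_top hY2 hΓ.integral_lt_top)
  obtain ⟨I, hI, huniq, hIle⟩ := PadicNoise.exists_isStochasticIntegral hW hμ hT hG hmem
  refine ⟨fun t ht => PadicNoise.isWienerExtension_wiener hW hμ ht, hae, hG, hmem, ?_, ?_,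
    I, hI, huniq, hIle.trans (heq.le.trans hFle)⟩
  · exact hswap.symm.trans (heq.trans hswapF)
  · exact hswap.symm.le.trans (heq.le.trans (hFle.trans hsup))
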